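/- **Setting.** Let $M$ be a smooth manifold (Hausdorff, $\sigma$-compact, without boundary). A *local $L_\infty$-algebra* on $M$ is the sheaf $\mathcal M$ of sections of a finite-rank $\mathbb Z$-graded vector bundle $E$ with poly-differential brackets $\ell_k$ ($k\ge 1$) of degree $2-k$, graded antisymmetric, satisfying for all $n\ge 1$ $$\sum_{k=1}^{n}\ \sum_{\sigma\in \mathrm{Sh}(k,n-k)} (-1)^{n-k}\chi(\sigma)\,\ell_{n-k+1}\big(\ell_k(v_{\sigma(1)},\dots,v_{\sigma(k)}),v_{\sigma(k+1)},\dots,v_{\sigma(n)}\big)=0,$$ where $\chi(\sigma)$ is the sign of $\sigma$ times the Koszul sign. It is *cyclic* (of degree $-3$) if it has a smooth, fibrewise non-degenerate, graded symmetric pairing $E\otimes E\to \mathrm{Dens}_M[-3]$ such that, with $\langle\cdot,\cdot\rangle$ its integral over $M$, $\langle \ell_n(\alpha_1,\dots,\alpha_n),\alpha_{n+1}\rangle$ is graded antisymmetric on compactly supported sections. If moreover only finitely many $\ell_k$ are nonzero, $\mathcal M$ *presents a classical BV theory*, with action $S_{\mathcal M}(\alpha)=\sum_{k}\frac1{(k+1)!}\langle\alpha,\ell_k(\alpha,\dots,\alpha)\rangle$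 on compactly supported sections. An *action* of a local $L_\infty$-algebra $\mathcal L$ on $\mathcal M$ is a local $L_\infty$-structure $\{\ell^\ltimes_k\}$ on $\mathcal L\oplus\mathcal M$ for which $0\to\mathcal M\to\mathcal L\oplus\mathcal M\to\mathcal L\to0$ is an exact sequence of sheaves of $L_\infty$-algebras and strict maps. It is an action *by classical symmetries* if * it is compatible with the pairing: for $s\ge1$ and compactly supported sections $X_i$ of $\mathcal L$ and $m_j$ of $\mathcal M$, $\langle \ell^\ltimes_{r+s}(X_1,\dots,X_r,m_1,\dots,m_s),m_{s+1}\rangle$ is graded antisymmetric in the $X_i$ and in $m_1,\dots,m_{s+1}$; and * it is Hamiltonian: there is a local functional $S^{\mathcal L}$, a degree-one element of $\mathrm{Ham}(\mathcal L,\mathcal M)=\ker\big(C^*_{\rm red,loc}(\mathcal L\oplus\mathcal M)[-1]\to C^*_{\rm red,loc}(\mathcal M)[-1]\big)$, which satisfies the Maurer–Cartan equation $d_{\mathcal L}S^{\mathcal L}+d_{\mathcal M}S^{\mathcal L}+\frac12\{S^{\mathcal L},S^{\mathcal L}\}=0$ and whose Hamiltonian vector field is the difference between the $\mathcal M$-component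 of $\ell^\ltimes$ and the brackets of $\mathcal M$; and $S^{\rm tot}=S^{\mathcal L}+S_{\mathcal M}$ satisfies the equivariant classical master equation $d_{\mathcal L}S^{\rm tot}+\frac12\{S^{\rm tot},S^{\rm tot}\}=0$ and equals $S_{\mathcal M}$ when the background field in $\mathcal L$ is zero. **Corollary.** Let the cyclic local $L_\infty$-algebra $\mathcal M$ present a classical BV theory. 1. $\mathcal M$ acts on this BV theory by classical symmetries through the *infinity adjoint action*, i.e. the brackets on $\mathcal M\oplus\mathcal M$ given, for $p_i=(X_i,u_i)$, by $$\ell_k^\ltimes(p_1,\dots,p_k)=\Big(\ell_k(X_1,\dots,X_k),\ \sum_{A\subsetneq\{1,\dots,k\}}\ell_k(p_1^A,\dots,p_k^A)\Big),\qquad p_i^A=\begin{cases}X_i& i\in A\\ u_i& i\notin A.\end{cases}$$ 2. Every local $L_\infty$-subalgebra $\mathcal H\subseteq\mathcal M$ (sections of a graded subbundle, closed under the brackets) acts on this BV theory by classical symmetries through the restriction of these brackets to $\mathcal H\oplus\mathcal M$. 3. The same holds for every, not necessarily local, $L_\infty$-subalgebra $\mathfrak h$ (graded subspace closed under the brackets)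 of the $L_\infty$-algebra of global sections of $\mathcal M$, acting on $\mathcal M$ by the restricted brackets on $\mathfrak h\oplus\mathcal M$. In this case locality is only required in the arguments from $\mathcal M$, the elements of $\mathfrak h$ may have arbitrary support, and functionals are taken on $\mathfrak h\oplus\mathcal M_c$, where $\mathcal M_c$ denotes the compactly supported sections. -/

import Mathlib

open scoped Manifold ContDiff Topology
open TopologicalSpace (Opens)

namespace LInf

noncomputable section

universe u v u' v' w

set_option linter.checkUnivs false

/-! ## Graded algebra: Koszul signs, `L∞`-algebras -/

section Algebra

variable {V W : Type*} [AddCommGroup V] [Module ℝ V] [AddCommGroup W] [Module ℝ W]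

/-- The graded antisymmetric sign `χ(σ; e)`, i.e. the sign of the permutation `σ` times the Koszul
sign of reordering `v₁ ⊗ ⋯ ⊗ vₙ` into `v_{σ(1)} ⊗ ⋯ ⊗ v_{σ(n)}`, for `vᵢ` of degree `eᵢ`:
the product over all inversions of `- (-1)^{|v||v'|}`. -/
def permSign {n : ℕ} (σ : Equiv.Perm (Fin n)) (e : Fin n → ℤ) : ℤˣ :=
  ∏ p : Fin n × Fin n with p.1 < p.2 ∧ σ p.2 < σ p.1, -Int.negOnePow (e (σ p.1) * e (σ p.2))

/-- The sign `χ(σ; e)` of the `(k, n - k)`-shuffle `σ` which lists the elements of `I` (in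
increasing order) and then those of the complement of `I` (in increasing order), `k = |I|`. -/
def shuffleSign {n : ℕ} (I : Finset (Fin n)) (e : Fin n → ℤ) : ℤˣ :=
  ∏ p : Fin n × Fin n with p.1 ∈ I ∧ p.2 ∉ I ∧ p.2 < p.1, -Int.negOnePow (e p.1 * e p.2)

/-- The insertion of the family of operations `g` into the family of operations `f`,
`∑_{k} ∑_{σ ∈ Sh(k, n-k)} (-1)^{n-k} χ(σ) f_{n-k+1}(g_k(v_{σ(1)}, …, v_{σ(k)}), v_{σ(k+1)}, …)`.
A `(k, n - k)`-shuffle is the same as its set `I` of first `k` values. -/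
def insertion (f : ∀ k : ℕ, (Fin k → V) → W) (g : ∀ k : ℕ, (Fin k → V) → V) (n : ℕ)
    (e : Fin n → ℤ) (v : Fin n → V) : W :=
  ∑ I : Finset (Fin n), (((Int.negOnePow (Iᶜ.card : ℤ) * shuffleSign I e : ℤˣ) : ℤ) : ℝ) •
    f (Iᶜ.card + 1) (Fin.cons (g I.card (fun i => v (I.orderEmbOfFin rfl i)))
      (fun j => v (Iᶜ.orderEmbOfFin rfl j)))

/-- A family of multilinear operations `ℓ_k : V^{⊗ k} → V`. -/
abbrev Brackets (V : Type*) [AddCommGroup V] [Module ℝ V] : Type _ :=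
  ∀ k : ℕ, MultilinearMap ℝ (fun _ : Fin k => V) V

/-- The operations `ℓ_k` (`k ≥ 1`; the slot `k = 0` is required to vanish, i.e. there is no
curvature) make the vector space `V` with the `ℤ`-grading `gr` an `L∞`-algebra. -/
structure IsLInfty (gr : ℤ → Submodule ℝ V) (ℓ : Brackets V) : Prop where
  isInternal : DirectSum.IsInternal gr
  uncurved : ℓ 0 = 0
  degree : ∀ (k : ℕ) (e : Fin k → ℤ) (v : Fin k → V), (∀ i, v i ∈ gr (e i)) →
    ℓ k v ∈ gr (∑ i, e i + 2 - k)
  antisymm : ∀ (k : ℕ) (σ : Equiv.Perm (Fin k)) (e : Fin k → ℤ) (v : Fin k → V),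
    (∀ i, v i ∈ gr (e i)) →
      ℓ k (fun i => v (σ i)) = (((permSign σ e : ℤˣ) : ℤ) : ℝ) • ℓ k v
  jacobi : ∀ (n : ℕ) (e : Fin n → ℤ) (v : Fin n → V), (∀ i, v i ∈ gr (e i)) →
    insertion (fun k => ℓ k) (fun k => ℓ k) n e v = 0

end Algebra

section InfinityAdjoint

variable {A N : Type*} [AddCommGroup A] [Module ℝ A] [AddCommGroup N] [Module ℝ N]

/-- The bracket `ℓ_k^⋉` of the infinity adjoint action, restricted along `j : A → N`: with
`p_i = (X_i, u_i)` and `p_i^S = j X_i` for `i ∈ S`, `p_i^S = u_i` for `i ∉ S`,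
`ℓ_k^⋉(p_1, …, p_k) = (ℓ_k(X_1, …, X_k), ∑_{S ⊊ {1, …, k}} ℓ_k(p_1^S, …, p_k^S))`. -/
def infAdj (ℓA : Brackets A) (ℓN : Brackets N) (j : A →ₗ[ℝ] N) : Brackets (A × N) := fun k =>
  (LinearMap.inl ℝ A N).compMultilinearMap
      ((ℓA k).compLinearMap fun _ => LinearMap.fst ℝ A N) +
    (LinearMap.inr ℝ A N).compMultilinearMap
      (∑ S : Finset (Fin k) with S ≠ Finset.univ, (ℓN k).compLinearMap fun i =>
        if i ∈ S then j ∘ₗ LinearMap.fst ℝ A N else LinearMap.snd ℝ A N)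

/-- The direct sum grading. -/
def prodGr (grA : ℤ → Submodule ℝ A) (grN : ℤ → Submodule ℝ N) : ℤ → Submodule ℝ (A × N) :=
  fun i => (grA i).prod (grN i)

/-- Functionals: a family of multilinear forms of each arity, i.e. Taylor components of a formal
power series on `(A ⊕ N)[1]`. -/
abbrev Functional (A N : Type*) [AddCommGroup A] [Module ℝ A] [AddCommGroup N] [Module ℝ N] :
    Type _ :=
  ∀ n : ℕ, MultilinearMap ℝ (fun _ : Fin n => A × N) ℝ

/-- `F` is a cochain of degree one in `Ham(A, N) = ker (C_red(A ⊕ N)[-1] → C_red(N)[-1])`, that is,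
a reduced cochain of degree `0` in `C(A ⊕ N)` which vanishes on `N`.
Symmetric forms on `(A ⊕ N)[1]` are written as graded antisymmetric forms on `A ⊕ N`, so a form of
arity `n` has degree `0` when it is supported on arguments of total degree `n`. -/
structure IsHamCochain (grA : ℤ → Submodule ℝ A) (grN : ℤ → Submodule ℝ N)
    (F : Functional A N) : Prop where
  reduced : F 0 = 0
  degree : ∀ (n : ℕ) (e : Fin n → ℤ) (p : Fin n → A × N),
    (∀ i, p i ∈ prodGr grA grN (e i)) → ∑ i, e i ≠ n → F n p = 0
  antisymm : ∀ (n : ℕ) (σ : Equiv.Perm (Fin n)) (e : Fin n → ℤ) (p : Fin n → A × N),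
    (∀ i, p i ∈ prodGr grA grN (e i)) →
      F n (fun i => p (σ i)) = (((permSign σ e : ℤˣ) : ℤ) : ℝ) * F n p
  vanish : ∀ (n : ℕ) (m : Fin n → N), F n (fun i => (0, m i)) = 0

/-- `X` is the Hamiltonian vector field of `F` in the direction of `N`:
`F_{k+1}(p_1, …, p_k, m) = ⟨X_k(p_1, …, p_k), m⟩`. By non-degeneracy of the pairing, it is
determined by `F`. -/
def IsHamVectorField (B : N → N → ℝ) (F : ∀ n : ℕ, (Fin n → A × N) → ℝ)
    (X : ∀ k : ℕ, (Fin k → A × N) → N) : Prop :=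
  ∀ (k : ℕ) (p : Fin k → A × N) (m : N),
    F (k + 1) (Fin.snoc (α := fun _ => A × N) p (0, m)) = B (X k p) m

/-- `d F + ½ {F, F} = 0`, evaluated on homogeneous arguments, for `F` of degree `0` with
Hamiltonian vector field `X`. Here `d` is the Chevalley-Eilenberg differential given by the
brackets `q` on `A ⊕ N`, i.e. `F` composed with the coderivation with components `q`, and
`{F, F}`, the bracket induced by the pairing on `N` (linear over the cochains of `A`), is `F`
composed with the coderivation with components `X`. -/
def MaurerCartan (grA : ℤ → Submodule ℝ A) (grN : ℤ → Submodule ℝ N)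
    (q : ∀ k : ℕ, (Fin k → A × N) → A × N) (F : ∀ n : ℕ, (Fin n → A × N) → ℝ)
    (X : ∀ k : ℕ, (Fin k → A × N) → N) : Prop :=
  ∀ (n : ℕ) (e : Fin n → ℤ) (p : Fin n → A × N), (∀ i, p i ∈ prodGr grA grN (e i)) →
    insertion F q n e p + (1 / 2 : ℝ) * insertion F (fun k p' => ((0 : A), X k p')) n e p = 0

/-- The brackets of the direct sum `A ⊕ N` of two `L∞`-algebras (no interaction); they give the
differential `d_A + d_N`. -/
def sumBrackets (ℓA : Brackets A) (ℓN : Brackets N) (k : ℕ) (p : Fin k → A × N) : A × N :=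
  (ℓA k fun i => (p i).1, ℓN k fun i => (p i).2)

/-- The Taylor components `S_{k+1}(m_1, …, m_{k+1}) = ⟨ℓ_k(m_1, …, m_k), m_{k+1}⟩` of the classical
action of a cyclic `L∞`-algebra. -/
def actionTaylor (B : N → N → ℝ) (ℓN : Brackets N) : ∀ n : ℕ, (Fin n → N) → ℝ
  | 0 => fun _ => 0
  | k + 1 => fun m => B (ℓN k fun i => m i.castSucc) (m (Fin.last k))

/-- The classical action `S(α) = ∑_k 1/(k+1)! ⟨α, ℓ_k(α, …, α)⟩` (a finite sum whenever only
finitely many brackets are nonzero; `ℓ_0 = 0`). -/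
def classicalAction (B : N → N → ℝ) (ℓN : Brackets N) (α : N) : ℝ :=
  ∑ᶠ k : ℕ, ((k + 1).factorial : ℝ)⁻¹ * B α (ℓN k fun _ => α)

/-- The total functional `S^tot = S^A + S` on `A ⊕ N`. -/
def totalFunctional (B : N → N → ℝ) (ℓN : Brackets N) (F : Functional A N) (n : ℕ)
    (p : Fin n → A × N) : ℝ :=
  F n p + actionTaylor B ℓN n fun i => (p i).2

end InfinityAdjoint

/-! ## Vector bundles and their sheaves of sections -/

/-- A smooth real vector bundle of finite rank over the `d`-dimensional manifold `M`. -/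
structure VecBundle (d : ℕ) (M : Type w) [TopologicalSpace M]
    [ChartedSpace (EuclideanSpace ℝ (Fin d)) M] where
  F : Type u
  [normedAddCommGroup : NormedAddCommGroup F]
  [normedSpace : NormedSpace ℝ F]
  [finiteDimensional : FiniteDimensional ℝ F]
  V : M → Type v
  [addCommGroup : ∀ x, AddCommGroup (V x)]
  [module : ∀ x, Module ℝ (V x)]
  [topFiber : ∀ x, TopologicalSpace (V x)]
  [topTotal : TopologicalSpace (Bundle.TotalSpace F V)]
  [fiberBundle : FiberBundle F V]
  [vectorBundle : VectorBundle ℝ F V]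
  [smooth : ContMDiffVectorBundle ∞ F V (𝓡 d)]

attribute [instance] VecBundle.normedAddCommGroup VecBundle.normedSpace
  VecBundle.finiteDimensional VecBundle.addCommGroup VecBundle.module VecBundle.topFiber
  VecBundle.topTotal VecBundle.fiberBundle VecBundle.vectorBundle VecBundle.smooth

variable {d : ℕ} {M : Type w} [TopologicalSpace M] [ChartedSpace (EuclideanSpace ℝ (Fin d)) M]

namespace VecBundle

variable (E : VecBundle.{u, v} d M)

/-- The space `Γ(U, E)` of smooth sections over the open set `U`. A section over `U` is
stored as a function on `M` whose value outside `U` is set to `0`. -/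
def Sec (U : Opens M) : Submodule ℝ (∀ x, E.V x) where
  carrier := {s | ContMDiffOn (𝓡 d) ((𝓡 d).prod 𝓘(ℝ, E.F)) ∞
      (fun x => Bundle.TotalSpace.mk' E.F x (s x)) (U : Set M) ∧ ∀ x ∉ U, s x = 0}
  zero_mem' := ⟨(Bundle.contMDiff_zeroSection ℝ E.V).contMDiffOn, fun _ _ => rfl⟩
  add_mem' := fun hs ht => ⟨hs.1.add_section ht.1, fun x hx => by simp [hs.2 x hx, ht.2 x hx]⟩
  smul_mem' := fun c s hs => ⟨hs.1.const_smul_section, fun x hx => by simp [hs.2 x hx]⟩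

open Classical in
/-- Restriction of sections to a smaller open set. -/
def res {U W : Opens M} (h : W ≤ U) : E.Sec U →ₗ[ℝ] E.Sec W where
  toFun s := ⟨fun x => if x ∈ W then s.1 x else 0,
    ((s.2.1.mono h).congr fun x hx => by
      have hx' : x ∈ W := hx
      simp [hx']), fun x hx => by simp [hx]⟩
  map_add' s t := by
    ext x
    by_cases hx : x ∈ W <;> simp [hx]
  map_smul' c s := by
    ext x
    by_cases hx : x ∈ W <;> simp [hx]

/-- The space `Γ_c(M, E)` of compactly supported global sections. -/
def SecC : Submodule ℝ (E.Sec ⊤) where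
  carrier := {s | ∃ K : Set M, IsCompact K ∧ ∀ x ∉ K, s.1 x = 0}
  zero_mem' := ⟨∅, isCompact_empty, fun _ _ => rfl⟩
  add_mem' := by
    rintro s t ⟨K, hK, hs⟩ ⟨L, hL, ht⟩
    refine ⟨K ∪ L, hK.union hL, fun x hx => ?_⟩
    have h1 := hs x fun h => hx (Or.inl h)
    have h2 := ht x fun h => hx (Or.inr h)
    simp [h1, h2]
  smul_mem' := by
    rintro c s ⟨K, hK, hs⟩
    exact ⟨K, hK, fun x hx => by simp [hs x hx]⟩

/-- The operator `D`, defined on `k`-tuples of sections of `E` over `U`, with values in sections of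
some other bundle with fibres `T x`, has order at most `r` in each argument: the value of
`D(φ_1, …, φ_k)` at `x` vanishes as soon as the `r`-jet at `x` of one of the `φ_i` vanishes, i.e. as
soon as some `φ_i` lies in `𝔪_x^{r+1} Γ(U, E)`. A multilinear operator (taking smooth sections to
smooth sections) with this property for some `r` is a poly-differential operator. -/
def HasOrderLE {E : VecBundle.{u, v} d M} {U : Opens M} {k : ℕ} {T : M → Type*}
    [∀ x, Zero (T x)] (r : ℕ) (D : (Fin k → E.Sec U) → ∀ x, T x) : Prop :=
  ∀ x ∈ U, ∀ (φ : Fin k → E.Sec U) (i : Fin k) (f : Fin (r + 1) → M → ℝ) (s : E.Sec U),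
    (∀ a, ContMDiff (𝓡 d) 𝓘(ℝ, ℝ) ∞ (f a)) → (∀ a, f a x = 0) →
    (∀ y, (φ i).1 y = (∏ a, f a y) • s.1 y) → D φ x = 0

end VecBundle

/-- A `ℤ`-graded smooth vector bundle `E = ⨁_i E_i` (finitely many nonzero `E_i`), given by the
smooth projections `pr i` of `E` onto the subbundles `E_i = {v | pr i v = v}`. -/
structure GradedBundle (d : ℕ) (M : Type w) [TopologicalSpace M]
    [ChartedSpace (EuclideanSpace ℝ (Fin d)) M] extends VecBundle.{u, v} d M where
  pr : ℤ → ∀ x, V x →ₗ[ℝ] V x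
  pr_pr : ∀ i x v, pr i x (pr i x v) = pr i x v
  pr_pr_ne : ∀ i j x v, i ≠ j → pr i x (pr j x v) = 0
  degrees : Finset ℤ
  pr_eq_zero : ∀ i x v, i ∉ degrees → pr i x v = 0
  sum_pr : ∀ x v, ∑ i ∈ degrees, pr i x v = v
  pr_smooth : ∀ (i : ℤ) (U : Opens M) (s : ∀ x, V x), s ∈ toVecBundle.Sec U →
    (fun x => pr i x (s x)) ∈ toVecBundle.Sec U

namespace GradedBundle

/-- The subspace of sections over `U` of degree `i`. -/
def secGr (E : GradedBundle.{u, v} d M) (U : Opens M) (i : ℤ) : Submodule ℝ (E.Sec U) where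
  carrier := {s | ∀ x, E.pr i x (s.1 x) = s.1 x}
  zero_mem' := fun x => by simp
  add_mem' := fun hs ht x => by simp [hs x, ht x]
  smul_mem' := fun c s hs x => by simp [hs x]

/-- The subspace of compactly supported sections of degree `i`. -/
def secCGr (E : GradedBundle.{u, v} d M) (i : ℤ) : Submodule ℝ E.SecC :=
  (E.secGr ⊤ i).comap E.SecC.subtype

/-- The degree `i` component of a section. -/
def component (E : GradedBundle.{u, v} d M) (U : Opens M) (i : ℤ) (s : E.Sec U) : E.Sec U :=
  ⟨fun x => E.pr i x (s.1 x), E.pr_smooth i U s.1 s.2⟩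

end GradedBundle

open Bundle in
/-- A family of fibres is a smooth section of a Whitney sum iff both components are. -/
theorem contMDiffOn_prod_section [IsManifold (𝓡 d) ∞ M] (E₁ : VecBundle.{u, v} d M)
    (E₂ : VecBundle.{u', v'} d M) (U : Set M) (s : ∀ x, (E₁.V ×ᵇ E₂.V) x) :
    ContMDiffOn (𝓡 d) ((𝓡 d).prod 𝓘(ℝ, E₁.F × E₂.F)) ∞
        (fun x => Bundle.TotalSpace.mk' (E₁.F × E₂.F) (E := (E₁.V ×ᵇ E₂.V)) x (s x)) U ↔
      ContMDiffOn (𝓡 d) ((𝓡 d).prod 𝓘(ℝ, E₁.F)) ∞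
        (fun x => Bundle.TotalSpace.mk' E₁.F x (s x).1) U ∧
      ContMDiffOn (𝓡 d) ((𝓡 d).prod 𝓘(ℝ, E₂.F)) ∞
        (fun x => Bundle.TotalSpace.mk' E₂.F x (s x).2) U := by
  unfold ContMDiffOn
  rw [← forall₂_and]
  refine forall₂_congr fun x hx => ?_
  rw [Bundle.contMDiffWithinAt_section, Bundle.contMDiffWithinAt_section,
    Bundle.contMDiffWithinAt_section]
  exact contMDiffWithinAt_prod_module_iff _

open Bundle in
/-- The Whitney sum. -/
abbrev VecBundle.prod [IsManifold (𝓡 d) ∞ M] (E₁ : VecBundle.{u, v} d M)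
    (E₂ : VecBundle.{u', v'} d M) : VecBundle d M where
  F := E₁.F × E₂.F
  V := E₁.V ×ᵇ E₂.V

/-- Sections of the Whitney sum are pairs of sections. -/
def VecBundle.secProd [IsManifold (𝓡 d) ∞ M] (E₁ : VecBundle.{u, v} d M)
    (E₂ : VecBundle.{u', v'} d M) (U : Opens M) :
    (E₁.prod E₂).Sec U ≃ₗ[ℝ] E₁.Sec U × E₂.Sec U where
  toFun s := (⟨fun x => (s.1 x).1, ((contMDiffOn_prod_section E₁ E₂ U s.1).1 s.2.1).1,
      fun x hx => congrArg Prod.fst (s.2.2 x hx)⟩,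
    ⟨fun x => (s.1 x).2, ((contMDiffOn_prod_section E₁ E₂ U s.1).1 s.2.1).2,
      fun x hx => congrArg Prod.snd (s.2.2 x hx)⟩)
  map_add' _ _ := rfl
  map_smul' _ _ := rfl
  invFun p := ⟨fun x => (p.1.1 x, p.2.1 x),
    (contMDiffOn_prod_section E₁ E₂ U _).2 ⟨p.1.2.1, p.2.2.1⟩,
    fun x hx => Prod.ext (p.1.2.2 x hx) (p.2.2.2 x hx)⟩
  left_inv _ := rfl
  right_inv _ := rfl

/-- The Whitney sum of graded bundles, graded by `(E₁ ⊕ E₂)_i = (E₁)_i ⊕ (E₂)_i`. -/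
def GradedBundle.prod [IsManifold (𝓡 d) ∞ M] (E₁ : GradedBundle.{u, v} d M)
    (E₂ : GradedBundle.{u', v'} d M) : GradedBundle d M where
  toVecBundle := E₁.toVecBundle.prod E₂.toVecBundle
  pr i x := (E₁.pr i x).prodMap (E₂.pr i x)
  pr_pr i x v := Prod.ext (E₁.pr_pr i x _) (E₂.pr_pr i x _)
  pr_pr_ne i j x v h := Prod.ext (E₁.pr_pr_ne i j x _ h) (E₂.pr_pr_ne i j x _ h)
  degrees := E₁.degrees ∪ E₂.degrees
  pr_eq_zero i x v h := by
    rw [Finset.notMem_union] at h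
    exact Prod.ext (E₁.pr_eq_zero i x _ h.1) (E₂.pr_eq_zero i x _ h.2)
  sum_pr x v := by
    have h1 : ∑ i ∈ E₁.degrees ∪ E₂.degrees, E₁.pr i x v.1 = v.1 := by
      rw [← Finset.sum_subset Finset.subset_union_left
        fun i _ hi => E₁.pr_eq_zero i x v.1 hi]
      exact E₁.sum_pr x v.1
    have h2 : ∑ i ∈ E₁.degrees ∪ E₂.degrees, E₂.pr i x v.2 = v.2 := by
      rw [← Finset.sum_subset Finset.subset_union_right
        fun i _ hi => E₂.pr_eq_zero i x v.2 hi]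
      exact E₂.sum_pr x v.2
    refine Prod.ext ?_ ?_
    · refine Eq.trans ?_ h1
      exact map_sum (LinearMap.fst ℝ (E₁.V x) (E₂.V x)) _ _
    · refine Eq.trans ?_ h2
      exact map_sum (LinearMap.snd ℝ (E₁.V x) (E₂.V x)) _ _
  pr_smooth i U s hs := by
    let t := E₁.secProd E₂.toVecBundle U ⟨s, hs⟩
    exact ((E₁.secProd E₂.toVecBundle U).symm (E₁.component U i t.1, E₂.component U i t.2)).2

/-! ## Densities -/

/-- The fibre at `x` of the density line bundle `Dens_M`: functions `μ` of `d`-tuples of tangent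
vectors with `μ(A v_1, …, A v_d) = |det A| μ(v_1, …, v_d)` for every endomorphism `A` of `T_x M`. -/
def Dens (d : ℕ) {M : Type w} [TopologicalSpace M] [ChartedSpace (EuclideanSpace ℝ (Fin d)) M]
    (x : M) : Submodule ℝ ((Fin d → TangentSpace (𝓡 d) x) → ℝ) where
  carrier := {μ | ∀ (A : TangentSpace (𝓡 d) x →ₗ[ℝ] TangentSpace (𝓡 d) x)
    (v : Fin d → TangentSpace (𝓡 d) x), μ (fun i => A (v i)) = |LinearMap.det A| * μ v}
  zero_mem' := fun A v => by simp
  add_mem' := fun hμ hν A v => by simp [hμ A v, hν A v, mul_add]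
  smul_mem' := fun c μ hμ A v => by simp [hμ A v, mul_left_comm]

/-- The coefficient of the density `ρ` in the chart `φ` at `x₀`, a function of the coordinates
`y`: the value of `ρ` on the coordinate frame `∂_1, …, ∂_d` at `φ⁻¹(y)`. -/
def densCoord (ρ : ∀ x : M, Dens d x) (x₀ : M) (y : EuclideanSpace ℝ (Fin d)) : ℝ :=
  (ρ ((extChartAt (𝓡 d) x₀).symm y)).1 fun i =>
    mfderiv 𝓘(ℝ, EuclideanSpace ℝ (Fin d)) (𝓡 d) (extChartAt (𝓡 d) x₀).symm y
      (EuclideanSpace.single i (1 : ℝ))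

/-- The density `ρ` is smooth on the open set `U`. -/
def IsSmoothDens (ρ : ∀ x : M, Dens d x) (U : Opens M) : Prop :=
  ∀ x₀ : M, ContDiffOn ℝ ∞ (densCoord ρ x₀)
    ((extChartAt (𝓡 d) x₀).target ∩ (extChartAt (𝓡 d) x₀).symm ⁻¹' U)

section Manifold

variable [IsManifold (𝓡 d) ∞ M] [T2Space M] [SigmaCompactSpace M]

/-- The integral of a (compactly supported, smooth) density over `M`, computed by means of a
partition of unity subordinate to the charts; it does not depend on the partition. -/
def densIntegral (ρ : ∀ x : M, Dens d x) : ℝ :=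
  ∑ᶠ x₀ : M, ∫ y in (extChartAt (𝓡 d) x₀).target,
    (SmoothPartitionOfUnity.exists_isSubordinate_chartAt_source (𝓡 d) M).choose x₀
      ((extChartAt (𝓡 d) x₀).symm y) * densCoord ρ x₀ y

/-! ## Local `L∞`-algebras -/

/-- Brackets on the sections of `E` over every open set. -/
abbrev LocalBrackets (E : GradedBundle.{u, v} d M) : Type _ := ∀ U : Opens M, Brackets (E.Sec U)

/-- The brackets make the sheaf of sections of `E` a sheaf of `L∞`-algebras, and they are given by
poly-differential operators. -/
structure IsLocalLInfty (E : GradedBundle.{u, v} d M) (ℓ : LocalBrackets E) : Prop where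
  isLInfty : ∀ U, IsLInfty (E.secGr U) (ℓ U)
  res : ∀ (U W : Opens M) (h : W ≤ U) (k : ℕ) (s : Fin k → E.Sec U),
    ℓ W k (fun i => E.res h (s i)) = E.res h (ℓ U k s)
  polyDiff : ∀ k : ℕ, ∃ r : ℕ, ∀ U : Opens M,
    VecBundle.HasOrderLE r fun s : Fin k → E.Sec U => (ℓ U k s).1

/-- A local `L∞`-algebra on `M`. -/
structure LocalLInfty (d : ℕ) (M : Type w) [TopologicalSpace M]
    [ChartedSpace (EuclideanSpace ℝ (Fin d)) M] [IsManifold (𝓡 d) ∞ M] [T2Space M]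
    [SigmaCompactSpace M] extends GradedBundle.{u, v} d M where
  br : LocalBrackets toGradedBundle
  isLocal : IsLocalLInfty toGradedBundle br

/-- The induced pairing `⟨s, t⟩ = ∫_M ⟨s, t⟩_E` (for `s` or `t` compactly supported). -/
def pairInt {E : GradedBundle.{u, v} d M} (pair : ∀ x, E.V x →ₗ[ℝ] E.V x →ₗ[ℝ] Dens d x)
    (s t : E.Sec ⊤) : ℝ :=
  densIntegral fun x => pair x (s.1 x) (t.1 x)

/-- A local `L∞`-algebra which is cyclic of degree `-3`: a smooth, fibrewise non-degenerate, graded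
symmetric pairing `E ⊗ E → Dens_M[-3]`, such that the induced pairing on compactly supported
sections is invariant, i.e. `⟨ℓ_n(α_1, …, α_n), α_{n+1}⟩` is graded antisymmetric. -/
structure CyclicLocalLInfty (d : ℕ) (M : Type w) [TopologicalSpace M]
    [ChartedSpace (EuclideanSpace ℝ (Fin d)) M] [IsManifold (𝓡 d) ∞ M] [T2Space M]
    [SigmaCompactSpace M] extends LocalLInfty.{u, v} d M where
  pair : ∀ x, V x →ₗ[ℝ] V x →ₗ[ℝ] Dens d x
  pair_smooth : ∀ (U : Opens M) (s t : toVecBundle.Sec U),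
    IsSmoothDens (fun x => pair x (s.1 x) (t.1 x)) U
  pair_degree : ∀ x i j a b, pr i x a = a → pr j x b = b → i + j ≠ 3 → pair x a b = 0
  pair_symm : ∀ x i j a b, pr i x a = a → pr j x b = b →
    pair x a b = ((Int.negOnePow (i * j) : ℤ) : ℝ) • pair x b a
  pair_nondegenerate : ∀ x a, (∀ b, pair x a b = 0) → a = 0
  invariant : ∀ (n : ℕ) (e : Fin (n + 1) → ℤ) (α : Fin (n + 1) → toVecBundle.SecC)
    (σ : Equiv.Perm (Fin (n + 1))), (∀ i, α i ∈ toGradedBundle.secCGr (e i)) →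
      pairInt pair (br ⊤ n fun i => (α (σ i.castSucc)).1) (α (σ (Fin.last n))).1 =
        (((permSign σ e : ℤˣ) : ℤ) : ℝ) *
          pairInt pair (br ⊤ n fun i => (α i.castSucc).1) (α (Fin.last n)).1

/-- Poly-differential operators do not increase supports, so brackets of compactly supported
sections are compactly supported. -/
theorem LocalLInfty.br_mem_secC (𝓛 : LocalLInfty.{u, v} d M) (k : ℕ)
    (s : Fin k → 𝓛.Sec ⊤) (hs : ∀ i, s i ∈ 𝓛.SecC) : 𝓛.br ⊤ k s ∈ 𝓛.SecC := by
  rcases k with _ | k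
  · rw [(𝓛.isLocal.isLInfty ⊤).uncurved]
    exact 𝓛.SecC.zero_mem
  · obtain ⟨r, hr⟩ := 𝓛.isLocal.polyDiff (k + 1)
    obtain ⟨K, hK, h0⟩ := hs 0
    refine ⟨K, hK, fun x hx => ?_⟩
    obtain ⟨f, hf0, hf1, -⟩ := exists_contMDiffMap_zero_one_of_isClosed (n := ⊤) (𝓡 d)
      (isClosed_singleton (x := x)) hK.isClosed (Set.disjoint_singleton_left.2 hx)
    refine hr ⊤ x trivial s 0 (fun _ => f) (s 0) (fun _ => f.contMDiff) (fun _ => hf0 rfl)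
      fun y => ?_
    by_cases hy : y ∈ K
    · simp [hf1 hy]
    · simp [h0 y hy]

/-- The brackets on compactly supported sections. -/
def LocalLInfty.brC (𝓛 : LocalLInfty.{u, v} d M) : Brackets 𝓛.SecC := fun k =>
  ((𝓛.br ⊤ k).compLinearMap fun _ => 𝓛.SecC.subtype).codRestrict 𝓛.SecC
    fun s => 𝓛.br_mem_secC k _ fun i => (s i).2

namespace CyclicLocalLInfty

variable (𝓜 : CyclicLocalLInfty.{u, v} d M)

/-- The pairing of compactly supported sections. -/
def pairC (s t : 𝓜.SecC) : ℝ := pairInt 𝓜.pair s.1 t.1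

/-- A local cyclic `L∞`-algebra (of degree `-3`) with finitely many nonzero brackets presents a
classical BV theory, with fields the sections of `E` and action `classicalAction`. -/
def PresentsBVTheory : Prop := ∃ K : ℕ, ∀ k > K, ∀ U : Opens M, 𝓜.br U k = 0

/-- Let `A` be a graded space with brackets `ℓA`, and let
`act k (p_1, …, p_k)` be the component in `𝓜` of the `k`-th bracket, on `p_i ∈ A ⊕ 𝓜_c`, of an
action of `A` on `𝓜`. The action is by classical symmetries if it is compatible with the pairing
and Hamiltonian, where `isLocal` says which functionals on `A ⊕ 𝓜_c` are local. -/
structure IsClassicalSymmetry {A : Type*} [AddCommGroup A] [Module ℝ A]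
    (grA : ℤ → Submodule ℝ A) (ℓA : Brackets A)
    (act : ∀ k : ℕ, (Fin k → A × 𝓜.SecC) → 𝓜.Sec ⊤)
    (isLocal : Functional A 𝓜.SecC → Prop) : Prop where
  /-- `⟨ℓ^⋉(X_1, …, X_r, m_1, …, m_s), m_{s+1}⟩` is graded antisymmetric in the `X`'s and in all
  of the `m`'s. -/
  compatible : ∀ (r s : ℕ), 1 ≤ s → ∀ (e : Fin r → ℤ) (e' : Fin (s + 1) → ℤ) (X : Fin r → A)
    (m : Fin (s + 1) → 𝓜.SecC), (∀ i, X i ∈ grA (e i)) → (∀ i, m i ∈ 𝓜.secCGr (e' i)) →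
    ∀ (σ : Equiv.Perm (Fin r)) (τ : Equiv.Perm (Fin (s + 1))),
      pairInt 𝓜.pair (act (r + s) (Fin.append (fun i => (X (σ i), 0))
          (fun i : Fin s => (0, m (τ i.castSucc))))) (m (τ (Fin.last s))).1 =
        (((permSign σ e * permSign τ e' : ℤˣ) : ℤ) : ℝ) *
          pairInt 𝓜.pair (act (r + s) (Fin.append (fun i => (X i, 0))
            (fun i : Fin s => (0, m i.castSucc)))) (m (Fin.last s)).1
  /-- The action is given by a Maurer-Cartan element `F` of `Ham(A, 𝓜)`: the Hamiltonian vector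
  field of `F` is the difference of the action and of the brackets of `𝓜`. The total functional
  `S^tot = F + S` satisfies the equivariant classical master equation
  `d_A S^tot + ½ {S^tot, S^tot} = 0` and is the classical action at zero background field. -/
  hamiltonian : ∃ (F : Functional A 𝓜.SecC) (X : ∀ k : ℕ, (Fin k → A × 𝓜.SecC) → 𝓜.SecC),
    IsHamCochain grA 𝓜.secCGr F ∧ isLocal F ∧
    IsHamVectorField 𝓜.pairC (fun n => F n) X ∧
    (∀ k p, act k p = 𝓜.br ⊤ k (fun i => (p i).2.1) + (X k p).1) ∧
    MaurerCartan grA 𝓜.secCGr (sumBrackets ℓA 𝓜.brC) (fun n => F n) X ∧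
    MaurerCartan grA 𝓜.secCGr (fun k p => (ℓA k fun i => (p i).1, 0))
      (totalFunctional 𝓜.pairC 𝓜.brC F)
      (fun k p => X k p + 𝓜.brC k fun i => (p i).2) ∧
    ∀ α : 𝓜.SecC, ∑ᶠ n : ℕ, ((n.factorial : ℝ)⁻¹ *
        totalFunctional 𝓜.pairC 𝓜.brC F n fun _ => (0, α)) =
      classicalAction 𝓜.pairC 𝓜.brC α

end CyclicLocalLInfty

/-! ## Actions of local `L∞`-algebras -/

section LocalActions

variable (𝓛 : LocalLInfty.{u', v'} d M) (𝓜 : CyclicLocalLInfty.{u, v} d M)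

/-- Sections of the Whitney sum of the underlying bundles of `𝓛` and `𝓜`. -/
def secSum (U : Opens M) :
    (𝓛.toGradedBundle.prod 𝓜.toGradedBundle).Sec U ≃ₗ[ℝ] 𝓛.Sec U × 𝓜.Sec U :=
  𝓛.toVecBundle.secProd 𝓜.toVecBundle U

/-- The brackets `b` on the Whitney sum are an action of the local `L∞`-algebra `𝓛` on `𝓜`: they
make it a local `L∞`-algebra, and the inclusion and the projection of the exact sequence of sheaves
`0 → 𝓜 → 𝓛 ⊕ 𝓜 → 𝓛 → 0` are strict maps of `L∞`-algebras. -/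
structure IsAction (b : LocalBrackets (𝓛.toGradedBundle.prod 𝓜.toGradedBundle)) : Prop where
  isLocal : IsLocalLInfty _ b
  incl : ∀ (U : Opens M) (k : ℕ) (m : Fin k → 𝓜.Sec U),
    b U k (fun i => (secSum 𝓛 𝓜 U).symm (0, m i)) = (secSum 𝓛 𝓜 U).symm (0, 𝓜.br U k m)
  proj : ∀ (U : Opens M) (k : ℕ)
    (p : Fin k → (𝓛.toGradedBundle.prod 𝓜.toGradedBundle).Sec U),
    (secSum 𝓛 𝓜 U (b U k p)).1 = 𝓛.br U k fun i => (secSum 𝓛 𝓜 U (p i)).1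

/-- The functional `F` on `𝓛_c ⊕ 𝓜_c` is local: every Taylor component is the integral of a
Lagrangian density, i.e. of a poly-differential operator with values in densities. -/
def IsLocalFunctional (F : Functional 𝓛.SecC 𝓜.SecC) : Prop :=
  ∀ n : ℕ, ∃ (r : ℕ) (P : MultilinearMap ℝ
      (fun _ : Fin n => (𝓛.toGradedBundle.prod 𝓜.toGradedBundle).Sec ⊤) (∀ x : M, Dens d x)),
    (∀ s, IsSmoothDens (P s) ⊤) ∧ VecBundle.HasOrderLE r (fun s => P s) ∧
    ∀ p, F n p = densIntegral (P fun i => (secSum 𝓛 𝓜 ⊤).symm ((p i).1.1, (p i).2.1))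

/-- The brackets `b` define an action of `𝓛` on the classical BV theory presented by `𝓜` by
classical symmetries. -/
structure ActsByClassicalSymmetries
    (b : LocalBrackets (𝓛.toGradedBundle.prod 𝓜.toGradedBundle)) : Prop where
  isAction : IsAction 𝓛 𝓜 b
  isClassicalSymmetry : 𝓜.IsClassicalSymmetry 𝓛.secCGr 𝓛.brC
    (fun k p => (secSum 𝓛 𝓜 ⊤
      (b ⊤ k fun i => (secSum 𝓛 𝓜 ⊤).symm ((p i).1.1, (p i).2.1))).2)
    (IsLocalFunctional 𝓛 𝓜)

/-- The infinity adjoint brackets on the Whitney sum, restricted along maps on sections. -/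
def infAdjAlong (j : ∀ U : Opens M, 𝓛.Sec U →ₗ[ℝ] 𝓜.Sec U) :
    LocalBrackets (𝓛.toGradedBundle.prod 𝓜.toGradedBundle) := fun U k =>
  (secSum 𝓛 𝓜 U).symm.toLinearMap.compMultilinearMap
    ((infAdj (𝓛.br U) (𝓜.br U) (j U) k).compLinearMap fun _ => (secSum 𝓛 𝓜 U).toLinearMap)

/-- `𝓛` is a local `L∞`-subalgebra of `𝓜`: its bundle is a graded subbundle (via an injective smooth
bundle map preserving degrees), and its brackets are the restrictions of those of `𝓜`. -/
structure LocalSubalgebra where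
  map : ∀ x, 𝓛.V x →ₗ[ℝ] 𝓜.V x
  injective : ∀ x, Function.Injective (map x)
  map_pr : ∀ i x a, map x (𝓛.pr i x a) = 𝓜.pr i x (map x a)
  smooth : ∀ (U : Opens M) (s : 𝓛.Sec U), (fun x => map x (s.1 x)) ∈ 𝓜.Sec U
  map_br : ∀ (U : Opens M) (k : ℕ) (s : Fin k → 𝓛.Sec U) (x : M),
    map x ((𝓛.br U k s).1 x) =
      (𝓜.br U k fun i => ⟨fun y => map y ((s i).1 y), smooth U (s i)⟩).1 x

variable {𝓛 𝓜}

/-- The inclusion of sections of a local subalgebra. -/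
def LocalSubalgebra.mapSec (j : LocalSubalgebra 𝓛 𝓜) (U : Opens M) : 𝓛.Sec U →ₗ[ℝ] 𝓜.Sec U where
  toFun s := ⟨fun x => j.map x (s.1 x), j.smooth U s⟩
  map_add' s t := by ext x; simp
  map_smul' c s := by ext x; simp

/-- The restriction of the infinity adjoint action of `𝓜` to a local subalgebra. -/
def LocalSubalgebra.infinityAdjoint (j : LocalSubalgebra 𝓛 𝓜) :
    LocalBrackets (𝓛.toGradedBundle.prod 𝓜.toGradedBundle) :=
  infAdjAlong 𝓛 𝓜 j.mapSec

/-- The infinity adjoint action of `𝓜` on itself. -/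
def CyclicLocalLInfty.infinityAdjoint (𝓜 : CyclicLocalLInfty.{u, v} d M) :
    LocalBrackets (𝓜.toGradedBundle.prod 𝓜.toGradedBundle) :=
  infAdjAlong 𝓜.toLocalLInfty 𝓜 fun _ => LinearMap.id

end LocalActions

/-! ## Actions of arbitrary (not necessarily local) subalgebras -/

/-- An arbitrary `L∞`-subalgebra of the `L∞`-algebra of global sections of `𝓜`: a graded subspace
closed under all brackets. -/
structure Subalgebra (𝓜 : CyclicLocalLInfty.{u, v} d M) where
  carrier : Submodule ℝ (𝓜.Sec ⊤)
  component_mem : ∀ (i : ℤ), ∀ s ∈ carrier, 𝓜.component ⊤ i s ∈ carrier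
  br_mem : ∀ (k : ℕ) (s : Fin k → 𝓜.Sec ⊤), (∀ i, s i ∈ carrier) → 𝓜.br ⊤ k s ∈ carrier

namespace Subalgebra

variable {𝓜 : CyclicLocalLInfty.{u, v} d M} (𝔥 : Subalgebra 𝓜)

/-- The grading of a subalgebra. -/
def gr (i : ℤ) : Submodule ℝ 𝔥.carrier := (𝓜.secGr ⊤ i).comap 𝔥.carrier.subtype

/-- The brackets of a subalgebra. -/
def br : Brackets 𝔥.carrier := fun k =>
  ((𝓜.br ⊤ k).compLinearMap fun _ => 𝔥.carrier.subtype).codRestrict 𝔥.carrier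
    fun s => 𝔥.br_mem k _ fun i => (s i).2

/-- The restriction of the infinity adjoint action to `𝔥`: brackets on `𝔥 ⊕ Γ(U, E)` for every
open `U`. -/
def infinityAdjoint (U : Opens M) : Brackets (𝔥.carrier × 𝓜.Sec U) :=
  infAdj 𝔥.br (𝓜.br U) (𝓜.res (le_top : U ≤ ⊤) ∘ₗ 𝔥.carrier.subtype)

/-- Brackets `b` on `𝔥 ⊕ Γ(U, E)`, for all open `U`, are an action of `𝔥` on `𝓜`: they make this a
presheaf of `L∞`-algebras, they are poly-differential in the arguments from `𝓜`, and
`0 → 𝓜 → 𝔥 ⊕ 𝓜 → 𝔥 → 0` is a sequence of strict maps of `L∞`-algebras. -/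
structure IsAction (b : ∀ U : Opens M, Brackets (𝔥.carrier × 𝓜.Sec U)) : Prop where
  isLInfty : ∀ U, IsLInfty (prodGr 𝔥.gr (𝓜.secGr U)) (b U)
  res : ∀ (U W : Opens M) (h : W ≤ U) (k : ℕ) (p : Fin k → 𝔥.carrier × 𝓜.Sec U),
    b W k (fun i => ((p i).1, 𝓜.res h (p i).2)) = ((b U k p).1, 𝓜.res h (b U k p).2)
  polyDiff : ∀ (r s : ℕ) (X : Fin r → 𝔥.carrier), ∃ o : ℕ, ∀ U : Opens M,
    VecBundle.HasOrderLE o fun m : Fin s → 𝓜.Sec U =>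
      (b U (r + s) (Fin.append (fun i => (X i, 0)) fun i => (0, m i))).2.1
  incl : ∀ (U : Opens M) (k : ℕ) (m : Fin k → 𝓜.Sec U),
    b U k (fun i => (0, m i)) = (0, 𝓜.br U k m)
  proj : ∀ (U : Opens M) (k : ℕ) (p : Fin k → 𝔥.carrier × 𝓜.Sec U),
    (b U k p).1 = 𝔥.br k fun i => (p i).1

/-- A functional on `𝔥 ⊕ 𝓜_c` is local if, for fixed arguments from `𝔥` and at least one argument
from `𝓜_c`, it is the integral of a Lagrangian density depending on the arguments from `𝓜_c`. -/
def IsLocalFunctional (F : Functional 𝔥.carrier 𝓜.SecC) : Prop :=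
  ∀ (r s : ℕ), 1 ≤ s → ∀ X : Fin r → 𝔥.carrier,
    ∃ (o : ℕ) (P : MultilinearMap ℝ (fun _ : Fin s => 𝓜.Sec ⊤) (∀ x : M, Dens d x)),
      (∀ m, IsSmoothDens (P m) ⊤) ∧ VecBundle.HasOrderLE o (fun m => P m) ∧
      ∀ m : Fin s → 𝓜.SecC, F (r + s) (Fin.append (fun i => (X i, 0)) fun i => (0, m i)) =
        densIntegral (P fun i => (m i).1)

/-- The brackets `b` define an action of `𝔥` on the classical BV theory presented by `𝓜` by
classical symmetries. -/
structure ActsByClassicalSymmetries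
    (b : ∀ U : Opens M, Brackets (𝔥.carrier × 𝓜.Sec U)) : Prop where
  isAction : 𝔥.IsAction b
  isClassicalSymmetry : 𝓜.IsClassicalSymmetry 𝔥.gr 𝔥.br
    (fun k p => (b ⊤ k fun i => ((p i).1, (p i).2.1)).2) 𝔥.IsLocalFunctional

end Subalgebra

end Manifold

end

end LInf

namespace LInf

noncomputable section

universe u v u' v' w

/-! ### Koszul signs of a subset and of its complement -/

section Signs

variable {n : ℕ}

/-! Write formally Q(v) = ∑ ℓ_k(v, …, v)/k! and let S be the action, whose gradient is Q. Summing
over the subsets of arguments taken from the background field is multilinear expansion, so the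
𝓜-component of the infinity adjoint brackets encodes Q(jX + u) - Q(jX) (`infAdj_snd_eq_sub`). Hence
the shear (X, u) ↦ (X, jX + u) carries these brackets to those of a direct sum, and the L∞-axioms
can be checked in each component (`isLInfty_infAdj`).

The Hamiltonian is F(X, u) = S(jX + u) - S(jX) - dS(jX)u - S(u); `hamForm` is its multilinear form.
By `hamForm_snoc`, its gradient in u is Q(jX + u) - Q(jX) - Q(u), the difference between the action
and the brackets of 𝓜, and its gradient in X is the Taylor remainder Q(jX + u) - Q(jX) - DQ(jX)u.
The Jacobi identities and the invariance of the pairing give ⟨Q(v), Q(v)⟩ = 0 (`bracketSum_self`)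
and its derivative ⟨DQ(v)w, Q(v)⟩ = 0 (`bracketSum_update`). A graded symmetric pairing of degree -3
is symmetric without signs, so both master equations become quadratic identities in Q(jX + u), Q(jX)
and Q(u) (`maurerCartan`, `maurerCartan_total`).

This algebra lives on compactly supported sections, whereas jX may have any support, and then S(jX)
need not make sense. Every term of F, however, contains at least two arguments u, so by locality its
density is supported where the u's are. On a finite tuple jX may therefore be replaced by χ·jX, with
χ a cutoff equal to 1 near the supports of the u's. Cutting off does not commute with brackets, but
the results agree near those supports; the relation `CutRel` records this and carries the identities
over. All three assertions are instances of `isClassicalSymmetry`, stated for a degree-preserving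
linear map j from any graded space A into the global sections that is compatible with the brackets.
-/

lemma permSign_finRotate (k : ℕ) (e : Fin k → ℤ) (a : ℤ) :
    permSign (finRotate (k + 1)) (Fin.cons a e : Fin (k + 1) → ℤ) =
      ∏ i, -Int.negOnePow (e i * a) := by
  have h : ∀ i : Fin k, finRotate (k + 1) i.castSucc = i.succ := fun i => by
    rw [finRotate_of_lt (by simp)]; rfl
  unfold permSign
  rw [Finset.prod_filter, ← Finset.univ_product_univ, Finset.prod_product, Fin.prod_univ_castSucc]
  simp only [Fin.prod_univ_castSucc, h, finRotate_last, Fin.succ_lt_succ_iff,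
    Fin.castSucc_lt_castSucc_iff, Fin.cons_succ, Fin.cons_zero, Fin.castSucc_lt_last,
    Fin.succ_pos, and_self, if_true]
  have h0 : ∀ i j : Fin k, ¬ (i < j ∧ j < i) := fun i j hh => hh.1.not_gt hh.2
  simp [h0, (Fin.castSucc_lt_last _).le.not_gt]

lemma prod_neg_negOnePow {ι : Type*} (s : Finset ι) (e : ι → ℤ) (a : ℤ) :
    ∏ i ∈ s, -Int.negOnePow (e i * a) = Int.negOnePow (s.card + (∑ i ∈ s, e i) * a) := by
  classical
  induction s using Finset.induction_on with
  | empty => simp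
  | insert i s hi ih =>
    rw [Finset.prod_insert hi, ih, Finset.sum_insert hi, Finset.card_insert_of_notMem hi]
    push_cast
    rw [show (s.card : ℤ) + 1 + (e i + ∑ i ∈ s, e i) * a =
      1 + (e i * a) + (s.card + (∑ i ∈ s, e i) * a) by ring, Int.negOnePow_add _ (_ + _),
      Int.negOnePow_add 1]
    simp

/-- The sign of the term `⟨Y(v_{Iᶜ}), Z(v_I)⟩` in the bracket of two functionals. -/
def degSign (I : Finset (Fin n)) (e : Fin n → ℤ) : ℤˣ :=
  shuffleSign I e * Int.negOnePow ((∑ i ∈ I, e i - I.card) * ∑ i ∈ Iᶜ, e i)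

lemma sum_orderEmbOfFin {β : Type*} [AddCommMonoid β] (I : Finset (Fin n)) (f : Fin n → β) :
    ∑ i, f (I.orderEmbOfFin rfl i) = ∑ i ∈ I, f i := by
  conv_rhs => rw [← Finset.map_orderEmbOfFin_univ I rfl]
  rw [Finset.sum_map]; rfl

/-- The sign (-1)^{n-k} in the Jacobi identity is absorbed by the minus signs met when the inner
bracket, of degree ∑_I e + 2 - |I|, moves past the other arguments to the last slot. What remains is
`degSign`. -/
lemma insertion_sign (I : Finset (Fin n)) (e : Fin n → ℤ) :
    Int.negOnePow (Iᶜ.card : ℤ) * shuffleSign I e *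
      (∏ i, -Int.negOnePow (e (Iᶜ.orderEmbOfFin rfl i) * (∑ i ∈ I, e i + 2 - I.card))) =
      degSign I e := by
  rw [prod_neg_negOnePow, degSign, sum_orderEmbOfFin, Finset.card_univ, Fintype.card_fin,
    mul_comm (Int.negOnePow _), mul_assoc, ← Int.negOnePow_add]
  congr 1
  rw [Int.negOnePow_eq_iff]
  exact ⟨Iᶜ.card + ∑ i ∈ Iᶜ, e i, by ring⟩

/-- Each pair in I × Iᶜ is an inversion of exactly one of the two shuffles, so the product of the
signs runs over the whole of I × Iᶜ. -/
lemma shuffleSign_mul_compl (I : Finset (Fin n)) (e : Fin n → ℤ) :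
    shuffleSign I e * shuffleSign Iᶜ e =
      Int.negOnePow (Iᶜ.card * I.card + (∑ i ∈ Iᶜ, e i) * ∑ i ∈ I, e i) := by
  have h : shuffleSign Iᶜ e =
      ∏ p : Fin n × Fin n with p.1 ∈ I ∧ p.2 ∉ I ∧ p.1 < p.2,
        -Int.negOnePow (e p.1 * e p.2) := by
    unfold shuffleSign
    refine Finset.prod_nbij' Prod.swap Prod.swap ?_ ?_ ?_ ?_ ?_
    · intro p; simp; tauto
    · intro p; simp; tauto
    · intro p _; simp
    · intro p _; simp
    · intro p _; simp [mul_comm]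
  rw [h, shuffleSign, ← Finset.prod_union]
  · have : (Finset.univ.filter fun p : Fin n × Fin n => p.1 ∈ I ∧ p.2 ∉ I ∧ p.2 < p.1) ∪
        (Finset.univ.filter fun p : Fin n × Fin n => p.1 ∈ I ∧ p.2 ∉ I ∧ p.1 < p.2) = I ×ˢ Iᶜ := by
      ext p
      have : p.1 ∈ I → p.2 ∉ I → p.1 ≠ p.2 := fun h1 h2 h => h2 (h ▸ h1)
      simp only [Finset.mem_union, Finset.mem_filter, Finset.mem_univ, true_and,
        Finset.mem_product, Finset.mem_compl]
      grind
    rw [this, Finset.prod_product_right]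
    calc ∏ y ∈ Iᶜ, ∏ x ∈ I, -Int.negOnePow (e x * e y)
        = ∏ y ∈ Iᶜ, Int.negOnePow (I.card + (∑ i ∈ I, e i) * e y) :=
          Finset.prod_congr rfl fun y _ => prod_neg_negOnePow _ _ _
      _ = _ := by
          induction Iᶜ using Finset.induction_on with
          | empty => simp
          | insert i s hi ih =>
            rw [Finset.prod_insert hi, ih, Finset.sum_insert hi, Finset.card_insert_of_notMem hi,
              ← Int.negOnePow_add]
            congr 1
            push_cast
            ring
  · rw [Finset.disjoint_filter]
    intro p _ h1 h2
    exact absurd h1.2.2 h2.2.2.le.not_gt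

/-- The hypothesis says that the two brackets have total degree 3, the only case in which their
pairing can be nonzero. It makes the parity of the combined exponent even. -/
lemma degSign_compl (I : Finset (Fin n)) (e : Fin n → ℤ)
    (h : (∑ i ∈ Iᶜ, e i + 2 - Iᶜ.card) + (∑ i ∈ I, e i + 2 - I.card) = 3) :
    degSign Iᶜ e = degSign I e := by
  have key : degSign I e * degSign Iᶜ e = 1 := by
    rw [degSign, degSign, compl_compl, mul_mul_mul_comm, shuffleSign_mul_compl,
      ← Int.negOnePow_add, ← Int.negOnePow_add, Int.negOnePow_eq_one_iff]
    generalize (∑ i ∈ Iᶜ, e i) = a at *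
    generalize (∑ i ∈ I, e i) = b at *
    generalize (Iᶜ.card : ℤ) = k at *
    generalize (I.card : ℤ) = l at *
    obtain rfl : a = k + l - b - 1 := by linarith
    simp only [Int.even_add, Int.even_sub, Int.even_mul, Int.not_even_one]
    tauto
  rw [← mul_left_cancel_iff (a := degSign I e), key, Int.units_mul_self]

end Signs

/-! ### Cyclic forms, the Hamiltonian and mixed brackets as sums over subsets -/

section Forms

variable {V R : Type*} [AddCommGroup V] [Module ℝ V] [AddCommGroup R] [Module ℝ R]

/-- The cyclic forms `⟨ℓ_k(v_1, …, v_k), v_{k+1}⟩`. -/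
def cyclicForm (B : V →ₗ[ℝ] V →ₗ[ℝ] R) (ℓ : Brackets V) :
    ∀ n : ℕ, MultilinearMap ℝ (fun _ : Fin n => V) R
  | 0 => 0
  | k + 1 => (B.compMultilinearMap (ℓ k)).uncurryRight

lemma cyclicForm_succ (B : V →ₗ[ℝ] V →ₗ[ℝ] R) (ℓ : Brackets V) (k : ℕ) (v : Fin (k + 1) → V) :
    cyclicForm B ℓ (k + 1) v = B (ℓ k fun i => v i.castSucc) (v (Fin.last k)) := rfl

/-- The projection of `V × V` onto the first factor if `i ∈ S`, onto the second otherwise. -/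
def pick {k : ℕ} (S : Finset (Fin k)) (i : Fin k) : V × V →ₗ[ℝ] V :=
  if i ∈ S then LinearMap.fst ℝ V V else LinearMap.snd ℝ V V

/-- The forms `∑_S ⟨ℓ(p_1^S, …), p_n^S⟩`, where `S` is nonempty with at least two elements in its
complement. -/
def hamForm (B : V →ₗ[ℝ] V →ₗ[ℝ] R) (ℓ : Brackets V) (n : ℕ) :
    MultilinearMap ℝ (fun _ : Fin n => V × V) R :=
  ∑ S : Finset (Fin n) with S.Nonempty ∧ S.card + 2 ≤ n, (cyclicForm B ℓ n).compLinearMap (pick S)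

/-- The mixed terms `∑_S ℓ_k(p_1^S, …, p_k^S)` of the infinity adjoint action. -/
def mixedBracket (ℓ : Brackets V) (k : ℕ) : MultilinearMap ℝ (fun _ : Fin k => V × V) V :=
  ∑ S : Finset (Fin k) with S.Nonempty ∧ S ≠ Finset.univ, (ℓ k).compLinearMap (pick S)

lemma hamForm_apply (B : V →ₗ[ℝ] V →ₗ[ℝ] R) (ℓ : Brackets V) (n : ℕ) (p : Fin n → V × V) :
    hamForm B ℓ n p = ∑ S : Finset (Fin n) with S.Nonempty ∧ S.card + 2 ≤ n,
      cyclicForm B ℓ n fun i => pick S i (p i) := by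
  simp [hamForm]

lemma mixedBracket_apply (ℓ : Brackets V) (k : ℕ) (p : Fin k → V × V) :
    mixedBracket ℓ k p = ∑ S : Finset (Fin k) with S.Nonempty ∧ S ≠ Finset.univ,
      ℓ k fun i => pick S i (p i) := by
  simp [mixedBracket]

end Forms

/-! ### Subsets of `Fin n`: splitting off the last index, and reindexing -/

section Finsets

variable {β : Type*} [AddCommMonoid β]

lemma sum_finset_fin_succ {k : ℕ} (g : Finset (Fin (k + 1)) → β) :
    ∑ S, g S = (∑ S : Finset (Fin k), g (S.map Fin.castSuccEmb)) +
      ∑ S : Finset (Fin k), g (insert (Fin.last k) (S.map Fin.castSuccEmb)) := by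
  have h : (Finset.univ : Finset (Fin (k + 1))) =
      insert (Fin.last k) (Finset.univ.map Fin.castSuccEmb) := by
    ext i
    induction i using Fin.lastCases <;> simp
  have h2 : (Finset.univ.map (Fin.castSuccEmb (n := k))).powerset =
      (Finset.univ : Finset (Finset (Fin k))).map (Finset.mapEmbedding Fin.castSuccEmb).toEmbedding := by
    ext S
    simp only [Finset.mem_powerset, Finset.mem_map, Finset.mem_univ, true_and,
      Finset.subset_map_iff, Finset.subset_univ]
    exact ⟨fun ⟨a, h⟩ => ⟨a, h.symm⟩, fun ⟨a, h⟩ => ⟨a, h.symm⟩⟩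
  rw [← Finset.powerset_univ, h, Finset.sum_powerset_insert (by simp), h2, Finset.sum_map,
    Finset.sum_map]
  rfl

/-- The increasing enumeration of a finite set is unique. Stating this inside an operation of
variable arity avoids casts along the equality of cardinalities. -/
lemma orderEmb_restrict {n k : ℕ} {V W : Type*} (f : ∀ k : ℕ, (Fin k → V) → W)
    (S : Finset (Fin n)) (hk : S.card = k) (g : Fin k → Fin n) (hg : StrictMono g)
    (hS : ∀ i, g i ∈ S) (v : Fin n → V) :
    f S.card (fun i => v (S.orderEmbOfFin rfl i)) = f k fun i => v (g i) := by
  subst hk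
  rw [Finset.orderEmbOfFin_unique rfl hS hg]

end Finsets

/-! ### Insertions as signed sums of pairings -/

section Insertion

variable {V W : Type*} [AddCommGroup V] [Module ℝ V] [AddCommGroup W] [Module ℝ W]

/-- Restriction of a tuple to the indices in `I`. -/
abbrev sub {n : ℕ} {β : Type*} (v : Fin n → β) (I : Finset (Fin n)) : Fin I.card → β :=
  fun i => v (I.orderEmbOfFin rfl i)

omit [AddCommGroup V] [Module ℝ V] in
lemma insertion_congr {V' : Type*} {f : ∀ k : ℕ, (Fin k → V) → W}
    {f' : ∀ k : ℕ, (Fin k → V') → W} {g : ∀ k : ℕ, (Fin k → V) → V}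
    {g' : ∀ k : ℕ, (Fin k → V') → V'} {n : ℕ} {e : Fin n → ℤ} {v : Fin n → V} {v' : Fin n → V'}
    (h : ∀ I : Finset (Fin n), f (Iᶜ.card + 1) (Fin.cons (g I.card (sub v I)) (sub v Iᶜ)) =
      f' (Iᶜ.card + 1) (Fin.cons (g' I.card (sub v' I)) (sub v' Iᶜ))) :
    insertion f g n e v = insertion f' g' n e v' :=
  Finset.sum_congr rfl fun I _ => congrArg _ (h I)

omit [AddCommGroup V] [Module ℝ V] in
lemma insertion_add_left (f f' : ∀ k : ℕ, (Fin k → V) → W) (g : ∀ k : ℕ, (Fin k → V) → V) {n : ℕ}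
    (e : Fin n → ℤ) (v : Fin n → V) :
    insertion (fun k w => f k w + f' k w) g n e v = insertion f g n e v + insertion f' g n e v := by
  simp [insertion, smul_add, Finset.sum_add_distrib]

lemma insertion_add_right (f : ∀ k : ℕ, MultilinearMap ℝ (fun _ : Fin k => V) W)
    (g g' : ∀ k : ℕ, (Fin k → V) → V) {n : ℕ} (e : Fin n → ℤ) (v : Fin n → V) :
    insertion (fun k => f k) (fun k w => g k w + g' k w) n e v =
      insertion (fun k => f k) g n e v + insertion (fun k => f k) g' n e v := by
  simp [insertion, MultilinearMap.cons_add, smul_add, Finset.sum_add_distrib]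

lemma map_insertion {V' W' : Type*} [AddCommGroup V'] [Module ℝ V'] [AddCommGroup W'] [Module ℝ W']
    (φ : V →ₗ[ℝ] V') (ψ : W →ₗ[ℝ] W')
    {f : ∀ k : ℕ, (Fin k → V) → W} {f' : ∀ k : ℕ, (Fin k → V') → W'}
    {g : ∀ k : ℕ, (Fin k → V) → V} {g' : ∀ k : ℕ, (Fin k → V') → V'}
    (hf : ∀ k w, ψ (f k w) = f' k fun i => φ (w i)) (hg : ∀ k w, φ (g k w) = g' k fun i => φ (w i))
    {n : ℕ} (e : Fin n → ℤ) (v : Fin n → V) :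
    ψ (insertion f g n e v) = insertion f' g' n e fun i => φ (v i) := by
  simp only [insertion, map_sum, map_smul, hf]
  refine Finset.sum_congr rfl fun I _ => ?_
  congr 2
  ext i
  induction i using Fin.cases <;> simp [hg]

variable {P N : Type*} [AddCommGroup P] [Module ℝ P] [AddCommGroup N] [Module ℝ N]

/-- Graded antisymmetry of the forms `f`. -/
def GradedAntisymm (gr : ℤ → Submodule ℝ P) (f : ∀ n : ℕ, (Fin n → P) → ℝ) : Prop :=
  ∀ (n : ℕ) (σ : Equiv.Perm (Fin n)) (e : Fin n → ℤ) (p : Fin n → P), (∀ i, p i ∈ gr (e i)) →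
    f n (fun i => p (σ i)) = (((permSign σ e : ℤˣ) : ℤ) : ℝ) * f n p

lemma unit_mul_self (u : ℤˣ) : (((u : ℤˣ) : ℤ) : ℝ) * (((u : ℤˣ) : ℤ) : ℝ) = 1 := by
  rcases Int.units_eq_one_or u with rfl | rfl <;> simp

/-- Antisymmetry under a cyclic rotation moves the inserted element from the first slot to the last,
where a form can be read as a pairing with its gradient. -/
lemma insertion_term {gr : ℤ → Submodule ℝ P} {f : ∀ n : ℕ, (Fin n → P) → ℝ}
    (hf : GradedAntisymm gr f) {n : ℕ} {e : Fin n → ℤ} {p : Fin n → P} (hp : ∀ i, p i ∈ gr (e i))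
    (I : Finset (Fin n)) {y : P} (hy : y ∈ gr (∑ i ∈ I, e i + 2 - I.card)) :
    (((Int.negOnePow (Iᶜ.card : ℤ) * shuffleSign I e : ℤˣ) : ℤ) : ℝ) •
      f (Iᶜ.card + 1) (Fin.cons y (sub p Iᶜ)) =
    (((degSign I e : ℤˣ) : ℤ) : ℝ) *
      f (Iᶜ.card + 1) (Fin.snoc (α := fun _ => P) (sub p Iᶜ) y) := by
  have h := hf (Iᶜ.card + 1) (finRotate _) (Fin.cons (∑ i ∈ I, e i + 2 - I.card) (sub e Iᶜ))
    (Fin.cons y (sub p Iᶜ)) (fun i => by induction i using Fin.cases <;> simp [hy, hp])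
  rw [permSign_finRotate] at h
  have hs := insertion_sign I e
  generalize Int.negOnePow (Iᶜ.card : ℤ) * shuffleSign I e = u at hs ⊢
  rw [Fin.snoc_eq_cons_rotate, h, ← hs]
  generalize (∏ i, -(sub e Iᶜ i * (∑ i ∈ I, e i + 2 - I.card)).negOnePow) = w
  rw [Units.val_mul, Int.cast_mul, mul_assoc, ← mul_assoc _ _ (f _ _), unit_mul_self, one_mul,
    smul_eq_mul]

/-- The signed sum `∑_I ± ⟨Y_{Iᶜ}, Z_I⟩`. -/
def bracketSum (B : N →ₗ[ℝ] N →ₗ[ℝ] ℝ) {n : ℕ} (e : Fin n → ℤ) (Y Z : Finset (Fin n) → N) : ℝ :=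
  ∑ I : Finset (Fin n), (((degSign I e : ℤˣ) : ℤ) : ℝ) * B (Y Iᶜ) (Z I)

/-- Differentiating a functional along a vector field is pairing its gradient Y with the field Z.
Every term of the master equations is put in this form. -/
lemma insertion_eq_bracketSum (B : N →ₗ[ℝ] N →ₗ[ℝ] ℝ)
    {gr : ℤ → Submodule ℝ P} {f : ∀ n : ℕ, (Fin n → P) → ℝ} {g : ∀ k : ℕ, (Fin k → P) → P}
    (hf : GradedAntisymm gr f) {n : ℕ} {e : Fin n → ℤ} {p : Fin n → P} (hp : ∀ i, p i ∈ gr (e i))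
    (hg : ∀ I : Finset (Fin n), g I.card (sub p I) ∈ gr (∑ i ∈ I, e i + 2 - I.card))
    {Y Z : Finset (Fin n) → N}
    (h : ∀ I : Finset (Fin n), f (Iᶜ.card + 1)
      (Fin.snoc (α := fun _ => P) (sub p Iᶜ) (g I.card (sub p I))) = B (Y Iᶜ) (Z I)) :
    insertion f g n e p = bracketSum B e Y Z :=
  Finset.sum_congr rfl fun I _ => by rw [← h, ← insertion_term hf hp I (hg I)]

variable {B : N →ₗ[ℝ] N →ₗ[ℝ] ℝ} {gr : ℤ → Submodule ℝ N}

lemma degSign_term_compl (hsymm : ∀ x y, B x y = B y x)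
    (hdeg : ∀ i j x y, x ∈ gr i → y ∈ gr j → i + j ≠ 3 → B x y = 0) {n : ℕ} (e : Fin n → ℤ)
    {y z : N} {I : Finset (Fin n)} (hy : y ∈ gr (∑ i ∈ Iᶜ, e i + 2 - Iᶜ.card))
    (hz : z ∈ gr (∑ i ∈ I, e i + 2 - I.card)) :
    (((degSign Iᶜ e : ℤˣ) : ℤ) : ℝ) * B z y = (((degSign I e : ℤˣ) : ℤ) : ℝ) * B y z := by
  rw [hsymm z y]
  by_cases h : (∑ i ∈ Iᶜ, e i + 2 - Iᶜ.card) + (∑ i ∈ I, e i + 2 - I.card) = 3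
  · rw [degSign_compl I e h]
  · rw [hdeg _ _ _ _ hy hz h, mul_zero, mul_zero]

/-- Complementation of I exchanges the two factors. It preserves the sign whenever the pairing is
nonzero, so ⟨Y, Z⟩ is symmetric. -/
lemma bracketSum_comm (hsymm : ∀ x y, B x y = B y x)
    (hdeg : ∀ i j x y, x ∈ gr i → y ∈ gr j → i + j ≠ 3 → B x y = 0) {n : ℕ} (e : Fin n → ℤ)
    {Y Z : Finset (Fin n) → N} (hY : ∀ I, Y I ∈ gr (∑ i ∈ I, e i + 2 - I.card))
    (hZ : ∀ I, Z I ∈ gr (∑ i ∈ I, e i + 2 - I.card)) :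
    bracketSum B e Y Z = bracketSum B e Z Y := by
  refine Finset.sum_nbij' compl compl (by simp) (by simp) (by simp) (by simp) fun I _ => ?_
  rw [compl_compl, degSign_term_compl hsymm hdeg e (hY Iᶜ) (hZ I)]

lemma bracketSum_sub_left {n : ℕ} (e : Fin n → ℤ) (Y Y' Z : Finset (Fin n) → N) :
    bracketSum B e (fun I => Y I - Y' I) Z = bracketSum B e Y Z - bracketSum B e Y' Z := by
  simp [bracketSum, mul_sub]

lemma bracketSum_sub_right {n : ℕ} (e : Fin n → ℤ) (Y Z Z' : Finset (Fin n) → N) :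
    bracketSum B e Y (fun I => Z I - Z' I) = bracketSum B e Y Z - bracketSum B e Y Z' := by
  simp [bracketSum, mul_sub]

end Insertion

/-! ### The identity ⟨Q, Q⟩ = 0 for a cyclic L∞-algebra -/

section Cyclic

lemma shuffleSign_castSucc {n : ℕ} (J : Finset (Fin n)) (e : Fin (n + 1) → ℤ) :
    shuffleSign (J.map Fin.castSuccEmb) e = shuffleSign J fun i => e i.castSucc := by
  unfold shuffleSign
  rw [Finset.prod_filter, Finset.prod_filter, ← Finset.univ_product_univ, Finset.prod_product,
    ← Finset.univ_product_univ, Finset.prod_product, Fin.prod_univ_castSucc]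
  simp [Fin.prod_univ_castSucc, (Fin.castSucc_lt_last _).le.not_gt]

variable {N : Type*} [AddCommGroup N] [Module ℝ N]

/-- Brackets satisfying the Jacobi identities and invariant under a symmetric pairing of
degree `-3`. -/
structure IsCyclic (gr : ℤ → Submodule ℝ N) (ℓ : Brackets N) (B : N →ₗ[ℝ] N →ₗ[ℝ] ℝ) : Prop where
  uncurved : ℓ 0 = 0
  degree : ∀ (k : ℕ) (e : Fin k → ℤ) (v : Fin k → N), (∀ i, v i ∈ gr (e i)) →
    ℓ k v ∈ gr (∑ i, e i + 2 - k)
  jacobi : ∀ (n : ℕ) (e : Fin n → ℤ) (v : Fin n → N), (∀ i, v i ∈ gr (e i)) →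
    insertion (fun k => ℓ k) (fun k => ℓ k) n e v = 0
  symm : ∀ x y, B x y = B y x
  pair_degree : ∀ i j x y, x ∈ gr i → y ∈ gr j → i + j ≠ 3 → B x y = 0
  invariant : GradedAntisymm gr fun n => cyclicForm B ℓ n

variable {gr : ℤ → Submodule ℝ N} {ℓ : Brackets N} {B : N →ₗ[ℝ] N →ₗ[ℝ] ℝ}

/-- The bracket of the entries of `a` indexed by `I`. -/
abbrev subBr (ℓ : Brackets N) {n : ℕ} (a : Fin n → N) (I : Finset (Fin n)) : N :=
  ℓ I.card (sub a I)

/-- The complement of J in `Fin (n + 1)` is Jᶜ followed by the last index, so the last entry of a is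
the one fed to the pairing. -/
lemma cyclicForm_castSucc {n : ℕ} (a : Fin (n + 1) → N) (J : Finset (Fin n)) (y : N) :
    cyclicForm B ℓ ((J.map Fin.castSuccEmb)ᶜ.card + 1)
      (Fin.cons y (sub a (J.map Fin.castSuccEmb)ᶜ)) =
    B (ℓ (Jᶜ.card + 1) (Fin.cons y (sub (fun i => a i.castSucc) Jᶜ))) (a (Fin.last n)) := by
  have hc : (J.map Fin.castSuccEmb)ᶜ.card = Jᶜ.card + 1 := by
    have := J.card_le_univ
    simp only [Finset.card_compl, Finset.card_map, Fintype.card_fin] at *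
    omega
  rw [orderEmb_restrict (fun k w => cyclicForm B ℓ (k + 1) (Fin.cons y w)) _ hc
    (Fin.snoc (α := fun _ => Fin (n + 1)) (fun i => (Jᶜ.orderEmbOfFin rfl i).castSucc)
      (Fin.last n)), cyclicForm_succ]
  · congr 2
    · congr 1
      ext i
      induction i using Fin.cases <;> simp
    · rw [← Fin.succ_last, Fin.cons_succ, Fin.snoc_last]
  · intro i j hij
    induction j using Fin.lastCases with
    | last =>
      induction i using Fin.lastCases with
      | last => exact absurd hij (lt_irrefl _)
      | cast i => simp [Fin.castSucc_lt_last]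
    | cast j =>
      induction i using Fin.lastCases with
      | last => exact absurd hij (Fin.castSucc_lt_last j).le.not_gt
      | cast i => simpa using hij
  · intro i
    induction i using Fin.lastCases with
    | last => simp
    | cast i =>
      have := Finset.orderEmbOfFin_mem Jᶜ rfl i
      simpa using Finset.mem_compl.1 this

namespace IsCyclic

variable (h : IsCyclic gr ℓ B)
include h

lemma subBr_mem {n : ℕ} {e : Fin n → ℤ} {a : Fin n → N} (ha : ∀ i, a i ∈ gr (e i))
    (I : Finset (Fin n)) : subBr ℓ a I ∈ gr (∑ i ∈ I, e i + 2 - I.card) := by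
  have := h.degree I.card (sub e I) (sub a I) fun i => ha _
  rwa [sum_orderEmbOfFin] at this

lemma bracket_term {n : ℕ} {e : Fin n → ℤ} {a : Fin n → N} (ha : ∀ i, a i ∈ gr (e i))
    (I : Finset (Fin n)) :
    (((Int.negOnePow (Iᶜ.card : ℤ) * shuffleSign I e : ℤˣ) : ℤ) : ℝ) •
      cyclicForm B ℓ (Iᶜ.card + 1) (Fin.cons (subBr ℓ a I) (sub a Iᶜ)) =
    (((degSign I e : ℤˣ) : ℤ) : ℝ) * B (subBr ℓ a Iᶜ) (subBr ℓ a I) := by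
  rw [insertion_term h.invariant ha I (h.subBr_mem ha I), cyclicForm_succ]
  simp only [Fin.snoc_castSucc, Fin.snoc_last]

/-- This is the Jacobi identity for the first n entries, paired with the last one: invariance turns
⟨ℓ(ℓ(a_I), …), a_n⟩ into ± ⟨ℓ(a_{Iᶜ}), ℓ(a_I)⟩. -/
lemma sum_not_mem_last {n : ℕ} {e : Fin (n + 1) → ℤ} {a : Fin (n + 1) → N}
    (ha : ∀ i, a i ∈ gr (e i)) :
    ∑ I : Finset (Fin (n + 1)), (if Fin.last n ∈ I then 0 else
      (((degSign I e : ℤˣ) : ℤ) : ℝ) * B (subBr ℓ a Iᶜ) (subBr ℓ a I)) = 0 := by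
  -- The minus sign compensates for the complement of I having one element more in `Fin (n + 1)`
  -- than in `Fin n`.
  have hj := congrArg (fun y => - B y (a (Fin.last n)))
    (h.jacobi n (fun i => e i.castSucc) (fun i => a i.castSucc) fun i => ha _)
  simp only [insertion, map_sum, map_smul, LinearMap.sum_apply, LinearMap.smul_apply, map_zero,
    LinearMap.zero_apply, neg_zero] at hj
  refine Eq.trans ?_ hj
  rw [sum_finset_fin_succ, ← Finset.sum_neg_distrib]
  simp only [Finset.mem_insert_self, if_true, Finset.sum_const_zero, add_zero]
  refine Finset.sum_congr rfl fun J _ => ?_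
  have hc : (J.map Fin.castSuccEmb)ᶜ.card = Jᶜ.card + 1 := by
    have := J.card_le_univ
    simp only [Finset.card_compl, Finset.card_map, Fintype.card_fin] at *
    omega
  rw [if_neg (by simp), ← h.bracket_term ha, cyclicForm_castSucc, shuffleSign_castSucc, hc,
    subBr, orderEmb_restrict (fun k w => ℓ k w) (J.map Fin.castSuccEmb) (J.card_map _)
      (fun i => (J.orderEmbOfFin rfl i).castSucc) (fun i j hij => by simpa using hij) (by simp) a]
  simp [Int.negOnePow_add]

/-- For any chosen index i, complementation matches the subsets containing i with those avoiding it,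
and matched terms are equal. -/
lemma bracketSum_eq_two_mul {n : ℕ} {e : Fin n → ℤ} {a : Fin n → N} (ha : ∀ i, a i ∈ gr (e i))
    (i : Fin n) :
    bracketSum B e (subBr ℓ a) (subBr ℓ a) = 2 * ∑ I : Finset (Fin n), (if i ∈ I then 0 else
      (((degSign I e : ℤˣ) : ℤ) : ℝ) * B (subBr ℓ a Iᶜ) (subBr ℓ a I)) := by
  have h2 : ∑ I : Finset (Fin n), (if i ∈ I then 0 else
      (((degSign I e : ℤˣ) : ℤ) : ℝ) * B (subBr ℓ a Iᶜ) (subBr ℓ a I)) =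
      ∑ I : Finset (Fin n), (if i ∈ I then
        (((degSign I e : ℤˣ) : ℤ) : ℝ) * B (subBr ℓ a Iᶜ) (subBr ℓ a I) else 0) := by
    refine Finset.sum_nbij' compl compl (by simp) (by simp) (by simp) (by simp) fun I _ => ?_
    rw [compl_compl, degSign_term_compl h.symm h.pair_degree e (h.subBr_mem ha _)
      (h.subBr_mem ha _)]
    by_cases hI : i ∈ I <;> simp [hI]
  rw [two_mul]
  nth_rewrite 2 [h2]
  rw [← Finset.sum_add_distrib]
  refine Finset.sum_congr rfl fun I _ => ?_
  by_cases hI : i ∈ I <;> simp [hI]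

lemma bracketSum_self {n : ℕ} {e : Fin n → ℤ} {a : Fin n → N} (ha : ∀ i, a i ∈ gr (e i)) :
    bracketSum B e (subBr ℓ a) (subBr ℓ a) = 0 := by
  cases n with
  | zero =>
    have h0 : ∀ k, k = 0 → ∀ w, ℓ k w = 0 := by
      rintro _ rfl w
      rw [h.uncurved, zero_apply]
    refine Finset.sum_eq_zero fun I _ => ?_
    rw [subBr, h0 _ (by simp [Subsingleton.elim Iᶜ ∅])]
    simp
  | succ n => rw [h.bracketSum_eq_two_mul ha (Fin.last n), h.sum_not_mem_last ha, mul_zero]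

/-- The Jacobi identity gives the half sum only for the last index. Since the full sum vanishes and
is twice the half sum for every i, no permutation of the arguments is needed to reach the other
indices. -/
lemma sum_not_mem {n : ℕ} {e : Fin n → ℤ} {a : Fin n → N} (ha : ∀ i, a i ∈ gr (e i)) (i : Fin n) :
    ∑ I : Finset (Fin n), (if i ∈ I then 0 else
      (((degSign I e : ℤˣ) : ℤ) : ℝ) * B (subBr ℓ a Iᶜ) (subBr ℓ a I)) = 0 := by
  have h1 := h.bracketSum_eq_two_mul ha i
  rw [h.bracketSum_self ha] at h1
  linarith

end IsCyclic

end Cyclic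

/-! ### Taylor expansions of the Hamiltonian and of the mixed brackets -/

section HamForm

variable {V R : Type*} [AddCommGroup V] [Module ℝ V] [AddCommGroup R] [Module ℝ R]

lemma pick_apply {k : ℕ} (S : Finset (Fin k)) (i : Fin k) (p : V × V) :
    pick S i p = if i ∈ S then p.1 else p.2 := by
  unfold pick
  split_ifs <;> rfl

/-- This computes both gradients of the Hamiltonian, by splitting according to whether S contains
the last index. If it does, nonemptiness is automatic and two fields must remain among the first k
arguments. If it does not, the last argument is one of the two fields and one more suffices. The
target R is general so that this applies both to real numbers and to densities. -/
lemma hamForm_snoc (B : V →ₗ[ℝ] V →ₗ[ℝ] R) (ℓ : Brackets V) (k : ℕ) (p : Fin k → V × V)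
    (q : V × V) :
    hamForm B ℓ (k + 1) (Fin.snoc (α := fun _ => V × V) p q) =
      B (∑ S : Finset (Fin k) with S.card + 2 ≤ k, ℓ k fun i => pick S i (p i)) q.1 +
        B (mixedBracket ℓ k p) q.2 := by
  rw [hamForm_apply, Finset.sum_filter, sum_finset_fin_succ, add_comm]
  congr 1
  · rw [map_sum, LinearMap.sum_apply, Finset.sum_filter]
    refine Finset.sum_congr rfl fun S _ => ?_
    simp [cyclicForm_succ, pick_apply, (Fin.castSucc_lt_last _).ne]
  · rw [mixedBracket_apply, map_sum, LinearMap.sum_apply, Finset.sum_filter]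
    refine Finset.sum_congr rfl fun S _ => ?_
    have hS : S.card + 2 ≤ k + 1 ↔ ¬ S = Finset.univ := by
      rw [← ne_eq, ← Finset.card_lt_iff_ne_univ, Fintype.card_fin]
      omega
    simp [hS, cyclicForm_succ, pick_apply]

/-- The subsets left out are those with at most one element in the complement: the whole set and its
one-point deletions. -/
lemma sum_card_add_two_le {β : Type*} [AddCommGroup β] {k : ℕ} (g : Finset (Fin k) → β) :
    ∑ S : Finset (Fin k) with S.card + 2 ≤ k, g S =
      ∑ S, g S - g Finset.univ - ∑ i, g (Finset.univ.erase i) := by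
  have h : (Finset.univ : Finset (Finset (Fin k))) =
      (Finset.univ.filter fun S => S.card + 2 ≤ k) ∪
        insert Finset.univ (Finset.univ.image fun i => Finset.univ.erase i) := by
    ext S
    simp only [Finset.mem_univ, Finset.mem_union, Finset.mem_filter, true_and, Finset.mem_insert,
      Finset.mem_image, true_iff]
    by_cases h1 : S = Finset.univ
    · exact Or.inr (Or.inl h1)
    · have hlt := (Finset.card_lt_iff_ne_univ S).2 h1
      rw [Fintype.card_fin] at hlt
      by_cases h2 : S.card + 2 ≤ k
      · exact Or.inl h2
      · refine Or.inr (Or.inr ?_)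
        have : Sᶜ.card = 1 := by rw [Finset.card_compl, Fintype.card_fin]; omega
        obtain ⟨i, hi⟩ := Finset.card_eq_one.1 this
        refine ⟨i, ?_⟩
        rw [← compl_compl S, hi]
        ext; simp
  have hs : ∑ S, g S = ∑ S : Finset (Fin k) with S.card + 2 ≤ k, g S +
      (g Finset.univ + ∑ i, g (Finset.univ.erase i)) := by
    conv_lhs => rw [h]
    rw [Finset.sum_union, Finset.sum_insert, Finset.sum_image]
    · intro i _ j _ hij
      by_contra hne
      have : i ∈ Finset.univ.erase j := by simp [hne]
      simp [← show Finset.univ.erase i = Finset.univ.erase j from hij] at this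
    · simp
    · rw [Finset.disjoint_left]
      intro S hS hS'
      rw [Finset.mem_filter] at hS
      rw [Finset.mem_insert, Finset.mem_image] at hS'
      rcases hS' with rfl | ⟨i, -, rfl⟩
      · simp at hS
      · rw [Finset.card_erase_of_mem (Finset.mem_univ i)] at hS
        have := i.pos
        simp at hS
        omega
  rw [hs]
  abel

lemma map_add_eq_sum_pick {k : ℕ} (f : MultilinearMap ℝ (fun _ : Fin k => V) R)
    (p : Fin k → V × V) :
    f (fun i => (p i).1 + (p i).2) = ∑ S : Finset (Fin k), f fun i => pick S i (p i) := by
  have := f.map_add_univ (fun i => (p i).1) fun i => (p i).2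
  refine Eq.trans this (Finset.sum_congr rfl fun S _ => congrArg f ?_)
  ext i
  simp [pick_apply, Finset.piecewise]

/-- The second-order Taylor remainder f(X + u) - f(X) - Df(X)u in multilinear form. -/
lemma sum_pick_card {k : ℕ} (f : MultilinearMap ℝ (fun _ : Fin k => V) R) (p : Fin k → V × V) :
    ∑ S : Finset (Fin k) with S.card + 2 ≤ k, (f fun i => pick S i (p i)) =
      f (fun i => (p i).1 + (p i).2) - f (fun i => (p i).1) -
        ∑ i, f (Function.update (fun i => (p i).1) i (p i).2) := by
  rw [sum_card_add_two_le, map_add_eq_sum_pick]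
  congr 2
  · simp [pick_apply]
  · refine funext fun i => congrArg f ?_
    ext j
    by_cases hj : j = i
    · subst hj; simp [pick_apply]
    · simp [pick_apply, hj]

/-- Full expansion minus its two extreme terms. In arity zero the empty set and the whole set
coincide, and it is `h0` that makes the formula hold there. -/
lemma mixedBracket_eq {ℓ : Brackets V} (h0 : ℓ 0 = 0) (k : ℕ) (p : Fin k → V × V) :
    mixedBracket ℓ k p =
      ℓ k (fun i => (p i).1 + (p i).2) - ℓ k (fun i => (p i).1) - ℓ k (fun i => (p i).2) := by
  cases k with
  | zero => simp [mixedBracket, h0]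
  | succ k =>
    have h : (Finset.univ : Finset (Finset (Fin (k + 1)))) =
        insert Finset.univ (insert ∅ (Finset.univ.filter fun S => S.Nonempty ∧ S ≠ Finset.univ)) := by
      ext S
      simp [Finset.nonempty_iff_ne_empty]
      tauto
    have hs : ∑ S : Finset (Fin (k + 1)), (ℓ (k + 1) fun i => pick S i (p i)) =
        ℓ (k + 1) (fun i => (p i).1) + (ℓ (k + 1) (fun i => (p i).2) +
          ∑ S : Finset (Fin (k + 1)) with S.Nonempty ∧ S ≠ Finset.univ,
            ℓ (k + 1) fun i => pick S i (p i)) := by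
      conv_lhs => rw [h]
      rw [Finset.sum_insert, Finset.sum_insert]
      · simp [pick_apply]
      · simp
      · simp [← Finset.nonempty_iff_ne_empty]
    rw [mixedBracket_apply, map_add_eq_sum_pick, hs]
    abel

end HamForm

/-! ### The Maurer–Cartan equations for a cyclic L∞-algebra acting on itself -/

namespace IsCyclic

variable {N : Type*} [AddCommGroup N] [Module ℝ N]
variable {gr : ℤ → Submodule ℝ N} {ℓ : Brackets N} {B : N →ₗ[ℝ] N →ₗ[ℝ] ℝ} (h : IsCyclic gr ℓ B)

lemma pick_mem {k : ℕ} (S : Finset (Fin k)) (i : Fin k) {e : ℤ} {p : N × N}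
    (hp : p ∈ prodGr gr gr e) : pick S i p ∈ gr e := by
  rw [pick_apply]
  split_ifs
  exacts [hp.1, hp.2]

include h

lemma cyclicForm_eq_zero {n : ℕ} {e : Fin n → ℤ} {v : Fin n → N} (hv : ∀ i, v i ∈ gr (e i))
    (hne : ∑ i, e i ≠ n) : cyclicForm B ℓ n v = 0 := by
  cases n with
  | zero => rfl
  | succ n =>
    refine h.pair_degree _ _ _ _ (h.degree n _ _ fun i => hv i.castSucc) (hv (Fin.last n)) ?_
    rw [Fin.sum_univ_castSucc] at hne
    push_cast at hne
    intro hh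
    exact hne (by linarith)

lemma hamForm_antisymm : GradedAntisymm (prodGr gr gr) fun n => hamForm B ℓ n := by
  intro n σ e p hp
  simp only [hamForm_apply, Finset.mul_sum]
  refine Finset.sum_nbij' (fun S => S.map σ.toEmbedding) (fun S => S.map σ.symm.toEmbedding)
    (by simp) (by simp) ?_ ?_ fun S _ => ?_
  · intro S _; ext; simp
  · intro S _; ext; simp
  · rw [← h.invariant n σ e _ fun i => pick_mem _ i (hp i)]
    congr 1
    ext i
    simp [pick_apply]

lemma isHamCochain : IsHamCochain gr gr (hamForm B ℓ) where
  reduced := by simp [hamForm]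
  degree n e p hp hne := by
    rw [hamForm_apply]
    exact Finset.sum_eq_zero fun S _ => h.cyclicForm_eq_zero (fun i => pick_mem S i (hp i)) hne
  antisymm := h.hamForm_antisymm
  vanish n m := by
    rw [hamForm_apply]
    refine Finset.sum_eq_zero fun S hS => ?_
    obtain ⟨i, hi⟩ := (Finset.mem_filter.1 hS).2.1
    exact MultilinearMap.map_coord_zero _ i (by simp [pick_apply, hi])

end IsCyclic

namespace IsCyclic

variable {N : Type*} [AddCommGroup N] [Module ℝ N]
variable {gr : ℤ → Submodule ℝ N} {ℓ : Brackets N} {B : N →ₗ[ℝ] N →ₗ[ℝ] ℝ} (h : IsCyclic gr ℓ B)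
include h

/-- The identity ⟨DQ(X)u, Q(X)⟩ = 0. Grouping by the index j at which u is inserted, the condition j
∉ I says that u_j occurs in the first factor, and each group is `sum_not_mem` for the tuple X with
X_j replaced by u_j. -/
lemma bracketSum_update {n : ℕ} {e : Fin n → ℤ} {p : Fin n → N × N}
    (hp : ∀ i, p i ∈ prodGr gr gr (e i)) :
    bracketSum B e (fun I => ∑ i, ℓ I.card
        (Function.update (fun j => (sub p I j).1) i (sub p I i).2))
      (subBr ℓ fun i => (p i).1) = 0 := by
  have key : ∀ I : Finset (Fin n), (((degSign I e : ℤˣ) : ℤ) : ℝ) *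
      B (∑ i, ℓ Iᶜ.card (Function.update (fun j => (sub p Iᶜ j).1) i (sub p Iᶜ i).2))
        (subBr ℓ (fun i => (p i).1) I) =
      ∑ j, if j ∈ I then 0 else (((degSign I e : ℤˣ) : ℤ) : ℝ) *
        B (subBr ℓ (Function.update (fun i => (p i).1) j (p j).2) Iᶜ)
          (subBr ℓ (Function.update (fun i => (p i).1) j (p j).2) I) := by
    intro I
    have h1 : (Finset.univ.filter fun j => j ∉ I) = Iᶜ := by ext; simp
    simp only [← ite_not (_ ∈ I)]
    rw [← Finset.sum_filter, h1, ← sum_orderEmbOfFin Iᶜ, map_sum, LinearMap.sum_apply, Finset.mul_sum]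
    refine Finset.sum_congr rfl fun i _ => ?_
    have hi : (Iᶜ.orderEmbOfFin rfl i) ∉ I := Finset.mem_compl.1 (Finset.orderEmbOfFin_mem _ _ _)
    have e1 : sub (Function.update (fun i => (p i).1) (Iᶜ.orderEmbOfFin rfl i)
        (p (Iᶜ.orderEmbOfFin rfl i)).2) Iᶜ =
        Function.update (fun j => (sub p Iᶜ j).1) i (sub p Iᶜ i).2 := by
      ext j
      by_cases hj : j = i
      · subst hj; simp
      · simp [hj]
    have e2 : sub (Function.update (fun i => (p i).1) (Iᶜ.orderEmbOfFin rfl i)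
        (p (Iᶜ.orderEmbOfFin rfl i)).2) I = sub (fun i => (p i).1) I := by
      ext j
      have hj : I.orderEmbOfFin rfl j ≠ Iᶜ.orderEmbOfFin rfl i := fun hh =>
        hi (hh ▸ Finset.orderEmbOfFin_mem _ _ _)
      simp [hj]
    rw [subBr, subBr, subBr, e1, e2]
  rw [bracketSum, Finset.sum_congr rfl fun I _ => key I, Finset.sum_comm]
  refine Finset.sum_eq_zero fun j _ => h.sum_not_mem (fun i => ?_) j
  by_cases hi : i = j
  · subst hi; simpa using (hp i).2
  · simpa [hi] using (hp i).1

/-- The differential along the background field is ⟨Q(X + u) - Q(X) - DQ(X)u, Q(X)⟩, of which only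
the first term survives. -/
lemma insertion_fst {n : ℕ} {e : Fin n → ℤ} {p : Fin n → N × N}
    (hp : ∀ i, p i ∈ prodGr gr gr (e i)) :
    insertion (fun n => hamForm B ℓ n) (fun k p => (ℓ k fun i => (p i).1, 0)) n e p =
      bracketSum B e (subBr ℓ fun i => (p i).1 + (p i).2) (subBr ℓ fun i => (p i).1) := by
  rw [insertion_eq_bracketSum B h.hamForm_antisymm hp
    (Y := fun I => subBr ℓ (fun i => (p i).1 + (p i).2) I - subBr ℓ (fun i => (p i).1) I -
      ∑ i, ℓ I.card (Function.update (fun j => (sub p I j).1) i (sub p I i).2))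
    (Z := subBr ℓ fun i => (p i).1), bracketSum_sub_left, bracketSum_sub_left,
    h.bracketSum_self fun i => (hp i).1, h.bracketSum_update hp, sub_zero, sub_zero]
  · exact fun I => ⟨h.subBr_mem (fun i => (hp i).1) I, Submodule.zero_mem _⟩
  · intro I
    rw [hamForm_snoc, map_zero, add_zero, sum_pick_card]

lemma insertion_snd {n : ℕ} {e : Fin n → ℤ} {p : Fin n → N × N}
    (hp : ∀ i, p i ∈ prodGr gr gr (e i)) (g : ∀ k : ℕ, (Fin k → N × N) → N)
    (hg : ∀ I : Finset (Fin n), g I.card (sub p I) ∈ gr (∑ i ∈ I, e i + 2 - I.card)) :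
    insertion (fun n => hamForm B ℓ n) (fun k p => (0, g k p)) n e p =
      bracketSum B e (fun I => subBr ℓ (fun i => (p i).1 + (p i).2) I -
        subBr ℓ (fun i => (p i).1) I - subBr ℓ (fun i => (p i).2) I)
        fun I => g I.card (sub p I) := by
  rw [insertion_eq_bracketSum B h.hamForm_antisymm hp]
  · exact fun I => ⟨Submodule.zero_mem _, hg I⟩
  · intro I
    rw [hamForm_snoc, map_zero, zero_add, mixedBracket_eq h.uncurved]

lemma insertion_cyclicForm_snd {n : ℕ} {e : Fin n → ℤ} {p : Fin n → N × N}
    (hp : ∀ i, p i ∈ prodGr gr gr (e i)) (g : ∀ k : ℕ, (Fin k → N × N) → N × N)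
    (hg : ∀ I : Finset (Fin n), g I.card (sub p I) ∈ prodGr gr gr (∑ i ∈ I, e i + 2 - I.card)) :
    insertion (fun n (p : Fin n → N × N) => cyclicForm B ℓ n fun i => (p i).2) g n e p =
      bracketSum B e (subBr ℓ fun i => (p i).2) fun I => (g I.card (sub p I)).2 := by
  refine insertion_eq_bracketSum B (gr := prodGr gr gr)
    (fun n σ e p hp => h.invariant n σ e _ fun i => (hp i).2) hp hg fun I => ?_
  rw [cyclicForm_succ]
  simp

omit h in
lemma add_mem_gr {e : ℤ} {p : N × N} (hp : p ∈ prodGr gr gr e) : p.1 + p.2 ∈ gr e :=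
  Submodule.add_mem _ hp.1 hp.2

theorem maurerCartan :
    MaurerCartan gr gr (sumBrackets ℓ ℓ) (fun n => hamForm B ℓ n) fun k => mixedBracket ℓ k := by
  intro n e p hp
  have hs := fun I => h.subBr_mem (fun i => add_mem_gr (hp i)) I
  have h1 := fun I => h.subBr_mem (fun i => (hp i).1) I
  have h2 := fun I => h.subBr_mem (fun i => (hp i).2) I
  have e1 : insertion (fun n => hamForm B ℓ n) (sumBrackets ℓ ℓ) n e p =
      insertion (fun n => hamForm B ℓ n) (fun k p => (ℓ k fun i => (p i).1, 0)) n e p +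
      insertion (fun n => hamForm B ℓ n) (fun k p => (0, ℓ k fun i => (p i).2)) n e p := by
    rw [← insertion_add_right]
    simp only [Prod.mk_add_mk, add_zero, zero_add]
    rfl
  have hm : (fun I : Finset (Fin n) => mixedBracket ℓ I.card (sub p I)) = fun I =>
      subBr ℓ (fun i => (p i).1 + (p i).2) I - subBr ℓ (fun i => (p i).1) I -
        subBr ℓ (fun i => (p i).2) I := funext fun I => mixedBracket_eq h.uncurved _ _
  rw [e1, h.insertion_fst hp, h.insertion_snd hp _ h2, h.insertion_snd hp _ fun I => ?_, hm]
  -- With s = Q(X + u), a = Q(X), b = Q(u), the claim is ⟨s, a⟩ + ⟨s - a - b, b⟩ + ½⟨s - a - b, s -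
  -- a - b⟩ = 0, given symmetry and ⟨s, s⟩ = ⟨a, a⟩ = ⟨b, b⟩ = 0.
  · simp only [bracketSum_sub_left, bracketSum_sub_right]
    rw [bracketSum_comm h.symm h.pair_degree e h1 hs, bracketSum_comm h.symm h.pair_degree e h2 hs,
      bracketSum_comm h.symm h.pair_degree e h2 h1, h.bracketSum_self fun i => add_mem_gr (hp i),
      h.bracketSum_self fun i => (hp i).1, h.bracketSum_self fun i => (hp i).2]
    ring
  · rw [mixedBracket_eq h.uncurved]
    exact Submodule.sub_mem _ (Submodule.sub_mem _ (hs I) (h1 I)) (h2 I)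

theorem maurerCartan_total :
    MaurerCartan gr gr (fun k p => (ℓ k fun i => (p i).1, 0))
      (fun n p => hamForm B ℓ n p + cyclicForm B ℓ n fun i => (p i).2)
      fun k p => mixedBracket ℓ k p + ℓ k fun i => (p i).2 := by
  intro n e p hp
  have hs := fun I => h.subBr_mem (fun i => add_mem_gr (hp i)) I
  have h1 := fun I => h.subBr_mem (fun i => (hp i).1) I
  have h2 := fun I => h.subBr_mem (fun i => (hp i).2) I
  have hm : (fun (k : ℕ) (p : Fin k → N × N) => mixedBracket ℓ k p + ℓ k fun i => (p i).2) =
      fun k p => ℓ k (fun i => (p i).1 + (p i).2) - ℓ k fun i => (p i).1 := by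
    funext k p
    rw [mixedBracket_eq h.uncurved, sub_add_cancel]
  have hd := fun I => Submodule.sub_mem _ (hs I) (h1 I)
  rw [hm, insertion_add_left, insertion_add_left, h.insertion_fst hp, h.insertion_snd hp _ hd,
    h.insertion_cyclicForm_snd hp _ fun I => ⟨h1 I, Submodule.zero_mem _⟩,
    h.insertion_cyclicForm_snd hp _ fun I => ⟨Submodule.zero_mem _, hd I⟩]
  have h0 : bracketSum B e (subBr ℓ fun i => (p i).2) (fun _ => 0) = 0 := by simp [bracketSum]
  rw [h0]
  change _ + 1 / 2 * (bracketSum B e _ (fun I => subBr ℓ (fun i => (p i).1 + (p i).2) I -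
    subBr ℓ (fun i => (p i).1) I) + bracketSum B e _ (fun I =>
      subBr ℓ (fun i => (p i).1 + (p i).2) I - subBr ℓ (fun i => (p i).1) I)) = 0
  -- Adding S restores the term Q(u), so the total gradient in u is s - a. The equation reduces to
  -- ⟨s, a⟩ + ½⟨s - a, s - a⟩ = 0.
  simp only [bracketSum_sub_left, bracketSum_sub_right]
  rw [bracketSum_comm h.symm h.pair_degree e h1 hs, h.bracketSum_self fun i => add_mem_gr (hp i),
    h.bracketSum_self fun i => (hp i).1]
  ring

end IsCyclic

/-! ### Gradings, and the L∞-structure of the infinity adjoint brackets -/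

section

section Internal

lemma isInternal_of_projections {V : Type*} [AddCommGroup V] [Module ℝ V] (gr : ℤ → Submodule ℝ V)
    (pr : ℤ → V →ₗ[ℝ] V) (mem : ∀ i v, pr i v ∈ gr i) (same : ∀ i, ∀ v ∈ gr i, pr i v = v)
    (ne : ∀ i j, i ≠ j → ∀ v ∈ gr j, pr i v = 0)
    (sum : ∀ v, ∃ D : Finset ℤ, ∑ i ∈ D, pr i v = v) : DirectSum.IsInternal gr := by
  constructor
  · have key : ∀ j, pr j ∘ₗ DirectSum.coeLinearMap gr =
        (gr j).subtype ∘ₗ DirectSum.component ℝ ℤ (fun i => gr i) j := by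
      intro j
      refine DirectSum.linearMap_ext ℝ fun i => ?_
      ext x
      by_cases hij : j = i
      · subst hij
        simp [same]
      · simp [DirectSum.component.of, ne j i hij x x.2, Ne.symm hij]
    rw [injective_iff_map_eq_zero]
    intro x hx
    refine DFinsupp.ext fun j => ?_
    have h1 := LinearMap.congr_fun (key j) x
    have h2 : DirectSum.coeLinearMap gr x = 0 := hx
    rw [LinearMap.comp_apply, h2, map_zero] at h1
    exact Subtype.ext h1.symm
  · intro v
    obtain ⟨D, hD⟩ := sum v
    refine ⟨∑ i ∈ D, DirectSum.of (fun i => gr i) i ⟨pr i v, mem i v⟩, ?_⟩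
    rw [map_sum]
    conv_rhs => rw [← hD]
    refine Finset.sum_congr rfl fun i _ => ?_
    exact DirectSum.coeAddMonoidHom_of gr i _

/-- Allowing every larger index set D' lets two elements, here the components of a pair, be
decomposed over a common finite set. -/
lemma exists_projections {V : Type*} [AddCommGroup V] [Module ℝ V] {gr : ℤ → Submodule ℝ V}
    (h : DirectSum.IsInternal gr) : ∃ pr : ℤ → V →ₗ[ℝ] V, (∀ i v, pr i v ∈ gr i) ∧
      (∀ i, ∀ v ∈ gr i, pr i v = v) ∧ (∀ i j, i ≠ j → ∀ v ∈ gr j, pr i v = 0) ∧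
      ∀ v, ∃ D : Finset ℤ, ∀ D', D ⊆ D' → ∑ i ∈ D', pr i v = v := by
  classical
  let _ := h.chooseDecomposition
  refine ⟨fun i => (gr i).subtype ∘ₗ DirectSum.component ℝ ℤ (fun i => gr i) i ∘ₗ
    (DirectSum.decomposeLinearEquiv gr).toLinearMap, fun i v => Submodule.coe_mem _,
    fun i v hv => DirectSum.decompose_of_mem_same gr hv,
    fun i j hij v hv => DirectSum.decompose_of_mem_ne gr hv hij.symm, fun v =>
    ⟨(DirectSum.decompose gr v).support, fun D' hD' => ?_⟩⟩
  conv_rhs => rw [← DirectSum.sum_support_decompose gr v]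
  refine (Finset.sum_subset hD' fun i _ hi => ?_).symm
  rw [DFinsupp.notMem_support_iff] at hi
  change ((DirectSum.decompose gr v i : gr i) : V) = 0
  rw [hi]; rfl

lemma isInternal_prodGr {A N : Type*} [AddCommGroup A] [Module ℝ A] [AddCommGroup N] [Module ℝ N]
    {grA : ℤ → Submodule ℝ A} {grN : ℤ → Submodule ℝ N} (hA : DirectSum.IsInternal grA)
    (hN : DirectSum.IsInternal grN) : DirectSum.IsInternal (prodGr grA grN) := by
  classical
  obtain ⟨p, p1, p2, p3, p4⟩ := exists_projections hA
  obtain ⟨q, q1, q2, q3, q4⟩ := exists_projections hN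
  refine isInternal_of_projections _ (fun i => (p i).prodMap (q i)) (fun i v => ⟨p1 i _, q1 i _⟩)
    (fun i v hv => Prod.ext (p2 i _ hv.1) (q2 i _ hv.2))
    (fun i j hij v hv => Prod.ext (p3 i j hij _ hv.1) (q3 i j hij _ hv.2)) fun v => ?_
  obtain ⟨D, hD⟩ := p4 v.1
  obtain ⟨D', hD'⟩ := q4 v.2
  refine ⟨D ∪ D', Prod.ext ?_ ?_⟩
  · rw [Prod.fst_sum]
    exact hD _ Finset.subset_union_left
  · rw [Prod.snd_sum]
    exact hD' _ Finset.subset_union_right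

end Internal

section InfAdj

variable {A N : Type*} [AddCommGroup A] [Module ℝ A] [AddCommGroup N] [Module ℝ N]
  {ℓA : Brackets A} {ℓN : Brackets N} {j : A →ₗ[ℝ] N}

lemma infAdj_fst (k : ℕ) (p : Fin k → A × N) :
    (infAdj ℓA ℓN j k p).1 = ℓA k fun i => (p i).1 := by
  simp [infAdj, Prod.fst_sum]

lemma infAdj_snd (k : ℕ) (p : Fin k → A × N) :
    (infAdj ℓA ℓN j k p).2 = ∑ S : Finset (Fin k) with S ≠ Finset.univ,
      ℓN k fun i => if i ∈ S then j (p i).1 else (p i).2 := by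
  simp only [infAdj, add_apply, LinearMap.compMultilinearMap_apply,
    LinearMap.inl_apply, LinearMap.inr_apply, Prod.snd_add, zero_add, sum_apply,
    MultilinearMap.compLinearMap_apply]
  refine Finset.sum_congr rfl fun S _ => congrArg _ (funext fun i => ?_)
  split_ifs <;> rfl

lemma infAdj_snd_eq_sub (k : ℕ) (p : Fin k → A × N) :
    (infAdj ℓA ℓN j k p).2 = ℓN k (fun i => j (p i).1 + (p i).2) - ℓN k fun i => j (p i).1 := by
  have h := map_add_eq_sum_pick (ℓN k) fun i => (j (p i).1, (p i).2)
  have hu : (fun i => j (p i).1) =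
      fun i => pick (Finset.univ : Finset (Fin k)) i (j (p i).1, (p i).2) := by
    simp [pick_apply]
  rw [infAdj_snd, h, hu, Finset.filter_ne', Finset.sum_erase_eq_sub (Finset.mem_univ Finset.univ)]
  simp [pick_apply]

lemma infAdj_snd_eq_mixedBracket (h0 : ℓN 0 = 0) (k : ℕ) (p : Fin k → A × N) :
    (infAdj ℓA ℓN j k p).2 = ℓN k (fun i => (p i).2) +
      mixedBracket ℓN k fun i => (j (p i).1, (p i).2) := by
  rw [infAdj_snd_eq_sub, mixedBracket_eq h0]
  abel

/-- The projection to A and the map τ(X, u) = jX + u both commute with the brackets, and together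
they are injective. Antisymmetry and the Jacobi identities are therefore inherited from A and N. -/
lemma isLInfty_infAdj {grA : ℤ → Submodule ℝ A} {grN : ℤ → Submodule ℝ N}
    (hA : IsLInfty grA ℓA) (hN : IsLInfty grN ℓN) (hgr : ∀ i, ∀ a ∈ grA i, j a ∈ grN i)
    (hbr : ∀ k (a : Fin k → A), j (ℓA k a) = ℓN k fun i => j (a i)) :
    IsLInfty (prodGr grA grN) (infAdj ℓA ℓN j) := by
  let τ : A × N →ₗ[ℝ] N := j ∘ₗ LinearMap.fst ℝ A N + LinearMap.snd ℝ A N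
  have hτ : ∀ k p, τ (infAdj ℓA ℓN j k p) = ℓN k fun i => τ (p i) := fun k p => by
    change j (infAdj ℓA ℓN j k p).1 + (infAdj ℓA ℓN j k p).2 = _
    rw [infAdj_fst, infAdj_snd_eq_sub, hbr, add_sub_cancel]
    rfl
  have hτgr : ∀ i p, p ∈ prodGr grA grN i → τ p ∈ grN i := fun i p hp =>
    Submodule.add_mem _ (hgr i _ hp.1) hp.2
  have hext : ∀ p q : A × N, p.1 = q.1 → τ p = τ q → p = q := fun p q h1 h2 => by
    refine Prod.ext h1 ?_
    have h3 : j p.1 + p.2 = j q.1 + q.2 := h2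
    rwa [h1, add_left_cancel_iff] at h3
  refine ⟨isInternal_prodGr hA.isInternal hN.isInternal, ?_, ?_, ?_, ?_⟩
  · ext p
    · simp [infAdj_fst, hA.uncurved]
    · simp [infAdj_snd_eq_sub, hN.uncurved]
  · intro k e v hv
    refine ⟨?_, ?_⟩
    · exact infAdj_fst k v ▸ hA.degree k e _ fun i => (hv i).1
    · exact infAdj_snd_eq_sub (ℓA := ℓA) k v ▸ Submodule.sub_mem _
        (hN.degree k e _ fun i => hτgr _ _ (hv i))
        (hN.degree k e _ fun i => hgr _ _ (hv i).1)
  · intro k σ e v hv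
    refine hext _ _ ?_ ?_
    · rw [infAdj_fst, Prod.smul_fst, infAdj_fst]
      exact hA.antisymm k σ e _ fun i => (hv i).1
    · rw [map_smul, hτ, hτ]
      exact hN.antisymm k σ e _ fun i => hτgr _ _ (hv i)
  · intro n e v hv
    refine hext _ _ ?_ ?_
    · refine (map_insertion (LinearMap.fst ℝ A N) (LinearMap.fst ℝ A N) infAdj_fst infAdj_fst
        e v).trans ?_
      exact hA.jacobi n e _ fun i => (hv i).1
    · refine (map_insertion τ τ hτ hτ e v).trans ?_
      rw [map_zero]
      exact hN.jacobi n e _ fun i => hτgr _ _ (hv i)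

end InfAdj

end

/-! ### Integration of compactly supported smooth densities -/

section

section Densities

variable {d : ℕ} {M : Type w} [TopologicalSpace M] [ChartedSpace (EuclideanSpace ℝ (Fin d)) M]

lemma IsSmoothDens.add {ρ ρ' : ∀ x : M, Dens d x} {U : Opens M} (h : IsSmoothDens ρ U)
    (h' : IsSmoothDens ρ' U) : IsSmoothDens (ρ + ρ') U := fun x => (h x).add (h' x)

lemma IsSmoothDens.smul {ρ : ∀ x : M, Dens d x} {U : Opens M} (c : ℝ) (h : IsSmoothDens ρ U) :
    IsSmoothDens (c • ρ) U := fun x => contDiffOn_const.mul (h x)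

lemma IsSmoothDens.zero (U : Opens M) : IsSmoothDens (0 : ∀ x : M, Dens d x) U :=
  fun _ => contDiffOn_const (c := (0 : ℝ))

lemma IsSmoothDens.sum {ι : Type*} {s : Finset ι} {ρ : ι → ∀ x : M, Dens d x} {U : Opens M}
    (h : ∀ i ∈ s, IsSmoothDens (ρ i) U) : IsSmoothDens (∑ i ∈ s, ρ i) U := by
  classical
  induction s using Finset.induction_on with
  | empty => simpa using IsSmoothDens.zero U
  | insert i s hi ih =>
    rw [Finset.sum_insert hi]
    exact (h i (Finset.mem_insert_self i s)).add
      (ih fun j hj => h j (Finset.mem_insert_of_mem hj))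

variable (d M) in
/-- Smooth densities with compact support. -/
def CompactDens : Submodule ℝ (∀ x : M, Dens d x) where
  carrier := {ρ | IsSmoothDens ρ ⊤ ∧ ∃ K : Set M, IsCompact K ∧ ∀ x ∉ K, ρ x = 0}
  zero_mem' := ⟨IsSmoothDens.zero ⊤, ∅, isCompact_empty, fun _ _ => rfl⟩
  add_mem' := by
    rintro ρ ρ' ⟨h, K, hK, h0⟩ ⟨h', L, hL, h0'⟩
    refine ⟨h.add h', K ∪ L, hK.union hL, fun x hx => ?_⟩
    have h1 := h0 x fun hh => hx (Or.inl hh)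
    have h2 := h0' x fun hh => hx (Or.inr hh)
    simp [h1, h2]
  smul_mem' := by
    rintro c ρ ⟨h, K, hK, h0⟩
    exact ⟨h.smul c, K, hK, fun x hx => by simp [h0 x hx]⟩

/-- The integrand is continuous on the chart target and vanishes off the image of supp ρ ∩ supp f.
That image is contained in a compact subset of the target. -/
lemma integrableOn_densCoord {f : M → ℝ} (hf : ContMDiff (𝓡 d) 𝓘(ℝ, ℝ) ∞ f) {x₀ : M}
    (hs : tsupport f ⊆ (chartAt (EuclideanSpace ℝ (Fin d)) x₀).source)
    {ρ : ∀ x : M, Dens d x} (hρ : ρ ∈ CompactDens d M) :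
    MeasureTheory.IntegrableOn
      (fun y => f ((extChartAt (𝓡 d) x₀).symm y) * densCoord ρ x₀ y)
      (extChartAt (𝓡 d) x₀).target := by
  obtain ⟨h, K, hK, h0⟩ := hρ
  have hL : IsCompact (K ∩ tsupport f) := hK.inter_right (isClosed_tsupport f)
  have hsub : K ∩ tsupport f ⊆ (extChartAt (𝓡 d) x₀).source := by
    rw [extChartAt_source]
    exact Set.inter_subset_right.trans hs
  have hQ : IsCompact (extChartAt (𝓡 d) x₀ '' (K ∩ tsupport f)) :=
    hL.image_of_continuousOn ((continuousOn_extChartAt x₀).mono hsub)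
  have hQt : extChartAt (𝓡 d) x₀ '' (K ∩ tsupport f) ⊆ (extChartAt (𝓡 d) x₀).target := by
    rintro _ ⟨x, hx, rfl⟩
    exact (extChartAt (𝓡 d) x₀).map_source (hsub hx)
  have hc : ContinuousOn (fun y => f ((extChartAt (𝓡 d) x₀).symm y) * densCoord ρ x₀ y)
      (extChartAt (𝓡 d) x₀).target := by
    refine ContinuousOn.mul ?_ ?_
    · exact hf.continuous.comp_continuousOn (continuousOn_extChartAt_symm x₀)
    · refine (h x₀).continuousOn.mono fun y hy => ⟨hy, trivial⟩
  refine MeasureTheory.IntegrableOn.of_forall_sdiff_eq_zero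
    ((hc.mono hQt).integrableOn_compact hQ) (isOpen_extChartAt_target x₀).measurableSet ?_
  rintro y ⟨hy, hyQ⟩
  by_cases h1 : (extChartAt (𝓡 d) x₀).symm y ∈ K
  · by_cases h2 : (extChartAt (𝓡 d) x₀).symm y ∈ tsupport f
    · exact absurd ⟨_, ⟨h1, h2⟩, (extChartAt (𝓡 d) x₀).right_inv hy⟩ hyQ
    · rw [image_eq_zero_of_notMem_tsupport h2, zero_mul]
  · rw [densCoord, h0 _ h1]
    exact mul_zero _

lemma finite_support_densIntegral {f : SmoothPartitionOfUnity M (𝓡 d) M Set.univ}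
    {ρ : ∀ x : M, Dens d x} (hρ : ρ ∈ CompactDens d M) :
    (Function.support fun x₀ : M => ∫ y in (extChartAt (𝓡 d) x₀).target,
      f x₀ ((extChartAt (𝓡 d) x₀).symm y) * densCoord ρ x₀ y).Finite := by
  obtain ⟨-, K, hK, h0⟩ := hρ
  refine (f.locallyFinite.finite_nonempty_inter_compact hK).subset fun x₀ hx => ?_
  by_contra hne
  refine hx ?_
  have : ∀ y, f x₀ ((extChartAt (𝓡 d) x₀).symm y) * densCoord ρ x₀ y = 0 := fun y => by
    by_cases h1 : (extChartAt (𝓡 d) x₀).symm y ∈ K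
    · by_cases h2 : f x₀ ((extChartAt (𝓡 d) x₀).symm y) = 0
      · rw [h2, zero_mul]
      · exact absurd ⟨_, h2, h1⟩ hne
    · rw [densCoord, h0 _ h1]
      exact mul_zero _
  simp only [this, MeasureTheory.integral_zero]

variable [IsManifold (𝓡 d) ∞ M] [T2Space M] [SigmaCompactSpace M]

lemma densIntegral_smul (c : ℝ) (ρ : ∀ x : M, Dens d x) :
    densIntegral (c • ρ) = c * densIntegral ρ := by
  unfold densIntegral
  rw [← smul_eq_mul, smul_finsum]
  refine finsum_congr fun x => ?_
  rw [← MeasureTheory.integral_smul]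
  congr 1
  ext y
  change _ * (c * densCoord ρ x y) = c * (_ * densCoord ρ x y)
  ring

/-- Unlike homogeneity, additivity fails for the default values of divergent integrals and infinite
sums. Compact support supplies integrability in each chart and finitely many nonzero chart
contributions. -/
lemma densIntegral_add {ρ ρ' : ∀ x : M, Dens d x} (hρ : ρ ∈ CompactDens d M)
    (hρ' : ρ' ∈ CompactDens d M) :
    densIntegral (ρ + ρ') = densIntegral ρ + densIntegral ρ' := by
  unfold densIntegral
  rw [← finsum_add_distrib (finite_support_densIntegral hρ) (finite_support_densIntegral hρ')]
  refine finsum_congr fun x => ?_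
  have hs := (SmoothPartitionOfUnity.exists_isSubordinate_chartAt_source (𝓡 d) M).choose_spec x
  rw [← MeasureTheory.integral_add
    (integrableOn_densCoord (ContMDiffMap.contMDiff _) hs hρ)
    (integrableOn_densCoord (ContMDiffMap.contMDiff _) hs hρ')]
  congr 1
  ext y
  rw [← mul_add]
  rfl

variable (d M) in
/-- Integration of smooth densities with compact support. -/
def densIntegralₗ : CompactDens d M →ₗ[ℝ] ℝ where
  toFun ρ := densIntegral ρ.1
  map_add' ρ ρ' := densIntegral_add ρ.2 ρ'.2
  map_smul' c ρ := densIntegral_smul c ρ.1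

end Densities

end

/-! ### Locality of brackets and Lagrangian densities -/

section

variable {d : ℕ} {M : Type w} [TopologicalSpace M] [ChartedSpace (EuclideanSpace ℝ (Fin d)) M]
  [IsManifold (𝓡 d) ∞ M] [T2Space M] [SigmaCompactSpace M]

section Support

/-- Brackets commute with restriction to W, so on W they see only the restricted sections. -/
lemma LocalLInfty.br_congr (𝓛 : LocalLInfty.{u, v} d M) {W : Opens M} {k : ℕ}
    {s t : Fin k → 𝓛.Sec ⊤} (h : ∀ i, ∀ x ∈ W, (s i).1 x = (t i).1 x) :
    ∀ x ∈ W, (𝓛.br ⊤ k s).1 x = (𝓛.br ⊤ k t).1 x := by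
  intro x hx
  have hst : (fun i => 𝓛.res (le_top : W ≤ ⊤) (s i)) = fun i => 𝓛.res (le_top : W ≤ ⊤) (t i) := by
    funext i
    refine Subtype.ext (funext fun y => ?_)
    by_cases hy : y ∈ W
    · simp [VecBundle.res, hy, h i y hy]
    · simp [VecBundle.res, hy]
  have h1 := 𝓛.isLocal.res ⊤ W le_top k s
  have h2 := 𝓛.isLocal.res ⊤ W le_top k t
  rw [hst, h2] at h1
  have h3 := congrFun (congrArg Subtype.val h1) x
  simpa [VecBundle.res, hx] using h3.symm

lemma LocalLInfty.br_eq_zero (𝓛 : LocalLInfty.{u, v} d M) {W : Opens M} {k : ℕ}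
    {s : Fin k → 𝓛.Sec ⊤} (i : Fin k) (h : ∀ x ∈ W, (s i).1 x = 0) :
    ∀ x ∈ W, (𝓛.br ⊤ k s).1 x = 0 := by
  intro x hx
  rw [𝓛.br_congr (W := W) (t := Function.update s i 0) _ x hx, MultilinearMap.map_update_zero]
  · rfl
  · intro j y hy
    by_cases hj : j = i
    · subst hj; simp [h y hy]
    · simp [hj]

end Support

namespace CyclicLocalLInfty

variable (𝓜 : CyclicLocalLInfty.{u, v} d M)

/-- The pairing of sections with values in densities. -/
def pairDens : 𝓜.Sec ⊤ →ₗ[ℝ] 𝓜.Sec ⊤ →ₗ[ℝ] (∀ x : M, Dens d x) :=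
  LinearMap.mk₂ ℝ (fun s t x => 𝓜.pair x (s.1 x) (t.1 x))
    (fun s s' t => by ext x : 1; simp) (fun c s t => by ext x : 1; simp)
    (fun s t t' => by ext x : 1; simp) (fun c s t => by ext x : 1; simp)

lemma pairDens_apply (s t : 𝓜.Sec ⊤) (x : M) : 𝓜.pairDens s t x = 𝓜.pair x (s.1 x) (t.1 x) := rfl

/-- The densities `⟨ℓ_k(v_1, …, v_k), v_{k+1}⟩`. -/
abbrev cyclicDens (n : ℕ) : MultilinearMap ℝ (fun _ : Fin n => 𝓜.Sec ⊤) (∀ x : M, Dens d x) :=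
  cyclicForm 𝓜.pairDens (𝓜.br ⊤) n

/-- The Lagrangian density of the Hamiltonian of the infinity adjoint action. -/
abbrev hamDens (n : ℕ) :
    MultilinearMap ℝ (fun _ : Fin n => 𝓜.Sec ⊤ × 𝓜.Sec ⊤) (∀ x : M, Dens d x) :=
  hamForm 𝓜.pairDens (𝓜.br ⊤) n

variable {𝓜}

lemma cyclicDens_smooth {n : ℕ} (v : Fin n → 𝓜.Sec ⊤) : IsSmoothDens (𝓜.cyclicDens n v) ⊤ := by
  cases n with
  | zero => exact IsSmoothDens.zero ⊤
  | succ n => exact 𝓜.pair_smooth ⊤ _ _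

lemma hamDens_smooth {n : ℕ} (p : Fin n → 𝓜.Sec ⊤ × 𝓜.Sec ⊤) :
    IsSmoothDens (𝓜.hamDens n p) ⊤ := by
  rw [hamDens, hamForm_apply]
  exact IsSmoothDens.sum fun S _ => cyclicDens_smooth _

lemma cyclicDens_congr {W : Opens M} {n : ℕ} {v v' : Fin n → 𝓜.Sec ⊤}
    (h : ∀ i, ∀ x ∈ W, (v i).1 x = (v' i).1 x) :
    ∀ x ∈ W, 𝓜.cyclicDens n v x = 𝓜.cyclicDens n v' x := by
  cases n with
  | zero => exact fun _ _ => rfl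
  | succ n =>
    intro x hx
    rw [cyclicDens, cyclicForm_succ, cyclicForm_succ, pairDens_apply, pairDens_apply,
      h _ x hx, 𝓜.br_congr (fun i => h i.castSucc) x hx]

lemma cyclicDens_eq_zero {W : Opens M} {n : ℕ} {v : Fin n → 𝓜.Sec ⊤} (i : Fin n)
    (h : ∀ x ∈ W, (v i).1 x = 0) : ∀ x ∈ W, 𝓜.cyclicDens n v x = 0 := by
  intro x hx
  rw [cyclicDens_congr (W := W) (v' := Function.update v i 0) _ x hx,
    MultilinearMap.map_update_zero]
  · rfl
  · intro j y hy
    by_cases hj : j = i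
    · subst hj; simp [h y hy]
    · simp [hj]

lemma pick_congr {W : Opens M} {n : ℕ} {p p' : Fin n → 𝓜.Sec ⊤ × 𝓜.Sec ⊤}
    (h1 : ∀ i, ∀ x ∈ W, (p i).1.1 x = (p' i).1.1 x)
    (h2 : ∀ i, ∀ x ∈ W, (p i).2.1 x = (p' i).2.1 x) (S : Finset (Fin n)) (i : Fin n) :
    ∀ x ∈ W, (pick S i (p i)).1 x = (pick S i (p' i)).1 x := by
  intro x hx
  rw [pick_apply, pick_apply]
  split_ifs
  exacts [h1 i x hx, h2 i x hx]

lemma hamDens_congr {W : Opens M} {n : ℕ} {p p' : Fin n → 𝓜.Sec ⊤ × 𝓜.Sec ⊤}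
    (h1 : ∀ i, ∀ x ∈ W, (p i).1.1 x = (p' i).1.1 x)
    (h2 : ∀ i, ∀ x ∈ W, (p i).2.1 x = (p' i).2.1 x) :
    ∀ x ∈ W, 𝓜.hamDens n p x = 𝓜.hamDens n p' x := by
  intro x hx
  rw [hamDens, hamForm_apply, hamForm_apply, Finset.sum_apply, Finset.sum_apply]
  exact Finset.sum_congr rfl fun S _ => cyclicDens_congr (pick_congr h1 h2 S) x hx

lemma mixedBracket_congr {W : Opens M} {n : ℕ} {p p' : Fin n → 𝓜.Sec ⊤ × 𝓜.Sec ⊤}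
    (h1 : ∀ i, ∀ x ∈ W, (p i).1.1 x = (p' i).1.1 x)
    (h2 : ∀ i, ∀ x ∈ W, (p i).2.1 x = (p' i).2.1 x) :
    ∀ x ∈ W, (mixedBracket (𝓜.br ⊤) n p).1 x = (mixedBracket (𝓜.br ⊤) n p').1 x := by
  intro x hx
  rw [mixedBracket_apply, mixedBracket_apply, AddSubmonoidClass.coe_finsetSum,
    AddSubmonoidClass.coe_finsetSum, Finset.sum_apply, Finset.sum_apply]
  exact Finset.sum_congr rfl fun S _ => 𝓜.br_congr (pick_congr h1 h2 S) x hx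

lemma exists_notMem_of_card {n : ℕ} {S : Finset (Fin n)} (h : S.card + 2 ≤ n) : ∃ i, i ∉ S := by
  by_contra! hh
  have : S = Finset.univ := Finset.eq_univ_iff_forall.2 hh
  rw [this, Finset.card_univ, Fintype.card_fin] at h
  omega

/-- Every subset S in the Hamiltonian misses some index, so every term has a field argument. This
makes the density compactly supported whatever the background fields are. -/
lemma hamDens_eq_zero {W : Opens M} {n : ℕ} {p : Fin n → 𝓜.Sec ⊤ × 𝓜.Sec ⊤}
    (h : ∀ i, ∀ x ∈ W, (p i).2.1 x = 0) : ∀ x ∈ W, 𝓜.hamDens n p x = 0 := by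
  intro x hx
  rw [hamDens, hamForm_apply, Finset.sum_apply]
  refine Finset.sum_eq_zero fun S hS => ?_
  obtain ⟨i, hi⟩ := exists_notMem_of_card (Finset.mem_filter.1 hS).2.2
  refine cyclicDens_eq_zero i (fun y hy => ?_) x hx
  rw [pick_apply, if_neg hi, h i y hy]

lemma mixedBracket_eq_zero {W : Opens M} {n : ℕ} {p : Fin n → 𝓜.Sec ⊤ × 𝓜.Sec ⊤}
    (h : ∀ i, ∀ x ∈ W, (p i).2.1 x = 0) : ∀ x ∈ W, (mixedBracket (𝓜.br ⊤) n p).1 x = 0 := by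
  intro x hx
  rw [mixedBracket_apply, AddSubmonoidClass.coe_finsetSum, Finset.sum_apply]
  refine Finset.sum_eq_zero fun S hS => ?_
  obtain ⟨i, hi⟩ : ∃ i, i ∉ S := by
    by_contra! hh
    exact (Finset.mem_filter.1 hS).2.2 (Finset.eq_univ_iff_forall.2 hh)
  refine 𝓜.br_eq_zero i (fun y hy => ?_) x hx
  rw [pick_apply, if_neg hi, h i y hy]

lemma exists_compact_support {n : ℕ} (m : Fin n → 𝓜.SecC) :
    ∃ K : Set M, IsCompact K ∧ ∀ i, ∀ x ∉ K, (m i).1.1 x = 0 := by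
  choose K hK h using fun i => (m i).2
  exact ⟨⋃ i, K i, isCompact_iUnion hK, fun i x hx => h i x fun hh =>
    hx (Set.mem_iUnion.2 ⟨i, hh⟩)⟩

/-- The complement of a compact set as an open set. -/
abbrev complOpens {K : Set M} (hK : IsCompact K) : Opens M := ⟨Kᶜ, hK.isClosed.isOpen_compl⟩

lemma cyclicDens_mem {n : ℕ} {v : Fin n → 𝓜.Sec ⊤} (i : Fin n) (hi : v i ∈ 𝓜.SecC) :
    𝓜.cyclicDens n v ∈ CompactDens d M := by
  obtain ⟨K, hK, h⟩ := hi
  exact ⟨cyclicDens_smooth v, K, hK, fun x hx =>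
    cyclicDens_eq_zero (W := complOpens hK) i (fun y hy => h y hy) x hx⟩

lemma hamDens_mem {n : ℕ} (p : Fin n → 𝓜.Sec ⊤ × 𝓜.SecC) :
    𝓜.hamDens n (fun i => ((p i).1, (p i).2.1)) ∈ CompactDens d M := by
  obtain ⟨K, hK, h⟩ := exists_compact_support fun i => (p i).2
  exact ⟨hamDens_smooth _, K, hK, fun x hx =>
    hamDens_eq_zero (W := complOpens hK) (fun i y hy => h i y hy) x hx⟩

lemma mixedBracket_mem {n : ℕ} (p : Fin n → 𝓜.Sec ⊤ × 𝓜.SecC) :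
    mixedBracket (𝓜.br ⊤) n (fun i => ((p i).1, (p i).2.1)) ∈ 𝓜.SecC := by
  obtain ⟨K, hK, h⟩ := exists_compact_support fun i => (p i).2
  exact ⟨K, hK, fun x hx =>
    mixedBracket_eq_zero (W := complOpens hK) (fun i y hy => h i y hy) x hx⟩

end CyclicLocalLInfty

end

/-! ### The cyclic algebra of compactly supported sections, and its Hamiltonian -/

section

variable {d : ℕ} {M : Type w} [TopologicalSpace M] [ChartedSpace (EuclideanSpace ℝ (Fin d)) M]
  [IsManifold (𝓡 d) ∞ M] [T2Space M] [SigmaCompactSpace M]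

lemma LocalLInfty.brC_degree (𝓛 : LocalLInfty.{u, v} d M) (k : ℕ) (e : Fin k → ℤ)
    (v : Fin k → 𝓛.SecC) (hv : ∀ i, v i ∈ 𝓛.secCGr (e i)) :
    𝓛.brC k v ∈ 𝓛.secCGr (∑ i, e i + 2 - k) :=
  (𝓛.isLocal.isLInfty ⊤).degree k e (fun i => (v i).1) hv

lemma LocalLInfty.brC_jacobi (𝓛 : LocalLInfty.{u, v} d M) (n : ℕ) (e : Fin n → ℤ)
    (v : Fin n → 𝓛.SecC) (hv : ∀ i, v i ∈ 𝓛.secCGr (e i)) :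
    insertion (fun k => 𝓛.brC k) (fun k => 𝓛.brC k) n e v = 0 := by
  refine Subtype.val_injective ?_
  refine (map_insertion 𝓛.SecC.subtype 𝓛.SecC.subtype (f := fun k => 𝓛.brC k)
    (g := fun k => 𝓛.brC k) (f' := fun k => 𝓛.br ⊤ k) (g' := fun k => 𝓛.br ⊤ k) (fun _ _ => rfl) (fun _ _ => rfl) e v).trans ?_
  exact (𝓛.isLocal.isLInfty ⊤).jacobi n e (fun i => (v i).1) hv

lemma LocalLInfty.brC_zero (𝓛 : LocalLInfty.{u, v} d M) : 𝓛.brC 0 = 0 := by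
  ext v : 1
  refine Subtype.val_injective ?_
  change 𝓛.br ⊤ 0 _ = 0
  rw [(𝓛.isLocal.isLInfty ⊤).uncurved]
  rfl

namespace CyclicLocalLInfty

variable {𝓜 : CyclicLocalLInfty.{u, v} d M}

/-- If i + j = 3 then one of i, j is even, so the Koszul sign is trivial; all other components pair
to zero. -/
lemma pair_comm (x : M) (a b : 𝓜.V x) : 𝓜.pair x a b = 𝓜.pair x b a := by
  have ha := 𝓜.sum_pr x a
  have hb := 𝓜.sum_pr x b
  rw [← ha, ← hb]
  simp only [map_sum, LinearMap.sum_apply]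
  rw [Finset.sum_comm]
  refine Finset.sum_congr rfl fun i _ => Finset.sum_congr rfl fun j _ => ?_
  by_cases h : j + i = 3
  · rw [𝓜.pair_symm x j i _ _ (𝓜.pr_pr j x _) (𝓜.pr_pr i x _), Int.negOnePow_even]
    · simp
    · obtain rfl : i = 3 - j := by omega
      rw [Int.even_mul, Int.even_sub]
      by_cases hj : Even j
      · exact Or.inl hj
      · exact Or.inr (iff_of_false (by decide) hj)
  · rw [𝓜.pair_degree x j i _ _ (𝓜.pr_pr j x _) (𝓜.pr_pr i x _) h,
      𝓜.pair_degree x i j _ _ (𝓜.pr_pr i x _) (𝓜.pr_pr j x _) (by omega)]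

lemma pairDens_mem_left {s : 𝓜.Sec ⊤} (t : 𝓜.Sec ⊤) (hs : s ∈ 𝓜.SecC) :
    𝓜.pairDens s t ∈ CompactDens d M := by
  obtain ⟨K, hK, h⟩ := hs
  refine ⟨𝓜.pair_smooth ⊤ s t, K, hK, fun x hx => ?_⟩
  rw [pairDens_apply, h x hx, map_zero, LinearMap.zero_apply]

lemma pairC_eq (s t : 𝓜.SecC) : 𝓜.pairC s t = densIntegral (𝓜.pairDens s.1 t.1) := rfl

variable (𝓜) in
/-- The pairing of compactly supported sections as a bilinear form. -/
def pairCₗ : 𝓜.SecC →ₗ[ℝ] 𝓜.SecC →ₗ[ℝ] ℝ :=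
  LinearMap.mk₂ ℝ 𝓜.pairC
    (fun s s' t => by
      simp only [pairC_eq]
      rw [Submodule.coe_add, map_add, LinearMap.add_apply,
        densIntegral_add (pairDens_mem_left _ s.2) (pairDens_mem_left _ s'.2)])
    (fun c s t => by
      simp only [pairC_eq]
      rw [Submodule.coe_smul, map_smul, LinearMap.smul_apply, densIntegral_smul, smul_eq_mul])
    (fun s t t' => by
      simp only [pairC_eq]
      rw [Submodule.coe_add, map_add,
        densIntegral_add (pairDens_mem_left _ s.2) (pairDens_mem_left _ s.2)])
    (fun c s t => by
      simp only [pairC_eq]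
      rw [Submodule.coe_smul, map_smul, densIntegral_smul, smul_eq_mul])

lemma cyclicForm_pairCₗ (n : ℕ) (v : Fin n → 𝓜.SecC) :
    cyclicForm 𝓜.pairCₗ 𝓜.brC n v = densIntegral (𝓜.cyclicDens n fun i => (v i).1) := by
  cases n with
  | zero => exact (map_zero (densIntegralₗ d M)).symm
  | succ n => rfl

lemma actionTaylor_eq (n : ℕ) (v : Fin n → 𝓜.SecC) :
    actionTaylor 𝓜.pairC 𝓜.brC n v = cyclicForm 𝓜.pairCₗ 𝓜.brC n v := by
  cases n <;> rfl

variable (𝓜) in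
lemma isCyclic : IsCyclic 𝓜.secCGr 𝓜.brC 𝓜.pairCₗ where
  uncurved := 𝓜.brC_zero
  degree := 𝓜.brC_degree
  jacobi := 𝓜.brC_jacobi
  symm s t := congrArg densIntegral (funext fun x => pair_comm x _ _)
  pair_degree i j s t hs ht hij := by
    have : (fun x => 𝓜.pair x (s.1.1 x) (t.1.1 x)) = 0 :=
      funext fun x => 𝓜.pair_degree x i j _ _ (hs x) (ht x) hij
    change densIntegral _ = 0
    rw [this]
    exact map_zero (densIntegralₗ d M)
  invariant n σ e p hp := by
    cases n with
    | zero => simp [cyclicForm]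
    | succ n => exact 𝓜.invariant n e p σ hp

section Hamiltonian

variable {A : Type*} [AddCommGroup A] [Module ℝ A] (j : A →ₗ[ℝ] 𝓜.Sec ⊤)

/-- The Hamiltonian of the infinity adjoint action along `j`. -/
def hamFun : Functional A 𝓜.SecC := fun n =>
  (densIntegralₗ d M).compMultilinearMap
    (((𝓜.hamDens n).compLinearMap fun _ => j.prodMap 𝓜.SecC.subtype).codRestrict (CompactDens d M)
      fun p => hamDens_mem fun i => (j (p i).1, (p i).2))

/-- The Hamiltonian vector field of the infinity adjoint action along `j`. -/
def hamField (k : ℕ) (p : Fin k → A × 𝓜.SecC) : 𝓜.SecC :=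
  ⟨mixedBracket (𝓜.br ⊤) k fun i => (j (p i).1, (p i).2.1),
    mixedBracket_mem fun i => (j (p i).1, (p i).2)⟩

lemma hamFun_apply (n : ℕ) (p : Fin n → A × 𝓜.SecC) :
    hamFun j n p = densIntegral (𝓜.hamDens n fun i => (j (p i).1, (p i).2.1)) := rfl

lemma hamFun_subtype (n : ℕ) (p : Fin n → 𝓜.SecC × 𝓜.SecC) :
    hamFun 𝓜.SecC.subtype n p = hamForm 𝓜.pairCₗ 𝓜.brC n p := by
  have hmem : ∀ S : Finset (Fin n), S.card + 2 ≤ n →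
      𝓜.cyclicDens n (fun i => (pick S i (p i)).1) ∈ CompactDens d M := fun S hS => by
    obtain ⟨i, hi⟩ := exists_notMem_of_card hS
    exact cyclicDens_mem i (pick S i (p i)).2
  -- Membership in `CompactDens` is carried through the induction because the integral is additive
  -- only there.
  have key : ∀ s : Finset (Finset (Fin n)), (∀ S ∈ s, S.card + 2 ≤ n) →
      (∑ S ∈ s, 𝓜.cyclicDens n (fun i => (pick S i (p i)).1)) ∈ CompactDens d M ∧
      densIntegral (∑ S ∈ s, 𝓜.cyclicDens n fun i => (pick S i (p i)).1) =
        ∑ S ∈ s, cyclicForm 𝓜.pairCₗ 𝓜.brC n fun i => pick S i (p i) := by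
    intro s
    induction s using Finset.induction_on with
    | empty => exact fun _ => ⟨Submodule.zero_mem _, map_zero (densIntegralₗ d M)⟩
    | insert S s hS ih =>
      intro h
      have h1 := hmem S (h S (Finset.mem_insert_self S s))
      obtain ⟨h2, h3⟩ := ih fun S' h' => h S' (Finset.mem_insert_of_mem h')
      rw [Finset.sum_insert hS, Finset.sum_insert hS, densIntegral_add h1 h2, h3,
        cyclicForm_pairCₗ]
      exact ⟨Submodule.add_mem _ h1 h2, rfl⟩
  rw [hamFun_apply, hamDens, hamForm_apply, hamForm_apply,
    ← (key _ fun S hS => (Finset.mem_filter.1 hS).2.2).2]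
  congr 1
  refine Finset.sum_congr rfl fun S _ => congrArg _ (funext fun i => ?_)
  rw [pick_apply, pick_apply]
  split_ifs <;> rfl

lemma hamField_subtype (k : ℕ) (p : Fin k → 𝓜.SecC × 𝓜.SecC) :
    hamField 𝓜.SecC.subtype k p = mixedBracket 𝓜.brC k p := by
  refine Subtype.ext ?_
  change mixedBracket (𝓜.br ⊤) k _ = _
  rw [mixedBracket_eq (𝓜.isLocal.isLInfty ⊤).uncurved, mixedBracket_eq 𝓜.brC_zero]
  rfl

lemma isHamVectorField :
    IsHamVectorField 𝓜.pairC (fun n => hamFun j n) (hamField j) := by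
  intro k p m
  have h : (fun i => (j (Fin.snoc (α := fun _ => A × 𝓜.SecC) p (0, m) i).1,
      (Fin.snoc (α := fun _ => A × 𝓜.SecC) p (0, m) i).2.1)) =
      Fin.snoc (α := fun _ => 𝓜.Sec ⊤ × 𝓜.Sec ⊤) (fun i => (j (p i).1, (p i).2.1)) (0, m.1) := by
    funext i
    induction i using Fin.lastCases <;> simp
  change hamFun j (k + 1) _ = _
  rw [hamFun_apply, h, hamDens, hamForm_snoc, map_zero, zero_add]
  rfl

end Hamiltonian

end CyclicLocalLInfty

end

/-! ### Block permutations, cutoff functions and cut-off tuples -/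

section

section Blocks

variable {r s : ℕ}

/-- The permutation acting by `σ` on the first `r` and by `τ` on the last `s` indices. -/
def blockPerm (σ : Equiv.Perm (Fin r)) (τ : Equiv.Perm (Fin s)) : Equiv.Perm (Fin (r + s)) :=
  finSumFinEquiv.permCongr (Equiv.sumCongr σ τ)

lemma blockPerm_castAdd (σ : Equiv.Perm (Fin r)) (τ : Equiv.Perm (Fin s)) (i : Fin r) :
    blockPerm σ τ (Fin.castAdd s i) = Fin.castAdd s (σ i) := by
  simp [blockPerm, Equiv.permCongr_apply]

lemma blockPerm_natAdd (σ : Equiv.Perm (Fin r)) (τ : Equiv.Perm (Fin s)) (i : Fin s) :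
    blockPerm σ τ (Fin.natAdd r i) = Fin.natAdd r (τ i) := by
  simp [blockPerm, Equiv.permCongr_apply]

lemma append_blockPerm {β : Type*} (σ : Equiv.Perm (Fin r)) (τ : Equiv.Perm (Fin s))
    (a : Fin r → β) (b : Fin s → β) :
    (fun i => Fin.append a b (blockPerm σ τ i)) =
      Fin.append (fun i => a (σ i)) fun i => b (τ i) := by
  funext i
  induction i using Fin.addCases with
  | left i => simp [blockPerm_castAdd]
  | right i => simp [blockPerm_natAdd]

/-- No inversion involves one index from each block, so the product over inversions splits. -/
lemma permSign_blockPerm (σ : Equiv.Perm (Fin r)) (τ : Equiv.Perm (Fin s)) (e : Fin r → ℤ)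
    (e' : Fin s → ℤ) :
    permSign (blockPerm σ τ) (Fin.append e e') = permSign σ e * permSign τ e' := by
  have h1 : ∀ (i : Fin r) (j : Fin s), Fin.castAdd s i < Fin.natAdd r j := fun i j => by
    rw [Fin.lt_def, Fin.val_castAdd, Fin.val_natAdd]; omega
  have h2 : ∀ (i : Fin r) (j : Fin s), ¬ Fin.natAdd r j < Fin.castAdd s i :=
    fun i j => (h1 i j).le.not_gt
  have h3 : ∀ i j : Fin r, Fin.castAdd s i < Fin.castAdd s j ↔ i < j := fun _ _ => Iff.rfl
  have h4 : ∀ i j : Fin s, Fin.natAdd r i < Fin.natAdd r j ↔ i < j := fun i j => by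
    rw [Fin.lt_def, Fin.lt_def, Fin.val_natAdd, Fin.val_natAdd]; omega
  unfold permSign
  simp only [Finset.prod_filter, ← Finset.univ_product_univ, Finset.prod_product,
    Fin.prod_univ_add, blockPerm_castAdd, blockPerm_natAdd, h1, h2, h3, h4, Fin.append_left,
    Fin.append_right, and_false, false_and, if_false, Finset.prod_const_one, mul_one, one_mul]

lemma append_castSucc {β : Type*} (a : Fin r → β) (b : Fin (s + 1) → β) :
    (fun i : Fin (r + s) => Fin.append a b (Fin.castSucc i)) =
      Fin.append a fun i => b i.castSucc := by
  funext i
  induction i using Fin.addCases with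
  | left i =>
    rw [Fin.append_left]
    exact Fin.append_left a b i
  | right i =>
    rw [Fin.append_right]
    exact Fin.append_right a b i.castSucc

lemma append_last {β : Type*} (a : Fin r → β) (b : Fin (s + 1) → β) :
    Fin.append a b (Fin.last (r + s)) = b (Fin.last s) :=
  Fin.append_right a b (Fin.last s)

lemma comp_append {β γ : Type*} (f : β → γ) (a : Fin r → β) (b : Fin s → β) :
    (fun i => f (Fin.append a b i)) = Fin.append (fun i => f (a i)) fun i => f (b i) := by
  funext i
  induction i using Fin.addCases <;> simp

lemma append_mem {β : Type*} {p : ℤ → β → Prop} {e : Fin r → ℤ} {e' : Fin s → ℤ} {a : Fin r → β}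
    {b : Fin s → β} (ha : ∀ i, p (e i) (a i)) (hb : ∀ i, p (e' i) (b i)) (i : Fin (r + s)) :
    p (Fin.append e e' i) (Fin.append a b i) := by
  induction i using Fin.addCases <;> simp [ha, hb]

end Blocks

variable {d : ℕ} {M : Type w} [TopologicalSpace M] [ChartedSpace (EuclideanSpace ℝ (Fin d)) M]
  [IsManifold (𝓡 d) ∞ M] [T2Space M] [SigmaCompactSpace M]

lemma exists_cutoff {K : Set M} (hK : IsCompact K) :
    ∃ (χ : M → ℝ) (W : Opens M), ContMDiff (𝓡 d) 𝓘(ℝ, ℝ) ∞ χ ∧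
      (∃ L : Set M, IsCompact L ∧ ∀ x ∉ L, χ x = 0) ∧ K ⊆ W ∧ ∀ x ∈ W, χ x = 1 := by
  have := Manifold.locallyCompact_of_finiteDimensional (𝓡 d) (M := M)
  obtain ⟨L, hL, hKL⟩ := exists_compact_superset hK
  obtain ⟨L', hL', hLL'⟩ := exists_compact_superset hL
  obtain ⟨f, h0, h1, -⟩ := exists_contMDiffMap_zero_one_of_isClosed (n := ⊤) (𝓡 d)
    (isOpen_interior (s := L')).isClosed_compl hL.isClosed
    (Set.disjoint_left.2 fun x hx hx' => hx (hLL' hx'))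
  exact ⟨f, ⟨interior L, isOpen_interior⟩, f.contMDiff,
    ⟨L', hL', fun x hx => h0 fun h => hx (interior_subset h)⟩, hKL,
    fun x hx => h1 (interior_subset hx)⟩

namespace CyclicLocalLInfty

variable {𝓜 : CyclicLocalLInfty.{u, v} d M}

lemma exists_cut {K : Set M} (hK : IsCompact K) :
    ∃ (W : Opens M) (c : 𝓜.Sec ⊤ → 𝓜.SecC), K ⊆ W ∧ (∀ s, ∀ x ∈ W, (c s).1.1 x = s.1 x) ∧
      ∀ e, ∀ s ∈ 𝓜.secGr ⊤ e, c s ∈ 𝓜.secCGr e := by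
  obtain ⟨χ, W, hχ, ⟨L, hL, h0⟩, hKW, h1⟩ := exists_cutoff (d := d) hK
  refine ⟨W, fun s => ⟨⟨fun x => χ x • s.1 x, hχ.contMDiffOn.smul_section s.2.1,
    fun x hx => absurd trivial hx⟩, L, hL, fun x hx => by simp [h0 x hx]⟩, hKW,
    fun s x hx => by simp [h1 x hx], fun e s hs x => ?_⟩
  change 𝓜.pr e x (χ x • s.1 x) = χ x • s.1 x
  rw [map_smul, hs x]

section Cut

variable {A : Type*} [AddCommGroup A] [Module ℝ A]

/-- The pair of compactly supported sections `c` agrees with the image of `a` along `j` on the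
neighbourhood `W` of the set `K` supporting the second component. -/
structure CutRel (j : A →ₗ[ℝ] 𝓜.Sec ⊤) (K : Set M) (W : Opens M) (a : A × 𝓜.SecC)
    (c : 𝓜.SecC × 𝓜.SecC) : Prop where
  snd : c.2 = a.2
  supp : ∀ x ∉ K, a.2.1.1 x = 0
  eq : ∀ x ∈ W, c.1.1.1 x = (j a.1).1 x

variable {j : A →ₗ[ℝ] 𝓜.Sec ⊤} {K : Set M} {W : Opens M}

lemma exists_cutRel (j : A →ₗ[ℝ] 𝓜.Sec ⊤) {n : ℕ} (p : Fin n → A × 𝓜.SecC) :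
    ∃ (K : Set M) (W : Opens M) (c : 𝓜.Sec ⊤ → 𝓜.SecC), IsCompact K ∧ K ⊆ W ∧
      (∀ i, CutRel j K W (p i) (c (j (p i).1), (p i).2)) ∧
      ∀ e, ∀ s ∈ 𝓜.secGr ⊤ e, c s ∈ 𝓜.secCGr e := by
  obtain ⟨K, hK, h⟩ := exists_compact_support fun i => (p i).2
  obtain ⟨W, c, hKW, h1, h2⟩ := exists_cut (𝓜 := 𝓜) hK
  exact ⟨K, W, c, hK, hKW, fun i => ⟨rfl, h i, h1 _⟩, h2⟩

variable (hK : IsCompact K) (hKW : K ⊆ W) {n : ℕ} {p : Fin n → A × 𝓜.SecC}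
  {p' : Fin n → 𝓜.SecC × 𝓜.SecC} (h : ∀ i, CutRel j K W (p i) (p' i))
include hK hKW h

/-- The densities agree on K ⊆ W because the arguments agree on W, and off K both vanish because all
fields do. -/
lemma hamFun_cut : hamFun j n p = hamForm 𝓜.pairCₗ 𝓜.brC n p' := by
  rw [← hamFun_subtype, hamFun_apply, hamFun_apply]
  congr 1
  funext x
  by_cases hx : x ∈ K
  · refine hamDens_congr (W := W) (fun i y hy => ((h i).eq y hy).symm) (fun i y _ => ?_) x (hKW hx)
    rw [(h i).snd]
  · rw [hamDens_eq_zero (W := complOpens hK) (fun i y hy => (h i).supp y hy) x hx,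
      hamDens_eq_zero (W := complOpens hK) (fun i y hy => ?_) x hx]
    simp only [(h i).snd]
    exact (h i).supp y hy

lemma hamField_cut : hamField j n p = mixedBracket 𝓜.brC n p' := by
  rw [← hamField_subtype]
  refine Subtype.ext (Subtype.ext (funext fun x => ?_))
  by_cases hx : x ∈ K
  · refine mixedBracket_congr (W := W) (fun i y hy => ((h i).eq y hy).symm) (fun i y _ => ?_) x
      (hKW hx)
    rw [(h i).snd]
  · refine (mixedBracket_eq_zero (W := complOpens hK) (fun i y hy => (h i).supp y hy) x hx).trans
      (mixedBracket_eq_zero (W := complOpens hK) (fun i y hy => ?_) x hx).symm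
    simp only [(h i).snd]
    exact (h i).supp y hy

lemma cutRel_zero_hamField : CutRel j K W (0, hamField j n p) (0, mixedBracket 𝓜.brC n p') where
  snd := (hamField_cut hK hKW h).symm
  supp x hx := mixedBracket_eq_zero (W := complOpens hK) (fun i y hy => (h i).supp y hy) x hx
  eq x _ := by simp

omit hKW in
lemma cutRel_zero_br :
    CutRel j K W (0, 𝓜.brC n fun i => (p i).2) (0, 𝓜.brC n fun i => (p' i).2) where
  snd := by simp only [(h _).snd]
  supp x hx := by
    cases n with
    | zero => rw [𝓜.brC_zero]; rfl
    | succ n => exact 𝓜.br_eq_zero (W := complOpens hK) 0 (fun y hy => (h 0).supp y hy) x hx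
  eq x _ := by simp

omit hK hKW in
-- The bracket of cut-off sections is not the cutoff of the bracket. The two agree on the open set
-- W, which is all that `CutRel` requires.
lemma cutRel_br_zero {ℓA : Brackets A}
    (hbr : ∀ k (a : Fin k → A), j (ℓA k a) = 𝓜.br ⊤ k fun i => j (a i)) :
    CutRel j K W (ℓA n fun i => (p i).1, 0) (𝓜.brC n fun i => (p' i).1, 0) where
  snd := rfl
  supp x hx := rfl
  eq x hx := by
    rw [hbr]
    exact 𝓜.br_congr (fun i => (h i).eq) x hx

omit hK hKW h in
lemma CutRel.add {a b : A × 𝓜.SecC} {a' b' : 𝓜.SecC × 𝓜.SecC} (h : CutRel j K W a a')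
    (h' : CutRel j K W b b') : CutRel j K W (a + b) (a' + b') where
  snd := by simp [h.snd, h'.snd]
  supp x hx := by simp [h.supp x hx, h'.supp x hx]
  eq x hx := by simp [h.eq x hx, h'.eq x hx]

end Cut

end CyclicLocalLInfty

end

/-! ### Classical symmetries along a bracket-preserving map into the global sections -/

section

variable {d : ℕ} {M : Type w} [TopologicalSpace M] [ChartedSpace (EuclideanSpace ℝ (Fin d)) M]
  [IsManifold (𝓡 d) ∞ M] [T2Space M] [SigmaCompactSpace M]

namespace CyclicLocalLInfty

variable {𝓜 : CyclicLocalLInfty.{u, v} d M}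

section Symmetry

variable {A : Type*} [AddCommGroup A] [Module ℝ A] {grA : ℤ → Submodule ℝ A} {ℓA : Brackets A}
  {j : A →ₗ[ℝ] 𝓜.Sec ⊤}

lemma cut_mem_prodGr (hgr : ∀ i, ∀ a ∈ grA i, j a ∈ 𝓜.secGr ⊤ i) {c : 𝓜.Sec ⊤ → 𝓜.SecC}
    (hc : ∀ e, ∀ s ∈ 𝓜.secGr ⊤ e, c s ∈ 𝓜.secCGr e) {e : ℤ} {a : A × 𝓜.SecC}
    (ha : a ∈ prodGr grA 𝓜.secCGr e) : (c (j a.1), a.2) ∈ prodGr 𝓜.secCGr 𝓜.secCGr e :=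
  ⟨hc e _ (hgr e _ ha.1), ha.2⟩

lemma isHamCochain_hamFun (hgr : ∀ i, ∀ a ∈ grA i, j a ∈ 𝓜.secGr ⊤ i) :
    IsHamCochain grA 𝓜.secCGr (hamFun j) where
  reduced := by
    ext p
    rw [hamFun_apply, hamDens, hamForm_apply]
    exact map_zero (densIntegralₗ d M)
  degree n e p hp hne := by
    obtain ⟨K, W, c, hK, hKW, h, hc⟩ := exists_cutRel j p
    rw [hamFun_cut hK hKW h]
    exact 𝓜.isCyclic.isHamCochain.degree n e _ (fun i => cut_mem_prodGr hgr hc (hp i)) hne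
  antisymm n σ e p hp := by
    obtain ⟨K, W, c, hK, hKW, h, hc⟩ := exists_cutRel j p
    rw [hamFun_cut hK hKW h, hamFun_cut hK hKW fun i => h (σ i)]
    exact 𝓜.isCyclic.isHamCochain.antisymm n σ e _ fun i => cut_mem_prodGr hgr hc (hp i)
  vanish n m := by
    obtain ⟨K, W, c, hK, hKW, h, hc⟩ := exists_cutRel j fun i => ((0 : A), m i)
    -- The abstract cutoff c is not known to send 0 to 0, so the relation is established afresh with
    -- first component 0.
    have h' : ∀ i, CutRel j K W (0, m i) (0, m i) := fun i =>
      ⟨rfl, (h i).supp, fun x _ => by simp⟩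
    rw [hamFun_cut hK hKW h']
    exact 𝓜.isCyclic.isHamCochain.vanish n m

lemma maurerCartan_hamFun (hgr : ∀ i, ∀ a ∈ grA i, j a ∈ 𝓜.secGr ⊤ i)
    (hbr : ∀ k (a : Fin k → A), j (ℓA k a) = 𝓜.br ⊤ k fun i => j (a i)) :
    MaurerCartan grA 𝓜.secCGr (sumBrackets ℓA 𝓜.brC) (fun n => hamFun j n) (hamField j) := by
  intro n e p hp
  obtain ⟨K, W, c, hK, hKW, h, hc⟩ := exists_cutRel j p
  -- The zero on the right is replaced by the same expression for the cut-off tuple, and the two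
  -- sides are then compared term by term.
  rw [← 𝓜.isCyclic.maurerCartan n e _ fun i => cut_mem_prodGr hgr hc (hp i)]
  congr 1
  · refine insertion_congr fun I => hamFun_cut hK hKW fun i => ?_
    induction i using Fin.cases with
    | zero =>
      have h1 := cutRel_br_zero (fun i => h (I.orderEmbOfFin rfl i)) hbr
      have h2 := cutRel_zero_br (j := j) hK (W := W) fun i => h (I.orderEmbOfFin rfl i)
      simpa [sumBrackets] using h1.add h2
    | succ i => simpa using h _
  · congr 1
    refine insertion_congr fun I => hamFun_cut hK hKW fun i => ?_
    induction i using Fin.cases with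
    | zero => exact cutRel_zero_hamField hK hKW fun i => h (I.orderEmbOfFin rfl i)
    | succ i => simpa using h _

lemma totalFunctional_cut {K : Set M} {W : Opens M} (hK : IsCompact K) (hKW : K ⊆ W) {n : ℕ}
    {p : Fin n → A × 𝓜.SecC} {p' : Fin n → 𝓜.SecC × 𝓜.SecC}
    (h : ∀ i, CutRel j K W (p i) (p' i)) :
    totalFunctional 𝓜.pairC 𝓜.brC (hamFun j) n p =
      hamForm 𝓜.pairCₗ 𝓜.brC n p' + cyclicForm 𝓜.pairCₗ 𝓜.brC n fun i => (p' i).2 := by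
  simp only [totalFunctional, hamFun_cut hK hKW h, actionTaylor_eq, (h _).snd]

lemma maurerCartan_totalFunctional (hgr : ∀ i, ∀ a ∈ grA i, j a ∈ 𝓜.secGr ⊤ i)
    (hbr : ∀ k (a : Fin k → A), j (ℓA k a) = 𝓜.br ⊤ k fun i => j (a i)) :
    MaurerCartan grA 𝓜.secCGr (fun k p => (ℓA k fun i => (p i).1, 0))
      (totalFunctional 𝓜.pairC 𝓜.brC (hamFun j))
      (fun k p => hamField j k p + 𝓜.brC k fun i => (p i).2) := by
  intro n e p hp
  obtain ⟨K, W, c, hK, hKW, h, hc⟩ := exists_cutRel j p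
  rw [← 𝓜.isCyclic.maurerCartan_total n e _ fun i => cut_mem_prodGr hgr hc (hp i)]
  congr 1
  · refine insertion_congr fun I => totalFunctional_cut hK hKW fun i => ?_
    induction i using Fin.cases with
    | zero => exact cutRel_br_zero (fun i => h (I.orderEmbOfFin rfl i)) hbr
    | succ i => simpa using h _
  · congr 1
    refine insertion_congr fun I => totalFunctional_cut hK hKW fun i => ?_
    induction i using Fin.cases with
    | zero =>
      have h1 := cutRel_zero_hamField hK hKW fun i => h (I.orderEmbOfFin rfl i)
      have h2 := cutRel_zero_br (j := j) hK (W := W) fun i => h (I.orderEmbOfFin rfl i)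
      simpa using h1.add h2
    | succ i => simpa using h _

lemma finsum_totalFunctional (hF : IsHamCochain grA 𝓜.secCGr (hamFun j)) (α : 𝓜.SecC) :
    ∑ᶠ n : ℕ, ((n.factorial : ℝ)⁻¹ *
        totalFunctional 𝓜.pairC 𝓜.brC (hamFun j) n fun _ => (0, α)) =
      classicalAction 𝓜.pairC 𝓜.brC α := by
  have h : ∀ n : ℕ, totalFunctional 𝓜.pairC 𝓜.brC (hamFun j) n (fun _ => (0, α)) =
      actionTaylor 𝓜.pairC 𝓜.brC n fun _ => α := fun n => by
    rw [totalFunctional, hF.vanish n fun _ => α, zero_add]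
  simp only [h, classicalAction]
  rw [← finsum_mem_univ, ← finsum_mem_inter_support]
  -- The Taylor component of arity k + 1 comes from ℓ_k and there is none in arity 0, so the sum may
  -- be indexed by successors.
  have hs : Set.univ ∩ (Function.support fun n : ℕ => (n.factorial : ℝ)⁻¹ *
      actionTaylor 𝓜.pairC 𝓜.brC n fun _ => α) = Set.range Nat.succ ∩ (Function.support fun n : ℕ =>
        (n.factorial : ℝ)⁻¹ * actionTaylor 𝓜.pairC 𝓜.brC n fun _ => α) := by
    ext n
    cases n with
    | zero => simp [actionTaylor]
    | succ n => simp
  rw [hs, finsum_mem_inter_support, finsum_mem_range Nat.succ_injective]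
  refine finsum_congr fun k => ?_
  congr 1
  exact 𝓜.isCyclic.symm _ _

/-- The last argument is supported in K, so only the values of the bracket on K matter, and there
the cutoffs change nothing. -/
lemma pairInt_br_append {r s : ℕ} (X : Fin r → 𝓜.Sec ⊤) (m : Fin (s + 1) → 𝓜.SecC) {K : Set M}
    {W : Opens M} {c : 𝓜.Sec ⊤ → 𝓜.SecC} (hKW : K ⊆ W) (hm : ∀ i, ∀ x ∉ K, (m i).1.1 x = 0)
    (hc : ∀ s, ∀ x ∈ W, (c s).1.1 x = s.1 x) :
    pairInt 𝓜.pair (𝓜.br ⊤ (r + s) (Fin.append X fun i : Fin s => (m i.castSucc).1))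
      (m (Fin.last s)).1 =
    cyclicForm 𝓜.pairCₗ 𝓜.brC (r + (s + 1)) (Fin.append (fun i => c (X i)) m) := by
  have h1 : cyclicForm 𝓜.pairCₗ 𝓜.brC (r + (s + 1)) (Fin.append (fun i => c (X i)) m) =
      𝓜.pairC (𝓜.brC (r + s) (Fin.append (fun i => c (X i)) fun i => m i.castSucc))
        (m (Fin.last s)) := by
    rw [← append_castSucc (fun i => c (X i)) m, ← append_last (fun i => c (X i)) m]
    rfl
  rw [h1]
  refine congrArg densIntegral (funext fun x => ?_)
  by_cases hx : x ∈ K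
  · congr 2
    refine 𝓜.br_congr (W := W) (fun i y hy => ?_) x (hKW hx)
    induction i using Fin.addCases with
    | left i => simp [hc _ y hy]
    | right i => simp
  · simp [hm (Fin.last s) x hx]

theorem isClassicalSymmetry (hgr : ∀ i, ∀ a ∈ grA i, j a ∈ 𝓜.secGr ⊤ i)
    (hbr : ∀ k (a : Fin k → A), j (ℓA k a) = 𝓜.br ⊤ k fun i => j (a i))
    {act : ∀ k : ℕ, (Fin k → A × 𝓜.SecC) → 𝓜.Sec ⊤}
    (hact : ∀ k p, act k p = (infAdj ℓA (𝓜.br ⊤) j k fun i => ((p i).1, (p i).2.1)).2)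
    {isLocal : Functional A 𝓜.SecC → Prop} (hloc : isLocal (hamFun j)) :
    𝓜.IsClassicalSymmetry grA ℓA act isLocal where
  compatible r s hs e e' X m hX hm σ τ := by
    obtain ⟨K, hK, h0⟩ := exists_compact_support m
    obtain ⟨W, c, hKW, h1, h2⟩ := exists_cut (𝓜 := 𝓜) hK
    have key : ∀ (X : Fin r → A) (m : Fin s → 𝓜.SecC),
        act (r + s) (Fin.append (fun i => (X i, 0)) fun i => (0, m i)) =
          𝓜.br ⊤ (r + s) (Fin.append (fun i => j (X i)) fun i => (m i).1) := by
      intro X m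
      rw [hact, infAdj_snd_eq_sub]
      have e1 := comp_append (fun p : A × 𝓜.SecC => j p.1 + p.2.1) (fun i => (X i, 0))
        fun i => (0, m i)
      have e2 := comp_append (fun p : A × 𝓜.SecC => j p.1) (fun i => (X i, 0)) fun i => (0, m i)
      simp only [map_zero, zero_add, Submodule.coe_zero, add_zero] at e1 e2
      -- With at least one argument from 𝓜, the subtracted pure background term has a zero entry.
      -- This is where s ≥ 1 enters.
      have e3 : 𝓜.br ⊤ (r + s) (Fin.append (fun i => j (X i)) fun _ => 0) = 0 :=
        MultilinearMap.map_coord_zero _ (Fin.natAdd r ⟨0, hs⟩) (Fin.append_right _ _ _)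
      rw [e1, e2, e3, sub_zero]
    rw [key X, key (fun i => X (σ i)) fun i => m (τ i.castSucc),
      pairInt_br_append (fun i => j (X i)) m hKW h0 h1,
      pairInt_br_append (fun i => j (X (σ i))) (fun i => m (τ i)) hKW (fun i => h0 _) h1,
      -- Separate antisymmetry in the X's and in the m's is antisymmetry of the single cyclic form
      -- under a block permutation.
      ← append_blockPerm σ τ (fun i => c (j (X i))) m, ← permSign_blockPerm]
    exact 𝓜.isCyclic.invariant _ _ _ _
      (append_mem (p := fun e a => a ∈ 𝓜.secCGr e) (fun i => h2 _ _ (hgr _ _ (hX i))) hm)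
  hamiltonian := by
    refine ⟨hamFun j, hamField j, isHamCochain_hamFun hgr, hloc, isHamVectorField j, fun k p => ?_,
      maurerCartan_hamFun hgr hbr, maurerCartan_totalFunctional hgr hbr,
      finsum_totalFunctional (isHamCochain_hamFun hgr)⟩
    rw [hact, infAdj_snd_eq_mixedBracket (𝓜.isLocal.isLInfty ⊤).uncurved]
    rfl

end Symmetry

end CyclicLocalLInfty

end

/-! ### Functoriality and transport of brackets, restriction, and differential order -/

section

section Abstract

variable {A N A' N' : Type*} [AddCommGroup A] [Module ℝ A] [AddCommGroup N] [Module ℝ N]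
  [AddCommGroup A'] [Module ℝ A'] [AddCommGroup N'] [Module ℝ N']
  {ℓA : Brackets A} {ℓN : Brackets N} {j : A →ₗ[ℝ] N}
  {ℓA' : Brackets A'} {ℓN' : Brackets N'} {j' : A' →ₗ[ℝ] N'}

lemma infAdj_map (rA : A →ₗ[ℝ] A') (rN : N →ₗ[ℝ] N')
    (hA : ∀ k (a : Fin k → A), ℓA' k (fun i => rA (a i)) = rA (ℓA k a))
    (hN : ∀ k (a : Fin k → N), ℓN' k (fun i => rN (a i)) = rN (ℓN k a))
    (hj : ∀ a, j' (rA a) = rN (j a)) (k : ℕ) (p : Fin k → A × N) :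
    infAdj ℓA' ℓN' j' k (fun i => (rA (p i).1, rN (p i).2)) =
      (rA (infAdj ℓA ℓN j k p).1, rN (infAdj ℓA ℓN j k p).2) := by
  refine Prod.ext ?_ ?_
  · rw [infAdj_fst, infAdj_fst, hA]
  · rw [infAdj_snd_eq_sub, infAdj_snd_eq_sub, map_sub, ← hN, ← hN]
    simp only [hj, map_add]

lemma infAdj_inr (hA : ℓA 0 = 0) (hN : ℓN 0 = 0) (k : ℕ) (m : Fin k → N) :
    infAdj ℓA ℓN j k (fun i => (0, m i)) = (0, ℓN k m) := by
  refine Prod.ext ?_ ?_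
  · rw [infAdj_fst]
    cases k with
    | zero => rw [hA]; rfl
    | succ k => exact MultilinearMap.map_coord_zero _ 0 rfl
  · rw [infAdj_snd_eq_sub]
    simp only [map_zero, zero_add]
    cases k with
    | zero => rw [hN]; simp
    | succ k =>
      have h : ℓN (k + 1) (fun _ => (0 : N)) = 0 := MultilinearMap.map_coord_zero _ 0 rfl
      rw [h, sub_zero]

lemma IsLInfty.transport {gr : ℤ → Submodule ℝ A} {gr' : ℤ → Submodule ℝ A'} (φ : A' ≃ₗ[ℝ] A)
    (h : IsLInfty gr ℓA) (hgr : ∀ i a, a ∈ gr' i ↔ φ a ∈ gr i)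
    (hbr : ∀ k (a : Fin k → A'), φ (ℓA' k a) = ℓA k fun i => φ (a i)) : IsLInfty gr' ℓA' where
  isInternal := by
    obtain ⟨pr, h1, h2, h3, h4⟩ := exists_projections h.isInternal
    refine isInternal_of_projections _
      (fun i => φ.symm.toLinearMap ∘ₗ pr i ∘ₗ φ.toLinearMap)
      (fun i v => (hgr _ _).2 (by simp [h1])) (fun i v hv => ?_) (fun i i' hii v hv => ?_) fun v => ?_
    · simp [h2 i _ ((hgr _ _).1 hv)]
    · simp [h3 i i' hii _ ((hgr _ _).1 hv)]
    · obtain ⟨D, hD⟩ := h4 (φ v)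
      refine ⟨D, φ.injective ?_⟩
      rw [map_sum]
      simpa using hD D subset_rfl
  uncurved := by
    ext a
    refine φ.injective ?_
    rw [hbr, h.uncurved]
    simp
  degree k e v hv := by
    rw [hgr, hbr]
    exact h.degree k e _ fun i => (hgr _ _).1 (hv i)
  antisymm k σ e v hv := by
    refine φ.injective ?_
    rw [map_smul, hbr, hbr]
    exact h.antisymm k σ e _ fun i => (hgr _ _).1 (hv i)
  jacobi n e v hv := by
    refine φ.injective ?_
    rw [map_zero]
    exact (map_insertion φ.toLinearMap φ.toLinearMap hbr hbr e v).trans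
      (h.jacobi n e _ fun i => (hgr _ _).1 (hv i))

end Abstract

variable {d : ℕ} {M : Type w} [TopologicalSpace M] [ChartedSpace (EuclideanSpace ℝ (Fin d)) M]

section Restriction

variable (E : VecBundle.{u, v} d M)

lemma VecBundle.res_apply_of_mem {U W : Opens M} (h : W ≤ U) (s : E.Sec U) {x : M} (hx : x ∈ W) :
    (E.res h s).1 x = s.1 x := if_pos hx

lemma VecBundle.res_apply_of_notMem {U W : Opens M} (h : W ≤ U) (s : E.Sec U) {x : M}
    (hx : x ∉ W) : (E.res h s).1 x = 0 := if_neg hx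

lemma VecBundle.res_res {U W W' : Opens M} (h : W ≤ U) (h' : W' ≤ W) (s : E.Sec U) :
    E.res h' (E.res h s) = E.res (h'.trans h) s := by
  refine Subtype.ext (funext fun x => ?_)
  by_cases hx : x ∈ W'
  · simp [VecBundle.res, hx, h' hx]
  · simp [VecBundle.res, hx]

lemma VecBundle.res_self {U : Opens M} (h : U ≤ U) (s : E.Sec U) : E.res h s = s := by
  refine Subtype.ext (funext fun x => ?_)
  by_cases hx : x ∈ U
  · simp [VecBundle.res, hx]
  · simp [VecBundle.res, hx, s.2.2 x hx]

lemma GradedBundle.res_mem_secGr (E : GradedBundle.{u, v} d M) {U W : Opens M} (h : W ≤ U) {i : ℤ}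
    {s : E.Sec U} (hs : s ∈ E.secGr U i) : E.res h s ∈ E.secGr W i := by
  intro x
  by_cases hx : x ∈ W
  · simpa [VecBundle.res, hx] using hs x
  · simp [VecBundle.res, hx]

end Restriction

variable [IsManifold (𝓡 d) ∞ M] [T2Space M] [SigmaCompactSpace M]

section Order

variable (𝓜 : CyclicLocalLInfty.{u, v} d M)

lemma CyclicLocalLInfty.exists_order_cyclicDens (n : ℕ) :
    ∃ r, VecBundle.HasOrderLE r fun v => 𝓜.cyclicDens n v := by
  cases n with
  | zero => exact ⟨0, fun x _ φ i => i.elim0⟩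
  | succ k =>
    obtain ⟨r, hr⟩ := 𝓜.isLocal.polyDiff k
    refine ⟨r, fun x hx φ i f s hf h0 hφ => ?_⟩
    change 𝓜.pair x _ _ = 0
    induction i using Fin.lastCases with
    | last =>
      -- The pairing is of order zero in its last argument; one of the r + 1 vanishing factors
      -- already suffices.
      rw [hφ x, Finset.prod_eq_zero (Finset.mem_univ 0) (h0 0), zero_smul, map_zero]
    | cast i =>
      have h : (𝓜.br ⊤ k (Fin.init φ)).1 x = 0 := hr ⊤ x hx (Fin.init φ) i f s hf h0 hφ
      rw [h, map_zero, LinearMap.zero_apply]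

/-- The order is bounded jointly in both components of an argument, which is what sections of the
Whitney sum need; arguments from 𝓜 alone are the case of first component 0. -/
lemma CyclicLocalLInfty.exists_order_hamDens (n : ℕ) :
    ∃ r, ∀ (x : M) (p : Fin n → 𝓜.Sec ⊤ × 𝓜.Sec ⊤) (i : Fin n) (f : Fin (r + 1) → M → ℝ)
      (s : 𝓜.Sec ⊤ × 𝓜.Sec ⊤), (∀ a, ContMDiff (𝓡 d) 𝓘(ℝ, ℝ) ∞ (f a)) → (∀ a, f a x = 0) →
      (∀ y, (p i).1.1 y = (∏ a, f a y) • s.1.1 y) → (∀ y, (p i).2.1 y = (∏ a, f a y) • s.2.1 y) →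
      𝓜.hamDens n p x = 0 := by
  obtain ⟨r, hr⟩ := 𝓜.exists_order_cyclicDens n
  refine ⟨r, fun x p i f s hf h0 h1 h2 => ?_⟩
  rw [CyclicLocalLInfty.hamDens, hamForm_apply, Finset.sum_apply]
  refine Finset.sum_eq_zero fun S _ => hr x trivial _ i f (if i ∈ S then s.1 else s.2) hf h0 ?_
  intro y
  rw [pick_apply]
  split_ifs
  exacts [h1 y, h2 y]

end Order

end

/-! ### Local subalgebras and arbitrary subalgebras -/

section

/-- A subspace stable under the projections of a grading inherits the grading. -/
lemma isInternal_comap_subtype {V : Type*} [AddCommGroup V] [Module ℝ V] (S : Submodule ℝ V)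
    (gr : ℤ → Submodule ℝ V) (pr : ℤ → V →ₗ[ℝ] V) (stable : ∀ i, ∀ v ∈ S, pr i v ∈ S)
    (mem : ∀ i v, pr i v ∈ gr i) (same : ∀ i, ∀ v ∈ gr i, pr i v = v)
    (ne : ∀ i j, i ≠ j → ∀ v ∈ gr j, pr i v = 0)
    (sum : ∀ v, ∃ D : Finset ℤ, ∑ i ∈ D, pr i v = v) :
    DirectSum.IsInternal fun i => (gr i).comap S.subtype := by
  refine isInternal_of_projections _ (fun i => (pr i).restrict (stable i)) (fun i v => mem i v)
    (fun i v hv => Subtype.ext (same i v hv)) (fun i j hij v hv => Subtype.ext (ne i j hij v hv))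
    fun v => ?_
  obtain ⟨D, hD⟩ := sum v
  exact ⟨D, Subtype.ext ((map_sum S.subtype _ _).trans hD)⟩

variable {d : ℕ} {M : Type w} [TopologicalSpace M] [ChartedSpace (EuclideanSpace ℝ (Fin d)) M]
  [IsManifold (𝓡 d) ∞ M] [T2Space M] [SigmaCompactSpace M]

section Local

variable {𝓛 : LocalLInfty.{u', v'} d M} {𝓜 : CyclicLocalLInfty.{u, v} d M}

namespace LocalSubalgebra

variable (j : LocalSubalgebra 𝓛 𝓜)

lemma mapSec_mem_secGr (U : Opens M) {i : ℤ} {s : 𝓛.Sec U} (hs : s ∈ 𝓛.secGr U i) :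
    j.mapSec U s ∈ 𝓜.secGr U i := fun x => by
  change 𝓜.pr i x (j.map x (s.1 x)) = j.map x (s.1 x)
  rw [← j.map_pr, hs x]

lemma mapSec_br (U : Opens M) (k : ℕ) (s : Fin k → 𝓛.Sec U) :
    j.mapSec U (𝓛.br U k s) = 𝓜.br U k fun i => j.mapSec U (s i) :=
  Subtype.ext (funext fun x => j.map_br U k s x)

lemma mapSec_res {U W : Opens M} (h : W ≤ U) (s : 𝓛.Sec U) :
    j.mapSec W (𝓛.res h s) = 𝓜.res h (j.mapSec U s) := by
  refine Subtype.ext (funext fun x => ?_)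
  by_cases hx : x ∈ W
  · simp [mapSec, VecBundle.res, hx]
  · simp [mapSec, VecBundle.res, hx]

lemma secSum_infinityAdjoint (U : Opens M) (k : ℕ)
    (p : Fin k → (𝓛.toGradedBundle.prod 𝓜.toGradedBundle).Sec U) :
    secSum 𝓛 𝓜 U (j.infinityAdjoint U k p) =
      infAdj (𝓛.br U) (𝓜.br U) (j.mapSec U) k fun i => secSum 𝓛 𝓜 U (p i) :=
  (secSum 𝓛 𝓜 U).apply_symm_apply _

lemma secSum_res {U W : Opens M} (h : W ≤ U)
    (s : (𝓛.toGradedBundle.prod 𝓜.toGradedBundle).Sec U) :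
    secSum 𝓛 𝓜 W ((𝓛.toGradedBundle.prod 𝓜.toGradedBundle).res h s) =
      (𝓛.res h (secSum 𝓛 𝓜 U s).1, 𝓜.res h (secSum 𝓛 𝓜 U s).2) := by
  have h0 : ∀ x, ((secSum 𝓛 𝓜 W ((𝓛.toGradedBundle.prod 𝓜.toGradedBundle).res h s)).1.1 x,
      (secSum 𝓛 𝓜 W ((𝓛.toGradedBundle.prod 𝓜.toGradedBundle).res h s)).2.1 x) =
      ((𝓛.res h (secSum 𝓛 𝓜 U s).1).1 x, (𝓜.res h (secSum 𝓛 𝓜 U s).2).1 x) := by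
    intro x
    by_cases hx : x ∈ W
    · rw [VecBundle.res_apply_of_mem _ h _ hx, VecBundle.res_apply_of_mem _ h _ hx]
      exact VecBundle.res_apply_of_mem _ h s hx
    · rw [VecBundle.res_apply_of_notMem _ h _ hx, VecBundle.res_apply_of_notMem _ h _ hx]
      exact VecBundle.res_apply_of_notMem _ h s hx
  exact Prod.ext (Subtype.ext (funext fun x => congrArg Prod.fst (h0 x)))
    (Subtype.ext (funext fun x => congrArg Prod.snd (h0 x)))

lemma mem_secGr_prod {U : Opens M} {i : ℤ}
    {s : (𝓛.toGradedBundle.prod 𝓜.toGradedBundle).Sec U} :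
    s ∈ (𝓛.toGradedBundle.prod 𝓜.toGradedBundle).secGr U i ↔
      secSum 𝓛 𝓜 U s ∈ prodGr (𝓛.secGr U) (𝓜.secGr U) i :=
  ⟨fun h => ⟨fun x => congrArg Prod.fst (h x), fun x => congrArg Prod.snd (h x)⟩,
    fun h x => Prod.ext (h.1 x) (h.2 x)⟩

lemma hasOrderLE_infinityAdjoint {k r : ℕ} {U : Opens M}
    (hr : VecBundle.HasOrderLE r fun s : Fin k → 𝓜.Sec U => (𝓜.br U k s).1) :
    VecBundle.HasOrderLE r fun p => (j.infinityAdjoint U k p).1 := by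
  intro x hx φ i f s hf h0 hφ
  have h1 : ∀ y, (secSum 𝓛 𝓜 U (φ i)).1.1 y = (∏ a, f a y) • (secSum 𝓛 𝓜 U s).1.1 y :=
    fun y => congrArg Prod.fst (hφ y)
  have h2 : ∀ y, (secSum 𝓛 𝓜 U (φ i)).2.1 y = (∏ a, f a y) • (secSum 𝓛 𝓜 U s).2.1 y :=
    fun y => congrArg Prod.snd (hφ y)
  have h3 : ∀ y, (j.mapSec U (secSum 𝓛 𝓜 U (φ i)).1).1 y =
      (∏ a, f a y) • (j.mapSec U (secSum 𝓛 𝓜 U s).1).1 y := fun y => by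
    change j.map y _ = _ • j.map y _
    rw [h1, map_smul]
  have e1 : (secSum 𝓛 𝓜 U (j.infinityAdjoint U k φ)).1.1 x = 0 := by
    rw [secSum_infinityAdjoint, infAdj_fst]
    -- Fibrewise injectivity reads the vanishing off the bracket of 𝓜, so the order r of that
    -- bracket serves both components.
    refine j.injective x ?_
    rw [j.map_br, map_zero]
    exact hr x hx _ i f _ hf h0 h3
  have e2 : (secSum 𝓛 𝓜 U (j.infinityAdjoint U k φ)).2.1 x = 0 := by
    rw [secSum_infinityAdjoint, infAdj_snd, AddSubmonoidClass.coe_finsetSum, Finset.sum_apply]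
    refine Finset.sum_eq_zero fun S _ => hr x hx _ i f
      (if i ∈ S then j.mapSec U (secSum 𝓛 𝓜 U s).1 else (secSum 𝓛 𝓜 U s).2) hf h0 fun y => ?_
    split_ifs
    exacts [h3 y, h2 y]
  exact Prod.ext e1 e2

lemma isLocalLInfty_infinityAdjoint :
    IsLocalLInfty (𝓛.toGradedBundle.prod 𝓜.toGradedBundle) j.infinityAdjoint where
  isLInfty U := (isLInfty_infAdj (𝓛.isLocal.isLInfty U) (𝓜.isLocal.isLInfty U)
    (fun _ _ => j.mapSec_mem_secGr U) (j.mapSec_br U)).transport (secSum 𝓛 𝓜 U)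
      (fun _ _ => mem_secGr_prod) (j.secSum_infinityAdjoint U)
  res U W h k p := by
    refine (secSum 𝓛 𝓜 W).injective ?_
    rw [secSum_infinityAdjoint, secSum_res, secSum_infinityAdjoint]
    simp only [secSum_res]
    exact infAdj_map (𝓛.res h) (𝓜.res h) (𝓛.isLocal.res U W h) (𝓜.isLocal.res U W h)
      (j.mapSec_res h) k _
  polyDiff k := by
    obtain ⟨r, hr⟩ := 𝓜.isLocal.polyDiff k
    exact ⟨r, fun U => j.hasOrderLE_infinityAdjoint (hr U)⟩

lemma isAction_infinityAdjoint : IsAction 𝓛 𝓜 j.infinityAdjoint where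
  isLocal := j.isLocalLInfty_infinityAdjoint
  incl U k m := by
    refine (secSum 𝓛 𝓜 U).injective ?_
    rw [secSum_infinityAdjoint]
    simp only [LinearEquiv.apply_symm_apply]
    exact infAdj_inr (𝓛.isLocal.isLInfty U).uncurved (𝓜.isLocal.isLInfty U).uncurved k m
  proj U k p := by rw [secSum_infinityAdjoint, infAdj_fst]

lemma isLocalFunctional_hamFun :
    IsLocalFunctional 𝓛 𝓜 (CyclicLocalLInfty.hamFun (j.mapSec ⊤ ∘ₗ 𝓛.SecC.subtype)) := by
  intro n
  obtain ⟨r, hr⟩ := 𝓜.exists_order_hamDens n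
  refine ⟨r, (𝓜.hamDens n).compLinearMap fun _ =>
    ((j.mapSec ⊤).prodMap LinearMap.id) ∘ₗ (secSum 𝓛 𝓜 ⊤).toLinearMap,
    fun s => CyclicLocalLInfty.hamDens_smooth _, fun x _ φ i f s hf h0 hφ => ?_, fun p => rfl⟩
  refine hr x _ i f (j.mapSec ⊤ (secSum 𝓛 𝓜 ⊤ s).1, (secSum 𝓛 𝓜 ⊤ s).2) hf h0 (fun y => ?_)
    fun y => congrArg Prod.snd (hφ y)
  have h1 : (secSum 𝓛 𝓜 ⊤ (φ i)).1.1 y = (∏ a, f a y) • (secSum 𝓛 𝓜 ⊤ s).1.1 y :=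
    congrArg Prod.fst (hφ y)
  change j.map y ((secSum 𝓛 𝓜 ⊤ (φ i)).1.1 y) = _ • j.map y _
  rw [h1, map_smul]

theorem actsByClassicalSymmetries : ActsByClassicalSymmetries 𝓛 𝓜 j.infinityAdjoint where
  isAction := j.isAction_infinityAdjoint
  isClassicalSymmetry := by
    have hgr : ∀ i, ∀ a ∈ 𝓛.secCGr i, (j.mapSec ⊤ ∘ₗ 𝓛.SecC.subtype) a ∈ 𝓜.secGr ⊤ i :=
      fun i a ha => j.mapSec_mem_secGr ⊤ ha
    have hbr : ∀ k (a : Fin k → 𝓛.SecC), (j.mapSec ⊤ ∘ₗ 𝓛.SecC.subtype) (𝓛.brC k a) =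
        𝓜.br ⊤ k fun i => (j.mapSec ⊤ ∘ₗ 𝓛.SecC.subtype) (a i) :=
      fun k a => j.mapSec_br ⊤ k fun i => (a i).1
    refine CyclicLocalLInfty.isClassicalSymmetry (isLocal := IsLocalFunctional 𝓛 𝓜) hgr hbr ?_
      j.isLocalFunctional_hamFun
    intro k p
    rw [secSum_infinityAdjoint, infAdj_snd_eq_sub, infAdj_snd_eq_sub]
    rfl

variable (𝓜) in
/-- `𝓜` as a subalgebra of itself. -/
def refl : LocalSubalgebra 𝓜.toLocalLInfty 𝓜 where
  map _ := LinearMap.id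
  injective _ := Function.injective_id
  map_pr _ _ _ := rfl
  smooth _ s := s.2
  map_br _ _ _ _ := rfl

end LocalSubalgebra

end Local

namespace Subalgebra

variable {𝓜 : CyclicLocalLInfty.{u, v} d M} (𝔥 : Subalgebra 𝓜)

lemma isInternal_gr : DirectSum.IsInternal 𝔥.gr := by
  let pr (i : ℤ) : 𝓜.Sec ⊤ →ₗ[ℝ] 𝓜.Sec ⊤ :=
    { toFun := 𝓜.component ⊤ i
      map_add' := fun s t => Subtype.ext (funext fun x => by simp [GradedBundle.component])
      map_smul' := fun c s => Subtype.ext (funext fun x => by simp [GradedBundle.component]) }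
  refine isInternal_comap_subtype 𝔥.carrier (𝓜.secGr ⊤) pr 𝔥.component_mem ?_ ?_ ?_ ?_
  · exact fun i s x => 𝓜.pr_pr i x _
  · exact fun i s hs => Subtype.ext (funext hs)
  · intro i i' hii s hs
    refine Subtype.ext (funext fun x => ?_)
    change 𝓜.pr i x (s.1 x) = 0
    have h := 𝓜.pr_pr_ne i i' x (s.1 x) hii
    rwa [show 𝓜.pr i' x (s.1 x) = s.1 x from hs x] at h
  · refine fun s => ⟨𝓜.degrees, Subtype.ext (funext fun x => ?_)⟩
    let ev : 𝓜.Sec ⊤ →ₗ[ℝ] 𝓜.V x := LinearMap.proj x ∘ₗ (𝓜.Sec ⊤).subtype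
    exact (map_sum ev _ _).trans (𝓜.sum_pr x (s.1 x))

lemma isLInfty_br : IsLInfty 𝔥.gr 𝔥.br where
  isInternal := 𝔥.isInternal_gr
  uncurved := by
    ext v : 1
    refine Subtype.ext ?_
    change 𝓜.br ⊤ 0 _ = 0
    rw [(𝓜.isLocal.isLInfty ⊤).uncurved]
    rfl
  degree k e v hv := (𝓜.isLocal.isLInfty ⊤).degree k e (fun i => (v i).1) hv
  antisymm k σ e v hv :=
    Subtype.ext ((𝓜.isLocal.isLInfty ⊤).antisymm k σ e (fun i => (v i).1) hv)
  jacobi n e v hv := by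
    refine Subtype.ext ?_
    refine (map_insertion 𝔥.carrier.subtype 𝔥.carrier.subtype (f := fun k => 𝔥.br k)
      (g := fun k => 𝔥.br k) (f' := fun k => 𝓜.br ⊤ k) (g' := fun k => 𝓜.br ⊤ k)
      (fun _ _ => rfl) (fun _ _ => rfl) e v).trans ?_
    exact (𝓜.isLocal.isLInfty ⊤).jacobi n e (fun i => (v i).1) hv

lemma res_subtype_br (U : Opens M) (k : ℕ) (a : Fin k → 𝔥.carrier) :
    (𝓜.res (le_top : U ≤ ⊤) ∘ₗ 𝔥.carrier.subtype) (𝔥.br k a) =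
      𝓜.br U k fun i => (𝓜.res (le_top : U ≤ ⊤) ∘ₗ 𝔥.carrier.subtype) (a i) :=
  (𝓜.isLocal.res ⊤ U le_top k fun i => (a i).1).symm

lemma isAction_infinityAdjoint : 𝔥.IsAction 𝔥.infinityAdjoint where
  isLInfty U := isLInfty_infAdj 𝔥.isLInfty_br (𝓜.isLocal.isLInfty U)
    (fun _ _ ha => 𝓜.res_mem_secGr le_top ha) (𝔥.res_subtype_br U)
  res U W h k p := infAdj_map LinearMap.id (𝓜.res h) (fun _ _ => rfl) (𝓜.isLocal.res U W h)
    (fun a => (𝓜.res_res le_top h a.1).symm) k p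
  polyDiff r s X := by
    obtain ⟨o, ho⟩ := 𝓜.isLocal.polyDiff (r + s)
    refine ⟨o, fun U x hx φ i f t hf h0 hφ => ?_⟩
    change (infAdj 𝔥.br (𝓜.br U) _ (r + s) _).2.1 x = 0
    rw [infAdj_snd, AddSubmonoidClass.coe_finsetSum, Finset.sum_apply]
    refine Finset.sum_eq_zero fun S _ => ho U x hx _ (Fin.natAdd r i) f
      (if Fin.natAdd r i ∈ S then 0 else t) hf h0 fun y => ?_
    rw [Fin.append_right]
    split_ifs
    · simp
    · exact hφ y
  incl U k m := infAdj_inr 𝔥.isLInfty_br.uncurved (𝓜.isLocal.isLInfty U).uncurved k m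
  proj U k p := infAdj_fst k p

lemma isLocalFunctional_hamFun :
    𝔥.IsLocalFunctional (CyclicLocalLInfty.hamFun 𝔥.carrier.subtype) := by
  intro r s _ X
  obtain ⟨o, ho⟩ := 𝓜.exists_order_hamDens (r + s)
  -- The elements of 𝔥 are frozen in the first r slots, which leaves a Lagrangian density in the
  -- sections of 𝓜 alone.
  let P : MultilinearMap ℝ (fun _ : Fin s => 𝓜.Sec ⊤) (∀ x : M, Dens d x) :=
    (((𝓜.hamDens (r + s)).domDomCongr finSumFinEquiv.symm).currySum
      fun i => ((X i).1, 0)).compLinearMap fun _ => LinearMap.inr ℝ (𝓜.Sec ⊤) (𝓜.Sec ⊤)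
  have hP : ∀ m, P m = 𝓜.hamDens (r + s) (Fin.append (fun i => ((X i).1, 0)) fun i => (0, m i)) := by
    intro m
    change 𝓜.hamDens (r + s) _ = _
    congr 1
    funext i
    induction i using Fin.addCases <;> simp
  refine ⟨o, P, fun m => hP m ▸ CyclicLocalLInfty.hamDens_smooth _, fun x _ φ i f t hf h0 hφ => ?_,
    fun m => ?_⟩
  · change P φ x = 0
    rw [hP]
    refine ho x _ (Fin.natAdd r i) f (0, t) hf h0 (fun y => ?_) fun y => ?_
    · simp
    · rw [Fin.append_right]
      exact hφ y
  · rw [CyclicLocalLInfty.hamFun_apply, hP]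
    have h := comp_append (fun p : 𝔥.carrier × 𝓜.SecC => (𝔥.carrier.subtype p.1, p.2.1))
      (fun i => (X i, 0)) fun i => (0, m i)
    rw [h]
    rfl

theorem actsByClassicalSymmetries : 𝔥.ActsByClassicalSymmetries 𝔥.infinityAdjoint where
  isAction := 𝔥.isAction_infinityAdjoint
  isClassicalSymmetry := by
    have hgr : ∀ i, ∀ a ∈ 𝔥.gr i, 𝔥.carrier.subtype a ∈ 𝓜.secGr ⊤ i := fun i a ha => ha
    have hbr : ∀ k (a : Fin k → 𝔥.carrier), 𝔥.carrier.subtype (𝔥.br k a) =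
        𝓜.br ⊤ k fun i => 𝔥.carrier.subtype (a i) := fun k a => rfl
    refine CyclicLocalLInfty.isClassicalSymmetry (isLocal := 𝔥.IsLocalFunctional) hgr hbr ?_
      𝔥.isLocalFunctional_hamFun
    intro k p
    have h : 𝓜.res (le_top : (⊤ : Opens M) ≤ ⊤) ∘ₗ 𝔥.carrier.subtype = 𝔥.carrier.subtype :=
      LinearMap.ext fun a => 𝓜.res_self (le_top : (⊤ : Opens M) ≤ ⊤) a.1
    rw [infinityAdjoint, h]

end Subalgebra

end

end

end LInf

open LInf in
theorem mainTheorem2 {d : ℕ} {M : Type*} [TopologicalSpace M]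
    [ChartedSpace (EuclideanSpace ℝ (Fin d)) M] [IsManifold (𝓡 d) ∞ M] [T2Space M]
    [SigmaCompactSpace M] (𝓜 : CyclicLocalLInfty d M) (h𝓜 : 𝓜.PresentsBVTheory) :
    ActsByClassicalSymmetries 𝓜.toLocalLInfty 𝓜 𝓜.infinityAdjoint ∧
    (∀ (𝓗 : LocalLInfty d M) (j : LocalSubalgebra 𝓗 𝓜),
      ActsByClassicalSymmetries 𝓗 𝓜 j.infinityAdjoint) ∧
    (∀ 𝔥 : Subalgebra 𝓜, 𝔥.ActsByClassicalSymmetries 𝔥.infinityAdjoint) :=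
  -- The action of 𝓜 on itself is the case of the identity inclusion, whose map on sections is
  -- definitionally the identity.
  ⟨(LocalSubalgebra.refl 𝓜).actsByClassicalSymmetries, fun _ j => j.actsByClassicalSymmetries,
    fun 𝔥 => 𝔥.actsByClassicalSymmetries⟩
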